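/- Let $\mathbb K$ be a field and $q$ a formal variable of degree $2$. Write $|a|$ for the degree of a homogeneous element and $\|a\| = |a|-1$. A strictly unital curved $A_\infty$-algebra $A_q$ consists of a $\mathbb Z$-graded $\mathbb K$-vector space $A$, multilinear operations $\mu^d_{A_q} = \sum_{m\ge 0} q^m \mu^{d,(m)} : A^{\otimes d} \to A[[q]]$ of degree $2-d$ for all $d \ge 0$ (so $\mu^{d,(m)}: A^{\otimes d} \to A$ has degree $2-d-2m$), and an element $e_A \in A^0$, such that $\mu^{0,(0)} = 0$, the (extended $q$-linearly) curved $A_\infty$-equations $$\sum_{i,j}(-1)^{\|a_1\|+\dots+\|a_i\|}\mu_{A_q}^{d-j+1}(a_1,\dots,a_i,\mu_{A_q}^j(a_{i+1},\dots,a_{i+j}),\dots,a_d)=0 \qquad (d \ge 0)$$ hold, and $\mu^2_{A_q}(e_A,a)=a$, $\mu^2_{A_q}(a,e_A)=(-1)^{|a|}a$, $\mu^d_{A_q}(\dots,e_A,\dots)=0$ for $d\neq 2$. Its reduction at $q=0$ is an ordinary strictly unital $A_\infty$-algebra $A$, and $A_q$ is called a curved deformation of $A$. The Hochschild cohomology $\mathit{HH}^*(A)$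 is the cohomology of the normalized complex $\bar C^*(A)=\mathrm{hom}_{\mathbb K}(T(\bar A[1]),A)$, $\bar A=A/\mathbb K e_A$, whose degree $n$ cochains are sequences $(\phi^l)_{l \ge 0}$ of maps $\phi^l:\bar A^{\otimes l}\to A$ of degree $n-l$, with the differential $$(d\phi)^l(a_1,\dots,a_l)=\sum_{i,j}(-1)^{(n-1)(\|a_1\|+\dots+\|a_i\|)}\mu_A^{l-j+1}(a_1,\dots,a_i,\phi^j(a_{i+1},\dots,a_{i+j}),\dots,a_l)$$ $$\qquad +\sum_{i,j}(-1)^{\|a_1\|+\dots+\|a_i\|+n}\phi^{l-j+1}(a_1,\dots,a_i,\mu_A^j(a_{i+1},\dots,a_{i+j}),\dots,a_l).$$ A curved $A_\infty$-homomorphism $\Phi_q:A_q\to B_q$ consists of multilinear maps $\Phi_q^d:A^{\otimes d}\to B[[q]]$ of degree $1-d$ for all $d\ge 0$, where $\Phi_q^0$ has zero $q$-constant part, such that $\Phi^1_q(e_A)=e_B$, $\Phi_q^d(\dots,e_A,\dots)=0$ for $d\ne 1$, and for all $d \ge 0$ $$\sum_{r}\sum_{i_1+\dots+i_r=d}\mu^r_{B_q}(\Phi_q^{i_1}(a_1,\dots,a_{i_1}),\dots,\Phi_q^{i_r}(\dots,a_d))=\sum_{i,j}(-1)^{\|a_1\|+\dots+\|a_i\|}\Phi_q^{d-j+1}(a_1,\dots,a_i,\mu^j_{A_q}(a_{i+1},\dots,a_{i+j}),\dots,a_d).$$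 It is a filtered quasi-isomorphism if its $q=0$ reduction is a quasi-isomorphism, that is, if $\Phi^1_q|_{q=0}:(A,\mu^1_A)\to(B,\mu^1_B)$ induces an isomorphism on cohomology. Given a differential graded algebra $B$ over $\mathbb K$ and a central element $W\in B^0$ with $dW=0$, there is a strictly unital curved $A_\infty$-algebra $B_q$ with underlying graded space $B$, unit $e_B = 1$, and operations $\mu^0=qW$, $\mu^1(b)=db$, $\mu^2(b_1,b_2)=(-1)^{|b_1|}b_1b_2$, $\mu^d=0$ for $d\ge 3$. **Proposition.** Let $A_q$ be a strictly unital curved $A_\infty$-deformation of $A$ such that $\mathit{HH}^{2k}(A)=0$ for all integers $k<0$. Then there are a differential graded algebra $B$ over $\mathbb K$ (nonzero if $A$ is nonzero), a central element $W\in B^0$ with $dW=0$, and a filtered quasi-isomorphism $\Phi_q:A_q\to B_q$ to the associated curved algebra $B_q$ with curvature $qW$. -/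

import Mathlib

open Finset DirectSum

universe u v

noncomputable section

/-! ### Operations on a graded vector space

A graded `K`-vector space is a vector space `V` with an internal grading `𝒜 : ℤ → Submodule K V`
(`V = ⨁ 𝒜 n`). -/

section Operations

variable {K : Type*} [Field K]

/-- A sequence of multilinear operations `φ^d : V^{⊗ d} → V'`, one for each `d ≥ 0`. -/
abbrev MultiOp (K V V' : Type*) [Field K] [AddCommGroup V] [Module K V] [AddCommGroup V']
    [Module K V'] : Type _ :=
  ∀ d : ℕ, MultilinearMap K (fun _ : Fin d => V) V'

variable {V : Type*} [AddCommGroup V] [Module K V] {V' : Type*} [AddCommGroup V'] [Module K V']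

namespace MultiOp

/-- `φ.ev [a₁, …, a_d] = φ^d(a₁, …, a_d)`. -/
def ev (φ : MultiOp K V V') (l : List V) : V' := φ l.length l.get

/-- The linear map `φ¹`. -/
def lin (φ : MultiOp K V V') : V →ₗ[K] V' :=
  (MultilinearMap.ofSubsingleton K V V' (0 : Fin 1)).symm (φ 1)

/-- `φ` has degree `k` as a cochain: `φ^d` is a map of degree `k - d`, for every `d`. -/
def HasDegree (𝒜 : ℤ → Submodule K V) (ℬ : ℤ → Submodule K V') (k : ℤ) (φ : MultiOp K V V') :
    Prop :=
  ∀ (d : ℕ) (n : Fin d → ℤ) (a : Fin d → V), (∀ i, a i ∈ 𝒜 (n i)) →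
    φ d a ∈ ℬ (∑ i, n i + k - d)

theorem ev_eq (φ : MultiOp K V V') {l : List V} {d : ℕ} (h : l.length = d) :
    φ.ev l = φ d (fun i => l.get (i.cast h.symm)) := by
  subst h; rfl

theorem ev_add_left (φ ψ : MultiOp K V V') (l : List V) : (φ + ψ).ev l = φ.ev l + ψ.ev l := rfl

theorem ev_smul_left (c : K) (φ : MultiOp K V V') (l : List V) : (c • φ).ev l = c • φ.ev l := rfl

/-- `ev` as a linear map. -/
def evₗ : MultiOp K V V' →ₗ[K] (List V → V') where
  toFun φ := φ.ev
  map_add' _ _ := rfl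
  map_smul' _ _ := rfl

theorem ev_insert (φ : MultiOp K V V') (l₁ l₂ : List V) (x : V) :
    φ.ev (l₁ ++ x :: l₂) = φ (l₁.length + l₂.length + 1)
      (Function.update (fun i : Fin (l₁.length + l₂.length + 1) => (l₁ ++ (0 : V) :: l₂).get
        (i.cast (by simp; omega))) ⟨l₁.length, by omega⟩ x) := by
  rw [ev_eq φ (d := l₁.length + l₂.length + 1) (by simp; omega)]
  congr 1
  funext i
  by_cases h : i = ⟨l₁.length, by omega⟩
  · subst h; simp
  · rw [Function.update_of_ne h]
    have h' : (i : ℕ) ≠ l₁.length := fun hh => h (Fin.ext hh)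
    rcases lt_or_gt_of_ne h' with h2 | h2
    · simp [List.getElem_append_left, h2]
    · simp only [List.get_eq_getElem, Fin.val_cast]
      rw [List.getElem_append_right h2.le, List.getElem_append_right h2.le]
      obtain ⟨c, hc⟩ : ∃ c, (i : ℕ) - l₁.length = c + 1 := ⟨(i : ℕ) - l₁.length - 1, by omega⟩
      simp [hc]

theorem ev_insert_add (φ : MultiOp K V V') (l₁ l₂ : List V) (x y : V) :
    φ.ev (l₁ ++ (x + y) :: l₂) = φ.ev (l₁ ++ x :: l₂) + φ.ev (l₁ ++ y :: l₂) := by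
  simp only [ev_insert, MultilinearMap.map_update_add]

theorem ev_insert_zero (φ : MultiOp K V V') (l₁ l₂ : List V) : φ.ev (l₁ ++ 0 :: l₂) = 0 := by
  rw [ev_insert]
  exact MultilinearMap.map_coord_zero _ ⟨l₁.length, by omega⟩ (by simp)

theorem ev_insert_smul (φ : MultiOp K V V') (l₁ l₂ : List V) (c : K) (x : V) :
    φ.ev (l₁ ++ (c • x) :: l₂) = c • φ.ev (l₁ ++ x :: l₂) := by
  simp only [ev_insert, MultilinearMap.map_update_smul]

end MultiOp

/-- The linear map `a ↦ (-1)^{f n} a` for homogeneous `a` of degree `n` (see `signOp_of_mem`). -/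
def signOp (𝒜 : ℤ → Submodule K V) [Decomposition 𝒜] (f : ℤ → ℤ) : V →ₗ[K] V :=
  DirectSum.toModule K ℤ V (fun n => ((f n).negOnePow : ℤ) • (𝒜 n).subtype) ∘ₗ
    (decomposeLinearEquiv 𝒜).toLinearMap

theorem signOp_of_mem (𝒜 : ℤ → Submodule K V) [Decomposition 𝒜] (f : ℤ → ℤ) {n : ℤ} {a : V}
    (ha : a ∈ 𝒜 n) : signOp 𝒜 f a = ((f n).negOnePow : ℤ) • a := by
  have : decompose 𝒜 a = DirectSum.of (fun i => 𝒜 i) n ⟨a, ha⟩ := decompose_of_mem 𝒜 ha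
  simp only [signOp, LinearMap.comp_apply, LinearEquiv.coe_coe, decomposeLinearEquiv_apply, this]
  rw [← DirectSum.lof_eq_of K, DirectSum.toModule_lof]
  simp

/-- `a ↦ (-1)^{|a|} a`. -/
abbrev degSign (𝒜 : ℤ → Submodule K V) [Decomposition 𝒜] : V →ₗ[K] V := signOp 𝒜 (fun n => n)

/-- `a ↦ (-1)^{k ‖a‖} a`, where `‖a‖ = |a| - 1` is the reduced degree. -/
abbrev koszul (𝒜 : ℤ → Submodule K V) [Decomposition 𝒜] (k : ℤ) : V →ₗ[K] V :=
  signOp 𝒜 (fun n => k * (n - 1))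

/-- With `d` the length of the list, the expression
`∑_{i,j} (-1)^{k (‖a₁‖ + ⋯ + ‖a_i‖)} φ^{d-j+1}(a₁, …, a_i, ψ^j(a_{i+1}, …, a_{i+j}), …, a_d)`
(extended multilinearly from homogeneous elements), where `k` is the reduced degree of `ψ`. -/
def insertSum (𝒜 : ℤ → Submodule K V) [Decomposition 𝒜] (k : ℤ) (φ : MultiOp K V V')
    (ψ : MultiOp K V V) (l : List V) : V' :=
  ∑ i ∈ range (l.length + 1), ∑ j ∈ range (l.length - i + 1),
    φ.ev ((l.take i).map (koszul 𝒜 k) ++ ψ.ev ((l.drop i).take j) :: l.drop (i + j))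

/-- The cohomology `ker d / im d` of an endomorphism `d`; in the total space of a graded complex
this is the direct sum of the cohomologies in the individual degrees. -/
abbrev Cohomology (d : V →ₗ[K] V) : Type _ :=
  LinearMap.ker d ⧸ (LinearMap.range d).submoduleOf (LinearMap.ker d)

/-- The map on cohomology induced by a chain map. -/
def cohomologyMap (d : V →ₗ[K] V) (d' : V' →ₗ[K] V') (f : V →ₗ[K] V')
    (hf : ∀ a, f (d a) = d' (f a)) : Cohomology d →ₗ[K] Cohomology d' :=
  Submodule.mapQ _ _
    (f.restrict (p := LinearMap.ker d) (q := LinearMap.ker d') (fun a ha => by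
      rw [LinearMap.mem_ker] at ha ⊢
      rw [← hf, ha, map_zero]))
    (by
      rintro ⟨a, ha⟩ ⟨b, hb⟩
      exact ⟨f b, by
        have hb' : d b = a := hb
        simp [← hf, hb']⟩)

/-- `f` is a chain map which induces an isomorphism on cohomology. -/
def IsQuasiIso (d : V →ₗ[K] V) (d' : V' →ₗ[K] V') (f : V →ₗ[K] V') : Prop :=
  ∃ hf : ∀ a, f (d a) = d' (f a), Function.Bijective (cohomologyMap d d' f hf)

end Operations

/-! ### `A_∞`-algebras and Hochschild cohomology -/

section AInf

variable {K : Type*} [Field K] {V : Type*} [AddCommGroup V] [Module K V]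

/-- A strictly unital (uncurved) `A_∞`-algebra structure on the graded vector space `𝒜`. -/
structure AInfAlgebra (𝒜 : ℤ → Submodule K V) [Decomposition 𝒜] where
  μ : MultiOp K V V
  degree : μ.HasDegree 𝒜 𝒜 2
  uncurved : μ.ev [] = 0
  assoc : ∀ l : List V, insertSum 𝒜 1 μ μ l = 0
  e : V
  e_mem : e ∈ 𝒜 0
  e_left : ∀ a, μ.ev [e, a] = a
  e_right : ∀ a, μ.ev [a, e] = degSign 𝒜 a
  e_other : ∀ l : List V, l.length ≠ 2 → e ∈ l → μ.ev l = 0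

namespace AInfAlgebra

variable {𝒜 : ℤ → Submodule K V} [Decomposition 𝒜] (A : AInfAlgebra 𝒜)

/-- The degree `n` part of the normalized Hochschild complex `hom(T(Ā[1]), A)`, `Ā = A / K e`:
multilinear maps on `Ā` are identified with multilinear maps on `A` that vanish whenever one of
the entries is `e`. -/
def cochains (n : ℤ) : Submodule K (MultiOp K V V) where
  carrier := {φ | φ.HasDegree 𝒜 𝒜 n ∧ ∀ l : List V, A.e ∈ l → φ.ev l = 0}
  zero_mem' := ⟨fun _ _ _ _ => Submodule.zero_mem _, fun _ _ => rfl⟩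
  add_mem' := fun {φ ψ} hφ hψ =>
    ⟨fun d n a h => Submodule.add_mem _ (hφ.1 d n a h) (hψ.1 d n a h), fun l hl => by
      rw [MultiOp.ev_add_left, hφ.2 l hl, hψ.2 l hl, add_zero]⟩
  smul_mem' := fun c φ hφ =>
    ⟨fun d n a h => Submodule.smul_mem _ c (hφ.1 d n a h), fun l hl => by
      rw [MultiOp.ev_smul_left, hφ.2 l hl, smul_zero]⟩

/-- The Hochschild differential of a cochain `φ` of degree `n`, as a function of `(a₁, …, a_d)`:
`∑ (-1)^{(n-1)(‖a₁‖+⋯+‖a_i‖)} μ(a₁, …, a_i, φ(a_{i+1}, …, a_{i+j}), …, a_d)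
  + ∑ (-1)^{‖a₁‖+⋯+‖a_i‖ + n} φ(a₁, …, a_i, μ(a_{i+1}, …, a_{i+j}), …, a_d)`. -/
def differential (n : ℤ) : MultiOp K V V →ₗ[K] (List V → V) where
  toFun φ l := insertSum 𝒜 (n - 1) A.μ φ l + (n.negOnePow : ℤ) • insertSum 𝒜 1 φ A.μ l
  map_add' φ ψ := by
    funext l
    simp only [insertSum, MultiOp.ev_add_left, MultiOp.ev_insert_add, sum_add_distrib, smul_add,
      Pi.add_apply]
    abel
  map_smul' c φ := by
    funext l
    simp only [insertSum, MultiOp.ev_smul_left, MultiOp.ev_insert_smul, ← smul_sum,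
      RingHom.id_apply, Pi.smul_apply, smul_add, smul_comm c]

/-- Hochschild cocycles of degree `n`. -/
def cocycles (n : ℤ) : Submodule K (MultiOp K V V) :=
  A.cochains n ⊓ LinearMap.ker (A.differential n)

/-- Hochschild coboundaries of degree `n`: cochains `φ` such that `φ = dψ` for a cochain `ψ` of
degree `n - 1`. -/
def coboundaries (n : ℤ) : Submodule K (MultiOp K V V) :=
  A.cochains n ⊓
    ((A.cochains (n - 1)).map (A.differential (n - 1))).comap
      MultiOp.evₗ

/-- The Hochschild cohomology `HH^n(A)`. -/
abbrev HH (n : ℤ) : Type _ := A.cocycles n ⧸ (A.coboundaries n).submoduleOf (A.cocycles n)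

end AInfAlgebra

/-! ### Curved deformations -/

/-- A strictly unital curved `A_∞`-algebra `A_q`, with a formal variable `q` of degree `2`. The
operations `A^{⊗ d} → A[[q]]` of degree `2 - d` are given by their `q`-expansion
`∑_m q^m μ_m^d`, so that `μ_m^d : A^{⊗ d} → A` has degree `2 - 2m - d`. The unit `e` is
`q`-constant, and the equations hold for each power of `q`. -/
structure CurvedAInfAlgebra (𝒜 : ℤ → Submodule K V) [Decomposition 𝒜] where
  μ : ℕ → MultiOp K V V
  degree : ∀ m : ℕ, (μ m).HasDegree 𝒜 𝒜 (2 - 2 * m)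
  curvature : (μ 0).ev [] = 0
  assoc : ∀ (m : ℕ) (l : List V), ∑ p ∈ antidiagonal m, insertSum 𝒜 1 (μ p.1) (μ p.2) l = 0
  e : V
  e_mem : e ∈ 𝒜 0
  e_left : ∀ m a, (μ m).ev [e, a] = if m = 0 then a else 0
  e_right : ∀ m a, (μ m).ev [a, e] = if m = 0 then degSign 𝒜 a else 0
  e_other : ∀ (m : ℕ) (l : List V), l.length ≠ 2 → e ∈ l → (μ m).ev l = 0

/-- The `q = 0` reduction of a curved `A_∞`-algebra. -/
def CurvedAInfAlgebra.reduction {𝒜 : ℤ → Submodule K V} [Decomposition 𝒜]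
    (A : CurvedAInfAlgebra 𝒜) : AInfAlgebra 𝒜 where
  μ := A.μ 0
  degree := by simpa using A.degree 0
  uncurved := A.curvature
  assoc l := by simpa using A.assoc 0 l
  e := A.e
  e_mem := A.e_mem
  e_left a := by simpa using A.e_left 0 a
  e_right a := by simpa using A.e_right 0 a
  e_other := A.e_other 0

variable {V' : Type*} [AddCommGroup V'] [Module K V']

/-- The `t`-th of the consecutive blocks of lengths `i 0, i 1, …` of the list `l`. -/
def block {α : Type*} (l : List α) {r : ℕ} (i : Fin r → ℕ) (t : Fin r) : List α :=
  (l.drop (∑ s ∈ Iio t, i s)).take (i t)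

/-- A strictly unital curved `A_∞`-homomorphism `Φ_q : A_q → B_q`, given by its `q`-expansion
`∑_m q^m Φ_m^d`, where `Φ_m^d : A^{⊗ d} → B` has degree `1 - 2m - d`. For `d` inputs, the equation
is
`∑_r ∑_{i_1 + ⋯ + i_r = d} μ_{B_q}^r(Φ_q^{i_1}(a₁, …), …, Φ_q^{i_r}(…, a_d))
  = ∑_{i,j} (-1)^{‖a₁‖+⋯+‖a_i‖} Φ_q^{d-j+1}(a₁, …, a_i, μ_{A_q}^j(a_{i+1}, …), …, a_d)`,
with `i_k = 0` allowed. Because `Φ_0^0 = 0`, only terms with `r ≤ m + d` contribute to its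
`q^m`-coefficient. -/
structure CurvedAInfHom {𝒜 : ℤ → Submodule K V} [Decomposition 𝒜] {ℬ : ℤ → Submodule K V'}
    [Decomposition ℬ] (A : CurvedAInfAlgebra 𝒜) (B : CurvedAInfAlgebra ℬ) where
  Φ : ℕ → MultiOp K V V'
  degree : ∀ m : ℕ, (Φ m).HasDegree 𝒜 ℬ (1 - 2 * m)
  curvature : (Φ 0).ev [] = 0
  equation : ∀ (m : ℕ) (l : List V),
    ∑ r ∈ range (m + l.length + 1), ∑ i ∈ Finset.Nat.antidiagonalTuple r l.length,
      ∑ k ∈ Finset.Nat.antidiagonalTuple (r + 1) m,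
        B.μ (k 0) r (fun t : Fin r => (Φ (k t.succ)).ev (block l i t)) =
    ∑ p ∈ antidiagonal m, insertSum 𝒜 1 (Φ p.1) (A.μ p.2) l
  unit : ∀ m, (Φ m).ev [A.e] = if m = 0 then B.e else 0
  unit_other : ∀ (m : ℕ) (l : List V), l.length ≠ 1 → A.e ∈ l → (Φ m).ev l = 0

/-- `Φ_q` is a filtered quasi-isomorphism if its `q = 0` reduction is a quasi-isomorphism, meaning
that the linear part of that reduction is a quasi-isomorphism of complexes. -/
def CurvedAInfHom.IsFilteredQuasiIso {𝒜 : ℤ → Submodule K V} [Decomposition 𝒜]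
    {ℬ : ℤ → Submodule K V'} [Decomposition ℬ] {A : CurvedAInfAlgebra 𝒜}
    {B : CurvedAInfAlgebra ℬ} (Φ : CurvedAInfHom A B) : Prop :=
  IsQuasiIso (A.μ 0).lin (B.μ 0).lin (Φ.Φ 0).lin

end AInf

/-! ### Differential graded algebras with a central element -/

section DG

variable {K : Type*} [Field K] {B : Type*} [Ring B] [Algebra K B]

/-- A differential making the graded algebra `ℬ` into a dga. -/
structure DGStructure (ℬ : ℤ → Submodule K B) [GradedAlgebra ℬ] where
  d : B →ₗ[K] B
  d_mem : ∀ n a, a ∈ ℬ n → d a ∈ ℬ (n + 1)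
  d_d : ∀ a, d (d a) = 0
  leibniz : ∀ n a b, a ∈ ℬ n → d (a * b) = d a * b + (n.negOnePow : ℤ) • (a * d b)

variable {ℬ : ℤ → Submodule K B} [GradedAlgebra ℬ]

/-- `W` is a closed central element of degree `0`. -/
structure DGStructure.IsCentral (D : DGStructure ℬ) (W : B) : Prop where
  mem : W ∈ ℬ 0
  closed : D.d W = 0
  comm : ∀ a, W * a = a * W

/-- The operations of the curved dga with curvature `q W`: `μ¹(a) = d a`,
`μ²(a₁, a₂) = (-1)^{|a₁|} a₁ a₂`, `μ⁰ = q W`. -/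
def DGStructure.curvedOp (D : DGStructure ℬ) (W : B) : ℕ → MultiOp K B B
  | 0, 1 => MultilinearMap.ofSubsingleton K B B (0 : Fin 1) D.d
  | 0, 2 => (MultilinearMap.mkPiAlgebraFin K 2 B).compLinearMap ![degSign ℬ, LinearMap.id]
  | 1, 0 => MultilinearMap.constOfIsEmpty K _ W
  | _, _ => 0

namespace DGStructure

variable (D : DGStructure ℬ) (W : B)

theorem curvedOp_nil (m : ℕ) : (D.curvedOp W m).ev [] = if m = 1 then W else 0 := by
  match m with
  | 0 => rfl
  | 1 => rfl
  | _ + 2 => simp only [show ∀ n : ℕ, n + 2 ≠ 1 by omega, if_false]; rfl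

theorem curvedOp_one (m : ℕ) (a : B) :
    (D.curvedOp W m).ev [a] = if m = 0 then D.d a else 0 := by
  match m with
  | 0 => rfl
  | 1 => rfl
  | _ + 2 => rfl

theorem curvedOp_two (m : ℕ) (a b : B) :
    (D.curvedOp W m).ev [a, b] = if m = 0 then degSign ℬ a * b else 0 := by
  match m with
  | 0 =>
    change ((MultilinearMap.mkPiAlgebraFin K 2 B).compLinearMap ![degSign ℬ, LinearMap.id])
      [a, b].get = _
    simp [MultilinearMap.mkPiAlgebraFin_apply]
  | 1 => rfl
  | _ + 2 => rfl

theorem curvedOp_apply_three (m n : ℕ) : D.curvedOp W m (n + 3) = 0 := by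
  match m with
  | 0 => rfl
  | 1 => rfl
  | _ + 2 => rfl

theorem curvedOp_three (m : ℕ) (l : List B) (h : 3 ≤ l.length) : (D.curvedOp W m).ev l = 0 := by
  obtain ⟨n, hn⟩ : ∃ n, l.length = n + 3 := ⟨l.length - 3, by omega⟩
  rw [MultiOp.ev_eq _ hn, curvedOp_apply_three]; rfl

theorem curvedOp_succ (m : ℕ) (l : List B) (h : l ≠ []) : (D.curvedOp W (m + 1)).ev l = 0 := by
  match l with
  | [_] => simp [curvedOp_one]
  | [_, _] => simp [curvedOp_two]
  | _ :: _ :: _ :: _ => exact curvedOp_three _ _ _ _ (by simp)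

theorem insertSum_curvedOp_long (p q : ℕ) (l : List B) (h : 4 ≤ l.length) :
    insertSum ℬ 1 (D.curvedOp W p) (D.curvedOp W q) l = 0 := by
  refine sum_eq_zero fun i hi => sum_eq_zero fun j hj => ?_
  rw [mem_range] at hi hj
  by_cases h3 : 3 ≤ j
  · rw [curvedOp_three D W q _ (by simp; omega), MultiOp.ev_insert_zero]
  · exact curvedOp_three D W p _ (by simp; omega)

theorem insertSum_curvedOp_succ (p : ℕ) (ψ : MultiOp K B B) (l : List B) :
    insertSum ℬ 1 (D.curvedOp W (p + 1)) ψ l = 0 :=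
  sum_eq_zero fun i _ => sum_eq_zero fun j _ => curvedOp_succ _ _ _ _ (by simp)

theorem homogeneous_induction {P : B → Prop} (h0 : P 0) (hadd : ∀ a b, P a → P b → P (a + b))
    (hom : ∀ n a, a ∈ ℬ n → P a) (a : B) : P a :=
  Decomposition.inductionOn ℬ h0 (fun {n} m => hom n m m.2) (fun m m' => hadd m m') a

theorem degSign_mul (a b : B) : degSign ℬ (a * b) = degSign ℬ a * degSign ℬ b := by
  induction a using homogeneous_induction (ℬ := ℬ) with
  | h0 => simp
  | hadd a a' h h' => simp only [add_mul, map_add, h, h']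
  | hom n a ha =>
    induction b using homogeneous_induction (ℬ := ℬ) with
    | h0 => simp
    | hadd a a' h h' => simp only [mul_add, map_add, h, h']
    | hom m b hb =>
      rw [signOp_of_mem ℬ _ ha, signOp_of_mem ℬ _ hb, signOp_of_mem ℬ _ (SetLike.mul_mem_graded ha hb),
        Int.negOnePow_add, Units.val_mul, smul_mul_smul_comm]

theorem koszul_one (a : B) : koszul ℬ 1 a = - degSign ℬ a := by
  induction a using homogeneous_induction (ℬ := ℬ) with
  | h0 => simp
  | hadd a a' h h' => simp only [map_add, h, h']; abel
  | hom n a ha =>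
    rw [signOp_of_mem ℬ _ ha, signOp_of_mem ℬ _ ha, one_mul, Int.negOnePow_sub, Int.negOnePow_one]
    simp

theorem degSign_degSign (a : B) : degSign ℬ (degSign ℬ a) = a := by
  induction a using homogeneous_induction (ℬ := ℬ) with
  | h0 => simp
  | hadd a a' h h' => simp only [map_add, h, h']
  | hom n a ha =>
    rw [signOp_of_mem ℬ _ ha, map_zsmul, signOp_of_mem ℬ _ ha, smul_smul, ← Units.val_mul,
      ← Int.negOnePow_add]
    simp [Int.negOnePow_even]

theorem degSign_d (a : B) : degSign ℬ (D.d a) = - D.d (degSign ℬ a) := by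
  induction a using homogeneous_induction (ℬ := ℬ) with
  | h0 => simp
  | hadd a a' h h' => simp only [map_add, h, h']; abel
  | hom n a ha =>
    rw [signOp_of_mem ℬ _ ha, signOp_of_mem ℬ _ (D.d_mem n a ha), Int.negOnePow_add,
      Int.negOnePow_one, map_zsmul]
    simp

theorem leibniz' (a b : B) : D.d (a * b) = D.d a * b + degSign ℬ a * D.d b := by
  induction a using homogeneous_induction (ℬ := ℬ) with
  | h0 => simp
  | hadd a a' h h' => simp only [add_mul, map_add, h, h']; abel
  | hom n a ha =>
    rw [signOp_of_mem ℬ _ ha, D.leibniz n a b ha, smul_mul_assoc]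

theorem degSign_of_zero {a : B} (ha : a ∈ ℬ 0) : degSign ℬ a = a := by
  rw [signOp_of_mem ℬ _ ha]; simp

theorem d_one : D.d 1 = 0 := by
  have h := D.leibniz' 1 1
  rw [degSign_of_zero (SetLike.one_mem_graded ℬ)] at h
  simpa using h

theorem degSign_mem {n : ℤ} {a : B} (ha : a ∈ ℬ n) : degSign ℬ a ∈ ℬ n := by
  rw [signOp_of_mem ℬ _ ha]
  exact zsmul_mem ha _

theorem curvedOp_degree {W : B} (hW : D.IsCentral W) (m : ℕ) :
    (D.curvedOp W m).HasDegree ℬ ℬ (2 - 2 * m) := by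
  intro d n a ha
  obtain _ | _ | m := m
  · obtain _ | _ | _ | d := d
    · exact Submodule.zero_mem _
    · have h := D.d_mem _ _ (ha 0)
      have h2 : ∑ i, n i + (2 - 2 * ((0 : ℕ) : ℤ)) - ((0 + 1 : ℕ) : ℤ) = n 0 + 1 := by
        simp; ring
      rw [h2]; exact h
    · have h := SetLike.mul_mem_graded (degSign_mem (ha 0)) (ha 1)
      have h2 : ∑ i, n i + (2 - 2 * ((0 : ℕ) : ℤ)) - ((0 + 1 + 1 : ℕ) : ℤ) = n 0 + n 1 := by
        rw [Fin.sum_univ_two]; push_cast; ring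
      have h3 : D.curvedOp W 0 (0 + 1 + 1) a = degSign ℬ (a 0) * a 1 := by
        change ((MultilinearMap.mkPiAlgebraFin K 2 B).compLinearMap
          ![degSign ℬ, LinearMap.id]) a = _
        simp [MultilinearMap.mkPiAlgebraFin_apply]
      rw [h2, h3]; exact h
    · rw [curvedOp_apply_three]; exact Submodule.zero_mem _
  · obtain _ | d := d
    · have h2 : ∑ i, n i + (2 - 2 * ((0 + 1 : ℕ) : ℤ)) - ((0 : ℕ) : ℤ) = 0 := by simp
      rw [h2]; exact hW.mem
    · have h3 : D.curvedOp W (0 + 1) (d + 1) = 0 := rfl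
      rw [h3]; exact Submodule.zero_mem _
  · have h3 : D.curvedOp W (m + 1 + 1) d = 0 := by cases d <;> rfl
    rw [h3]; exact Submodule.zero_mem _

theorem insertSum_curvedOp_two (m : ℕ) (a b : B) :
    insertSum ℬ 1 (D.curvedOp W 0) (D.curvedOp W m) [a, b] = 0 := by
  by_cases h0 : m = 0 <;>
  simp [insertSum, curvedOp_nil, curvedOp_one, curvedOp_two, curvedOp_three, sum_range_succ,
    h0, koszul_one, degSign_degSign, leibniz', degSign_d]

theorem insertSum_curvedOp_three (m : ℕ) (a b c : B) :
    insertSum ℬ 1 (D.curvedOp W 0) (D.curvedOp W m) [a, b, c] = 0 := by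
  by_cases h0 : m = 0 <;>
  simp [insertSum, curvedOp_nil, curvedOp_one, curvedOp_two, curvedOp_three, sum_range_succ,
    h0, koszul_one, degSign_degSign, degSign_mul, mul_assoc]

theorem curvedOp_assoc {W : B} (hW : D.IsCentral W) (m : ℕ) (l : List B) :
    ∑ p ∈ antidiagonal m, insertSum ℬ 1 (D.curvedOp W p.1) (D.curvedOp W p.2) l = 0 := by
  have key : ∑ p ∈ antidiagonal m, insertSum ℬ 1 (D.curvedOp W p.1) (D.curvedOp W p.2) l =
      insertSum ℬ 1 (D.curvedOp W 0) (D.curvedOp W m) l := by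
    refine sum_eq_single (0, m) ?_ (by simp)
    rintro ⟨p, q⟩ hp hne
    rw [HasAntidiagonal.mem_antidiagonal] at hp
    obtain _ | p := p
    · simp_all
    · exact insertSum_curvedOp_succ D W p _ l
  rw [key]
  match l with
  | [] =>
    simp [insertSum, curvedOp_nil, curvedOp_one, apply_ite, hW.closed]
  | [a] =>
    by_cases h0 : m = 0 <;> by_cases h1 : m = 1 <;>
    simp [insertSum, curvedOp_nil, curvedOp_one, curvedOp_two, sum_range_succ, h0, h1, D.d_d,
      degSign_of_zero hW.mem, hW.comm, koszul_one, degSign_degSign]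
  | [a, b] => exact insertSum_curvedOp_two D W m a b
  | [a, b, c] => exact insertSum_curvedOp_three D W m a b c
  | _ :: _ :: _ :: _ :: _ => exact insertSum_curvedOp_long D W 0 m _ (by simp)

/-- The curved `A_∞`-algebra obtained from a dga and a central element `W`, with curvature
`q W`. -/
def curved {W : B} (hW : D.IsCentral W) : CurvedAInfAlgebra ℬ where
  μ := D.curvedOp W
  degree := D.curvedOp_degree hW
  curvature := by simp [curvedOp_nil]
  assoc := D.curvedOp_assoc hW
  e := 1
  e_mem := SetLike.one_mem_graded ℬ
  e_left m a := by
    rw [curvedOp_two, degSign_of_zero (SetLike.one_mem_graded ℬ), one_mul]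
  e_right m a := by rw [curvedOp_two, mul_one]
  e_other m l hl he := by
    match l with
    | [] => simp at he
    | [a] =>
      obtain rfl : 1 = a := by simpa using he
      simp [curvedOp_one, D.d_one]
    | [_, _] => simp at hl
    | _ :: _ :: _ :: _ => exact curvedOp_three _ _ _ _ (by simp)

end DGStructure

end DG

end

/-! The algebra `B` is a cobar construction, built so that a homomorphism out of `A_q` exists
tautologically. Fix a homogeneous basis of `A` containing the unit `e`. Take the free algebra on
letters `τ(m,u)`, one for each exponent `m` of `q` and each word `u` in the remaining basis vectors,
the trivial pair `(0,[])` excluded, and adjoin a central polynomial generator `W`. Put `Φ_m(u) =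
τ(m,u)` and `Φ_0(e) = 1`. The homomorphism equation on basis words without `e`, together with `dW =
0` and the Leibniz rule, then forces the differential: `dτ(m,u)` is the sum of the insertions of `μ`
into `u`, minus the products `± τ τ` over all ways of cutting `(m,u)` in two, minus `W` if `(m,u) =
(1,[])`. On words containing `e` the equation follows from strict unitality (`d_phi`). The identity
`d² = 0` combines the curved `A_∞`-equations, coassociativity of deconcatenation and centrality of
`W` (`sum_ins_ins`, `d_d_phi`).

It remains to show that `incl`, the linear part of `Φ_0`, is a quasi-isomorphism. Give `τ(m,u)` the
weight `2m + |u| + 1` and `W` the weight `4`. Products and the `W` term raise the weight by one,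
while insertions do not raise it, because `μ_0^0 = 0`. To leading order the generators therefore
cancel in pairs: `τ(m+1,u)` against `τ(1,[]) τ(m,u)`, `τ(1,[])` against `W`, and `τ(0,v::u)` against
`τ(0,[v]) τ(0,u)`. Only `1` and the single letters `τ(0,[v])` survive, and these span the image of
`A`.

The pairing defines a homotopy `h`. Modulo the image of `A`, the operator `dh + hd - 1` strictly
lowers the weight filtration refined by `cls` (`box_sub_mem`). That filtration is exhaustive and
starts at zero, so induction shows that `B` modulo the image of `A` is acyclic (`mem_sup_of_d_mem`).
Since `incl` is injective, it is a quasi-isomorphism (`isQuasiIso_of_injective`). -/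

noncomputable section

set_option linter.unusedSectionVars false

/-! ### Sums over the ways to split a list -/

section SplitSum

variable {α β X : Type*} [AddCommMonoid X]

/-- `∑ G u v`, the sum over all decompositions `l = u ++ v`. -/
def splitSum (G : List α → List α → X) (l : List α) : X :=
  ∑ i ∈ range (l.length + 1), G (l.take i) (l.drop i)

@[simp] theorem splitSum_nil (G : List α → List α → X) : splitSum G [] = G [] [] := by
  simp [splitSum]

theorem splitSum_cons (G : List α → List α → X) (x : α) (l : List α) :
    splitSum G (x :: l) = G [] (x :: l) + splitSum (fun u v => G (x :: u) v) l := by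
  rw [splitSum, List.length_cons, sum_range_succ', add_comm]
  simp [splitSum]

/-- The cut falls either before or after the marked entry `x`. This is how an inserted value is
followed through a later splitting. -/
theorem splitSum_append_cons (G : List α → List α → X) (u : List α) (x : α) (v : List α) :
    splitSum G (u ++ x :: v) = splitSum (fun p r => G p (r ++ x :: v)) u +
      splitSum (fun p r => G (u ++ x :: p) r) v := by
  induction u generalizing G with
  | nil => simp [splitSum_cons]
  | cons a u ih => simp only [List.cons_append, splitSum_cons, ih, add_assoc]

theorem splitSum_add (G H : List α → List α → X) (l : List α) :
    splitSum (fun u v => G u v + H u v) l = splitSum G l + splitSum H l :=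
  sum_add_distrib

theorem splitSum_sum {ι : Type*} (s : Finset ι) (G : ι → List α → List α → X) (l : List α) :
    splitSum (fun u v => ∑ i ∈ s, G i u v) l = ∑ i ∈ s, splitSum (G i) l :=
  sum_comm

theorem map_splitSum {Y F : Type*} [AddCommMonoid Y] [FunLike F X Y] [AddMonoidHomClass F X Y]
    (f : F) (G : List α → List α → X) (l : List α) :
    f (splitSum G l) = splitSum (fun u v => f (G u v)) l :=
  map_sum f _ _

theorem splitSum_map (f : α → β) (G : List β → List β → X) (l : List α) :
    splitSum G (l.map f) = splitSum (fun u v => G (u.map f) (v.map f)) l := by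
  simp [splitSum, List.map_take, List.map_drop]

theorem splitSum_congr {G H : List α → List α → X} {l : List α}
    (h : ∀ u v, u ++ v = l → G u v = H u v) : splitSum G l = splitSum H l :=
  sum_congr rfl fun i _ => h _ _ (List.take_append_drop i l)

theorem splitSum_eq_zero {G : List α → List α → X} {l : List α}
    (h : ∀ u v, u ++ v = l → G u v = 0) : splitSum G l = 0 :=
  sum_eq_zero fun i _ => h _ _ (List.take_append_drop i l)

/-- Coassociativity of deconcatenation: both sides sum over the cuts of `l` into three pieces. -/
theorem splitSum_assoc (H : List α → List α → List α → X) (l : List α) :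
    splitSum (fun u w => splitSum (fun a b => H u a b) w) l =
      splitSum (fun w c => splitSum (fun a b => H a b c) w) l := by
  induction l generalizing H with
  | nil => simp
  | cons x l ih =>
    simp only [splitSum_cons, splitSum_nil, splitSum_add, ih, add_assoc]

theorem splitSum_comm (G : List α → List α → List α → List α → X) (l l' : List α) :
    splitSum (fun a b => splitSum (fun c d => G a b c d) l') l =
      splitSum (fun c d => splitSum (fun a b => G a b c d) l) l' :=
  sum_comm

/-- Only the trivial splitting with empty second part contributes. -/
theorem splitSum_eq_right {G : List α → List α → X} {l : List α}
    (h : ∀ u v, u ++ v = l → v ≠ [] → G u v = 0) : splitSum G l = G l [] := by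
  rw [splitSum, sum_eq_single l.length]
  · simp
  · intro i hi hne
    rw [mem_range] at hi
    exact h _ _ (List.take_append_drop i l) (by simp; omega)
  · simp

/-- Only the trivial splitting with empty first part contributes. -/
theorem splitSum_eq_left {G : List α → List α → X} {l : List α}
    (h : ∀ u v, u ++ v = l → u ≠ [] → G u v = 0) : splitSum G l = G [] l := by
  rw [splitSum, sum_eq_single 0]
  · simp
  · intro i hi hne
    rw [mem_range] at hi
    refine h _ _ (List.take_append_drop i l) ?_
    rw [← List.length_pos_iff_ne_nil, List.length_take]
    omega
  · simp

end SplitSum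

/-! ### Slotwise linear functions of lists -/

section SlotLinear

variable {K : Type*} [Field K] {V : Type*} [AddCommGroup V] [Module K V]
  {X : Type*} [AddCommGroup X] [Module K X]

/-- `F` is linear in each entry of the list. -/
def SlotLinear (K : Type*) [Field K] {V : Type*} [AddCommGroup V] [Module K V]
    {X : Type*} [AddCommGroup X] [Module K X] (F : List V → X) : Prop :=
  ∀ u v, IsLinearMap K fun x => F (u ++ x :: v)

theorem MultiOp.slotLinear (φ : MultiOp K V X) : SlotLinear K φ.ev := fun u v =>
  ⟨fun x y => φ.ev_insert_add u v x y, fun c x => φ.ev_insert_smul u v c x⟩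

namespace SlotLinear

theorem sub {F G : List V → X} (hF : SlotLinear K F) (hG : SlotLinear K G) :
    SlotLinear K fun l => F l - G l := fun u v =>
  ((hF u v).mk' _ - (hG u v).mk' _).isLinear

theorem sum {ι : Type*} {s : Finset ι} {F : ι → List V → X} (hF : ∀ i ∈ s, SlotLinear K (F i)) :
    SlotLinear K fun l => ∑ i ∈ s, F i l := fun u v => by
  constructor
  · intro x y
    rw [← sum_add_distrib]
    exact sum_congr rfl fun i hi => (hF i hi u v).map_add x y
  · intro c x
    rw [smul_sum]
    exact sum_congr rfl fun i hi => (hF i hi u v).map_smul c x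

theorem comp {Y : Type*} [AddCommGroup Y] [Module K Y] (f : X →ₗ[K] Y) {F : List V → X}
    (hF : SlotLinear K F) : SlotLinear K fun l => f (F l) := fun u v =>
  (f ∘ₗ (hF u v).mk' _).isLinear

theorem comp_map (f : V →ₗ[K] V) {F : List V → X} (hF : SlotLinear K F) :
    SlotLinear K fun l => F (l.map f) := fun u v => by
  simp only [List.map_append, List.map_cons]
  exact ((hF (u.map f) (v.map f)).mk' _ ∘ₗ f).isLinear

theorem of_nil (x : X) : SlotLinear K fun l : List V => if l = [] then x else 0 := fun u v => by
  simp only [List.append_eq_nil_iff, List.cons_ne_nil, and_false, if_false]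
  exact (0 : V →ₗ[K] X).isLinear

/-- A splitting sum of a function which is slotwise linear in both arguments. -/
theorem splitSum {G : List V → List V → X} (h₁ : ∀ r, SlotLinear K fun u => G u r)
    (h₂ : ∀ p, SlotLinear K fun v => G p v) : SlotLinear K (splitSum G) := fun u v => by
  simp only [splitSum_append_cons]
  refine ((IsLinearMap.mk' (fun x => _root_.splitSum (fun p r => G p (r ++ x :: v)) u) ?_) +
    (IsLinearMap.mk' (fun x => _root_.splitSum (fun p r => G (u ++ x :: p) r) v) ?_)).isLinear
  · constructor
    · intro x y; simp only [(h₂ _ _ v).map_add, splitSum_add]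
    · intro c x; simp only [(h₂ _ _ v).map_smul, _root_.splitSum, smul_sum]
  · constructor
    · intro x y; simp only [(h₁ _ u _).map_add, splitSum_add]
    · intro c x; simp only [(h₁ _ u _).map_smul, _root_.splitSum, smul_sum]

theorem map_zero {F : List V → X} (hF : SlotLinear K F) (u v : List V) : F (u ++ 0 :: v) = 0 :=
  (hF u v).map_zero

theorem map_neg {F : List V → X} (hF : SlotLinear K F) (u v : List V) (x : V) :
    F (u ++ (-x) :: v) = - F (u ++ x :: v) :=
  (hF u v).map_neg x

theorem map_sum {F : List V → X} (hF : SlotLinear K F) (u v : List V) {ι : Type*} (s : Finset ι)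
    (x : ι → V) : F (u ++ (∑ i ∈ s, x i) :: v) = ∑ i ∈ s, F (u ++ x i :: v) :=
  _root_.map_sum ((hF u v).mk' _) x s

/-- A slotwise linear function vanishes if it vanishes on lists from a spanning set. -/
theorem eq_zero_of_span {F : List V → X} (hF : SlotLinear K F) {S : Set V}
    (hS : Submodule.span K S = ⊤) (h : ∀ l : List V, (∀ a ∈ l, a ∈ S) → F l = 0) (l : List V) :
    F l = 0 := by
  -- The prefix `u` holds entries already known to lie in `S`; the induction moves the border
  -- between `u` and the arbitrary tail `v` to the right.
  suffices H : ∀ v u : List V, (∀ a ∈ u, a ∈ S) → F (u ++ v) = 0 from H l [] (by simp)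
  intro v
  induction v with
  | nil => intro u hu; simpa using h u hu
  | cons x v ih =>
    intro u hu
    have hx : x ∈ Submodule.span K S := hS ▸ Submodule.mem_top
    induction hx using Submodule.span_induction with
    | mem x hx =>
      have := ih (u ++ [x]) (by
        intro a ha
        rcases List.mem_append.1 ha with ha | ha
        · exact hu a ha
        · rw [List.mem_singleton.1 ha]; exact hx)
      simpa using this
    | zero => exact hF.map_zero u v
    | add x y _ _ hx hy => rw [(hF u v).map_add, hx, hy, add_zero]
    | smul c x _ hx => rw [(hF u v).map_smul, hx, smul_zero]

theorem eq_of_span {F G : List V → X} (hF : SlotLinear K F) (hG : SlotLinear K G) {S : Set V}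
    (hS : Submodule.span K S = ⊤) (h : ∀ l : List V, (∀ a ∈ l, a ∈ S) → F l = G l) (l : List V) :
    F l = G l :=
  sub_eq_zero.1 ((hF.sub hG).eq_zero_of_span hS (fun l hl => sub_eq_zero.2 (h l hl)) l)

end SlotLinear

/-! ### Insertion of an operation into a function of lists -/

/-- `∑ F (κ u ++ ψ b :: c)`, the sum over all decompositions `l = u ++ b ++ c`. -/
def ins (κ : V → V) (ψ : List V → V) (F : List V → X) (l : List V) : X :=
  splitSum (fun u w => splitSum (fun b c => F (u.map κ ++ ψ b :: c)) w) l

theorem insertSum_eq_ins (𝒜 : ℤ → Submodule K V) [Decomposition 𝒜] (k : ℤ) (φ : MultiOp K V X)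
    (ψ : MultiOp K V V) (l : List V) :
    insertSum 𝒜 k φ ψ l = ins (koszul 𝒜 k) ψ.ev φ.ev l := by
  simp [insertSum, ins, splitSum]

/-- The block replaced by `ψ` lies before `x`, contains `x`, or lies after it. In the last case `x`
stands to the left and picks up `κ`. -/
theorem ins_append_cons (κ : V → V) (ψ : List V → V) (F : List V → X) (u : List V) (x : V)
    (v : List V) : ins κ ψ F (u ++ x :: v) =
      ins κ ψ (fun l => F (l ++ x :: v)) u +
      splitSum (fun a b => splitSum (fun b' c => F (a.map κ ++ ψ (b ++ x :: b') :: c)) v) u +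
      ins κ ψ (fun l => F (u.map κ ++ κ x :: l)) v := by
  simp only [ins, splitSum_append_cons, splitSum_add, List.append_assoc, List.cons_append,
    List.map_append, List.map_cons]

theorem ins_add (κ : V → V) (ψ : List V → V) (F G : List V → X) (l : List V) :
    ins κ ψ (fun l => F l + G l) l = ins κ ψ F l + ins κ ψ G l := by
  simp only [ins, splitSum_add]

theorem ins_sum {ι : Type*} (s : Finset ι) (κ : V → V) (ψ : List V → V) (F : ι → List V → X)
    (l : List V) : ins κ ψ (fun l => ∑ i ∈ s, F i l) l = ∑ i ∈ s, ins κ ψ (F i) l := by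
  simp only [ins, splitSum_sum]

theorem map_ins {Y : Type*} [AddCommGroup Y] [Module K Y] (f : X →ₗ[K] Y) (κ : V → V)
    (ψ : List V → V) (F : List V → X) (l : List V) :
    f (ins κ ψ F l) = ins κ ψ (fun l => f (F l)) l := by
  simp only [ins, map_splitSum]

theorem ins_neg (κ : V → V) (ψ : List V → V) (F : List V → X) (l : List V) :
    ins κ ψ (fun l => - F l) l = - ins κ ψ F l := by
  simp only [ins, splitSum, sum_neg_distrib]

theorem ins_sub (κ : V → V) (ψ : List V → V) (F G : List V → X) (l : List V) :
    ins κ ψ (fun l => F l - G l) l = ins κ ψ F l - ins κ ψ G l := by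
  simp only [sub_eq_add_neg, ins_add, ins_neg]

theorem SlotLinear.ins (κ : V →ₗ[K] V) {ψ : List V → V} (hψ : SlotLinear K ψ) {F : List V → X}
    (hF : SlotLinear K F) : SlotLinear K (ins κ ψ F) := by
  refine SlotLinear.splitSum (fun w => ?_) (fun u => ?_)
  · intro p r
    constructor
    · intro x y
      simp only [List.map_append, List.map_cons, List.append_assoc, List.cons_append, map_add,
        (hF _ _).map_add, splitSum_add]
    · intro c x
      simp only [List.map_append, List.map_cons, List.append_assoc, List.cons_append,
        _root_.map_smul, (hF _ _).map_smul, _root_.splitSum, smul_sum]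
  · refine SlotLinear.splitSum (fun r p q => ?_) (fun p => ?_)
    · exact ((hF (u.map κ) r).mk' _ ∘ₗ (hψ p q).mk' _).isLinear
    · intro q r
      simpa using hF (u.map κ ++ ψ p :: q) r

/-- Insertion is a derivation with respect to deconcatenation. -/
theorem ins_splitSum (κ : V → V) (ψ : List V → V) (G : List V → List V → X) (l : List V) :
    ins κ ψ (splitSum G) l =
      splitSum (fun u v => ins κ ψ (fun p => G p v) u) l +
      splitSum (fun u v => ins κ ψ (fun r => G (u.map κ) r) v) l := by
  simp only [ins, splitSum_append_cons, splitSum_add, splitSum_map]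
  rw [add_comm]
  congr 1
  · rw [← splitSum_assoc (fun u x r => splitSum (fun b p => G (u.map κ ++ ψ b :: p) r) x) l]
    exact splitSum_congr fun u w _ => splitSum_assoc (fun b p r => G (u.map κ ++ ψ b :: p) r) w
  · rw [splitSum_assoc (fun p r w => splitSum (fun b c => G (p.map κ) (r.map κ ++ ψ b :: c)) w) l]
    exact splitSum_congr fun u w _ => splitSum_comm _ _ _

theorem splitSum_neg (G : List V → List V → X) (l : List V) :
    splitSum (fun u v => - G u v) l = - splitSum G l := by
  simp only [splitSum, sum_neg_distrib]

/-- After the first insertion `ψ b` is an entry of the list, so the second one falls to its left,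
around it, or to its right. -/
theorem ins_ins_expand (κ : V → V) (ψ ψ' : List V → V) (F : List V → X) (l : List V) :
    ins κ ψ (ins κ ψ' F) l =
      splitSum (fun u w => splitSum (fun b v =>
        ins κ ψ' (fun l => F (l ++ ψ b :: v)) (u.map κ)) w) l +
      splitSum (fun u w => splitSum (fun b v => splitSum (fun p q => splitSum (fun r c =>
        F (p.map κ ++ ψ' (q ++ ψ b :: r) :: c)) v) (u.map κ)) w) l +
      splitSum (fun u w => splitSum (fun b v =>
        ins κ ψ' (fun l => F ((u.map κ).map κ ++ κ (ψ b) :: l)) v) w) l := by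
  rw [ins]
  simp only [ins_append_cons, splitSum_add]

/-- The terms with two disjoint insertions. -/
theorem ins_ins_disjoint (κ : V →ₗ[K] V) (hκ : ∀ x, κ (κ x) = x) {ψ ψ' : List V → V}
    (hψ' : ∀ l, ψ' (l.map κ) = - κ (ψ' l)) {F : List V → X} (hF : SlotLinear K F) (l : List V) :
    splitSum (fun u w => splitSum (fun b v =>
        ins κ ψ' (fun l => F (l ++ ψ b :: v)) (u.map κ)) w) l +
      splitSum (fun u w => splitSum (fun b v =>
        ins κ ψ (fun l => F ((u.map κ).map κ ++ κ (ψ' b) :: l)) v) w) l = 0 := by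
  have hκ' : ∀ u : List V, (u.map κ).map κ = u := fun u => by
    simp [Function.comp_def, hκ]
  -- The minus sign of `hψ'`, which records odd reduced degree, makes the two orders of insertion
  -- cancel; the rest only matches the cuts on both sides.
  simp only [ins, splitSum_map, hκ', hψ', List.append_assoc, List.cons_append, hF.map_neg,
    splitSum_neg]
  rw [neg_add_eq_zero,
    splitSum_congr (fun u w _ => splitSum_comm _ w u),
    ← splitSum_assoc (fun a x w => splitSum (fun b v => splitSum (fun q c =>
      F (a ++ κ (ψ' q) :: (c.map κ ++ ψ b :: v))) x) w) l]
  refine splitSum_congr fun a y _ => ?_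
  rw [splitSum_congr (fun x w _ => splitSum_comm _ w x),
    ← splitSum_assoc (fun q c w => splitSum (fun b v =>
      F (a ++ κ (ψ' q) :: (c.map κ ++ ψ b :: v))) w) y]

/-- The terms with two nested insertions. -/
theorem ins_ins_nested (κ : V →ₗ[K] V) (hκ : ∀ x, κ (κ x) = x) {ψ ψ' : List V → V}
    {F : List V → X} (hF : SlotLinear K F) (l : List V) :
    splitSum (fun u w => splitSum (fun b v => splitSum (fun p q => splitSum (fun r c =>
        F (p.map κ ++ ψ' (q ++ ψ b :: r) :: c)) v) (u.map κ)) w) l =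
      splitSum (fun a w => splitSum (fun b c => F (a ++ ins κ ψ ψ' b :: c)) w) l := by
  have hκ' : ∀ u : List V, (u.map κ).map κ = u := fun u => by
    simp [Function.comp_def, hκ]
  have hsplit : ∀ (a c w : List V) (G : List V → List V → V),
      F (a ++ splitSum G w :: c) = splitSum (fun x y => F (a ++ G x y :: c)) w :=
    fun a c w G => hF.map_sum a c _ _
  simp only [ins, splitSum_map, hκ', hsplit]
  rw [splitSum_congr (fun u w _ => splitSum_comm _ w u),
    ← splitSum_assoc (fun p q w => splitSum (fun b v => splitSum (fun r c =>
      F (p ++ ψ' (q.map κ ++ ψ b :: r) :: c)) v) w) l]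
  refine splitSum_congr fun a y _ => ?_
  rw [← splitSum_assoc (fun q w c => splitSum (fun b r =>
      F (a ++ ψ' (q.map κ ++ ψ b :: r) :: c)) w) y]
  exact splitSum_congr fun q w _ => splitSum_assoc (fun b r c =>
      F (a ++ ψ' (q.map κ ++ ψ b :: r) :: c)) w

/-- Insertion of a family of operations satisfying the curved `A_∞`-equations squares to zero. -/
theorem sum_ins_ins (κ : V →ₗ[K] V) (hκ : ∀ x, κ (κ x) = x) {ψ : ℕ → List V → V}
    (hψ : ∀ m l, ψ m (l.map κ) = - κ (ψ m l))
    (hassoc : ∀ m l, ∑ p ∈ antidiagonal m, ins κ (ψ p.2) (ψ p.1) l = 0)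
    {F : List V → X} (hF : SlotLinear K F) (m : ℕ) (l : List V) :
    ∑ p ∈ antidiagonal m, ins κ (ψ p.2) (ins κ (ψ p.1) F) l = 0 := by
  simp only [ins_ins_expand, sum_add_distrib]
  -- The disjoint terms are grouped together: they cancel in pairs once the antidiagonal is swapped.
  -- The nested terms assemble to the `A_∞`-equation `hassoc`.
  rw [add_right_comm]
  convert add_zero (0 : X)
  · rw [← Nat.sum_antidiagonal_swap (n := m) (f := fun p => splitSum (fun u w => splitSum (fun b v =>
      ins κ (ψ p.1) (fun l => F ((u.map κ).map κ ++ κ (ψ p.2 b) :: l)) v) w) l),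
      ← sum_add_distrib]
    exact sum_eq_zero fun p _ => ins_ins_disjoint κ hκ (hψ p.1) hF l
  · simp only [ins_ins_nested κ hκ hF]
    rw [← splitSum_sum]
    refine splitSum_eq_zero fun a w _ => ?_
    rw [← splitSum_sum]
    refine splitSum_eq_zero fun b c _ => ?_
    rw [← hF.map_sum, hassoc, hF.map_zero]

end SlotLinear

/-! ### Signs -/

section Signs

variable {K : Type*} [Field K] {V : Type*} [AddCommGroup V] [Module K V] {V' : Type*}
  [AddCommGroup V'] [Module K V'] (𝒜 : ℤ → Submodule K V) [Decomposition 𝒜]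
  {ℬ : ℤ → Submodule K V'} [Decomposition ℬ]

theorem span_homogeneous : Submodule.span K {a : V | ∃ n, a ∈ 𝒜 n} = ⊤ := by
  rw [eq_top_iff]
  rintro a -
  induction a using Decomposition.inductionOn 𝒜 with
  | zero => exact Submodule.zero_mem _
  | @homogeneous n m => exact Submodule.subset_span ⟨n, m.2⟩
  | add m m' h h' => exact Submodule.add_mem _ h h'

variable {𝒜}

theorem linearMap_ext_homogeneous {X : Type*} [AddCommGroup X] [Module K X] {f g : V →ₗ[K] X}
    (h : ∀ n, ∀ a ∈ 𝒜 n, f a = g a) (a : V) : f a = g a := by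
  have : f = g := LinearMap.ext_on (span_homogeneous 𝒜) fun a ⟨n, ha⟩ => h n a ha
  rw [this]

theorem koszul_eq_neg_degSign (a : V) : koszul 𝒜 1 a = - degSign 𝒜 a := by
  refine linearMap_ext_homogeneous (𝒜 := 𝒜) (g := - degSign 𝒜) (fun n a ha => ?_) a
  rw [LinearMap.neg_apply, signOp_of_mem 𝒜 _ ha, signOp_of_mem 𝒜 _ ha, one_mul, Int.negOnePow_sub,
    Int.negOnePow_one]
  simp

theorem degSign_degSign (a : V) : degSign 𝒜 (degSign 𝒜 a) = a := by
  refine linearMap_ext_homogeneous (𝒜 := 𝒜) (f := degSign 𝒜 ∘ₗ degSign 𝒜) (g := LinearMap.id)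
    (fun n a ha => ?_) a
  rw [LinearMap.comp_apply, signOp_of_mem 𝒜 _ ha, map_zsmul, signOp_of_mem 𝒜 _ ha, smul_smul,
    ← Units.val_mul, ← Int.negOnePow_add]
  simp [Int.negOnePow_even]

theorem koszul_koszul (a : V) : koszul 𝒜 1 (koszul 𝒜 1 a) = a := by
  rw [koszul_eq_neg_degSign, koszul_eq_neg_degSign, map_neg, degSign_degSign, neg_neg]

theorem Submodule.negOnePow_smul_mem {p : Submodule K V} {a : V} (ha : a ∈ p) (n : ℤ) :
    (n.negOnePow : ℤ) • a ∈ p :=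
  zsmul_mem ha _

theorem koszul_mem {n : ℤ} {a : V} (ha : a ∈ 𝒜 n) : koszul 𝒜 1 a ∈ 𝒜 n := by
  rw [signOp_of_mem 𝒜 _ ha]
  exact Submodule.negOnePow_smul_mem ha _

theorem prod_negOnePow {ι : Type*} (s : Finset ι) (f : ι → ℤ) :
    ∏ i ∈ s, ((f i).negOnePow : ℤ) = ((∑ i ∈ s, f i).negOnePow : ℤ) := by
  classical
  induction s using Finset.induction_on with
  | empty => simp
  | insert a s ha ih => rw [prod_insert ha, sum_insert ha, Int.negOnePow_add, ih, Units.val_mul]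

/-- A cochain of degree `k` is homogeneous on lists of homogeneous elements. -/
theorem MultiOp.HasDegree.ev_mem {φ : MultiOp K V V'} {k : ℤ} (hφ : φ.HasDegree 𝒜 ℬ k)
    {l : List V} {n : List ℤ} (h : List.Forall₂ (fun a n => a ∈ 𝒜 n) l n) :
    φ.ev l ∈ ℬ (n.sum + k - l.length) := by
  have hlen := h.length_eq
  have := hφ l.length (fun i => n.get (i.cast hlen)) l.get fun i =>
    (List.forall₂_iff_get.1 h).2 i i.2 (hlen ▸ i.2)
  have hsum : n.sum = ∑ i : Fin l.length, n.get (i.cast hlen) := by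
    rw [← Fin.sum_univ_getElem]
    exact (Fintype.sum_equiv (finCongr hlen) _ _ fun i => rfl).symm
  rwa [hsum]

/-- On homogeneous inputs the degree of the output is `k` plus the sum of the reduced degrees, so
its sign factors into `(-1)^k` and one `κ` for each input. -/
theorem MultiOp.HasDegree.degSign_ev {φ : MultiOp K V V'} {k : ℤ} (hφ : φ.HasDegree 𝒜 ℬ k)
    (l : List V) :
    degSign ℬ (φ.ev l) = (k.negOnePow : ℤ) • φ.ev (l.map (koszul 𝒜 1)) := by
  refine SlotLinear.eq_of_span (K := K) (F := fun l => degSign ℬ (φ.ev l))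
    (G := fun l => (k.negOnePow : ℤ) • φ.ev (l.map (koszul 𝒜 1)))
    (φ.slotLinear.comp (degSign ℬ)) ?_ (span_homogeneous 𝒜) (fun l hl => ?_) l
  · have := (φ.slotLinear.comp_map (koszul 𝒜 1)).comp
      ((k.negOnePow : ℤ) • (LinearMap.id : V' →ₗ[K] V'))
    exact this
  · have hn : ∀ i : Fin l.length, ∃ n, l.get i ∈ 𝒜 n := fun i => hl _ (List.get_mem l i)
    choose n hn using hn
    have h1 : φ.ev l ∈ ℬ (∑ i, n i + k - l.length) := hφ _ n _ hn
    have h2 : φ.ev (l.map (koszul 𝒜 1)) =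
        (((∑ i, (n i - 1)).negOnePow : ℤ) : K) • φ.ev l := by
      rw [MultiOp.ev_eq φ (List.length_map (as := l) (koszul 𝒜 1)), MultiOp.ev,
        ← prod_negOnePow, Int.cast_prod, ← MultilinearMap.map_smul_univ]
      congr 1
      funext i
      simp only [List.get_eq_getElem, Fin.val_cast, List.getElem_map]
      have := hn i
      rw [List.get_eq_getElem] at this
      rw [signOp_of_mem 𝒜 _ this, one_mul, Int.cast_smul_eq_zsmul]
    rw [signOp_of_mem ℬ _ h1, h2, Int.cast_smul_eq_zsmul, smul_smul, ← Units.val_mul,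
      ← Int.negOnePow_add]
    congr 3
    simp [sum_sub_distrib]
    ring

end Signs

/-! ### Homogeneous bases containing the unit -/

/-- A homogeneous basis of a curved `A_∞`-algebra which contains the unit. -/
structure UnitalBasis {K : Type u} [Field K] {V : Type v} [AddCommGroup V] [Module K V]
    {𝒜 : ℤ → Submodule K V} [Decomposition 𝒜] (A : CurvedAInfAlgebra 𝒜) where
  ι : Type v
  basis : Module.Basis ι K V
  deg : ι → ℤ
  mem : ∀ i, basis i ∈ 𝒜 (deg i)
  unit : ι
  basis_unit : basis unit = A.e

section Existence

variable {K : Type u} [Field K] {V : Type v} [AddCommGroup V] [Module K V]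
  {𝒜 : ℤ → Submodule K V} [Decomposition 𝒜] (A : CurvedAInfAlgebra 𝒜)

theorem CurvedAInfAlgebra.e_ne_zero [Nontrivial V] : A.e ≠ 0 := by
  intro h
  obtain ⟨a, ha⟩ := exists_ne (0 : V)
  apply ha
  have h1 := A.e_left 0 a
  rw [if_pos rfl, h] at h1
  rw [← h1]
  exact (A.μ 0).ev_insert_zero [] [a]

/-- Bases of the homogeneous components are collected into one. Only degree `0` needs care: there
the independent set `{e}` is extended to a basis. -/
theorem CurvedAInfAlgebra.nonempty_unitalBasis [Nontrivial V] : Nonempty (UnitalBasis A) := by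
  classical
  have key : ∀ n, ∃ (α : Type v) (b : Module.Basis α K (𝒜 n)),
      n = 0 → ∃ i, (b i : V) = A.e := by
    intro n
    by_cases hn : n = 0
    · subst hn
      have hli : LinearIndepOn K id ({⟨A.e, A.e_mem⟩} : Set (𝒜 0)) :=
        (linearIndepOn_singleton_iff (R := K) (v := id)).2 (by simpa [Subtype.ext_iff] using A.e_ne_zero)
      exact ⟨_, Module.Basis.extend hli, fun _ => ⟨⟨⟨A.e, A.e_mem⟩, hli.subset_extend _ rfl⟩, by
        rw [Module.Basis.extend_apply_self]⟩⟩
    · exact ⟨_, Module.Basis.ofVectorSpace K (𝒜 n), fun h => absurd h hn⟩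
  choose α b hb using key
  obtain ⟨i, hi⟩ := hb 0 rfl
  have hint : IsInternal 𝒜 := Decomposition.isInternal 𝒜
  exact ⟨⟨Σ n, α n, hint.collectedBasis b, Sigma.fst, hint.collectedBasis_mem b, ⟨0, i⟩, by
    simpa using hi⟩⟩

end Existence

/-! ### The free algebra on cochains -/

/-- Generators of the cobar construction: pairs of an exponent of the formal variable and a word
in `I`, not both trivial. -/
abbrev Letter (I : Type*) : Type _ := {c : ℕ × List I // c ≠ (0, [])}

/-- Words in the letters, together with an exponent of the central generator. -/
abbrev CobarWord (I : Type*) : Type _ := FreeAddMonoid (Letter I) × ℕ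

/-- The free algebra on the letters with an additional central polynomial generator. -/
abbrev CobarAlg (K I : Type*) [Field K] : Type _ := AddMonoidAlgebra K (CobarWord I)

namespace CobarAlg

variable {K I : Type*} [Field K] (deg : I → ℤ)

/-- The degree of a letter. -/
def letterDeg (c : Letter I) : ℤ := (c.1.2.map deg).sum + 1 - 2 * c.1.1 - c.1.2.length

/-- The degree of a word. -/
def wordDeg : CobarWord I →+ ℤ :=
  (FreeAddMonoid.lift (letterDeg deg)).comp (AddMonoidHom.fst _ _)

variable (K) in
/-- The grading of the free algebra by degree. -/
abbrev grading : ℤ → Submodule K (CobarAlg K I) := AddMonoidAlgebra.gradeBy K (wordDeg deg)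

variable (K) in
/-- The basis elements of the free algebra. -/
def wd (w : List (Letter I)) (k : ℕ) : CobarAlg K I :=
  AddMonoidAlgebra.single (FreeAddMonoid.ofList w, k) 1

theorem wd_mul (w w' : List (Letter I)) (k k' : ℕ) :
    wd K w k * wd K w' k' = wd K (w ++ w') (k + k') := by
  simp [wd, AddMonoidAlgebra.single_mul_single, FreeAddMonoid.ofList_append]

theorem wd_nil_zero : wd K ([] : List (Letter I)) 0 = 1 := rfl

theorem span_wd : Submodule.span K {x : CobarAlg K I | ∃ w k, x = wd K w k} = ⊤ := by
  rw [eq_top_iff]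
  rintro x -
  induction x using AddMonoidAlgebra.induction_linear with
  | zero => exact Submodule.zero_mem _
  | add x y hx hy => exact Submodule.add_mem _ hx hy
  | single a r =>
    have : AddMonoidAlgebra.single a r = r • wd K (FreeAddMonoid.toList a.1) a.2 := by
      simp [wd, AddMonoidAlgebra.smul_single]
    rw [this]
    exact Submodule.smul_mem _ _ (Submodule.subset_span ⟨_, _, rfl⟩)

section Lift

variable {X : Type*} [AddCommGroup X] [Module K X]

/-- The linear map with given values on words. -/
def lift (f : List (Letter I) → ℕ → X) : CobarAlg K I →ₗ[K] X :=
  Finsupp.linearCombination K (fun x : CobarWord I => f (FreeAddMonoid.toList x.1) x.2) ∘ₗ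
    (AddMonoidAlgebra.coeffLinearEquiv K).toLinearMap

@[simp] theorem lift_wd (f : List (Letter I) → ℕ → X) (w : List (Letter I)) (k : ℕ) :
    lift f (wd K w k) = f w k := by
  simp [lift, wd]

theorem ext_wd {f g : CobarAlg K I →ₗ[K] X} (h : ∀ w k, f (wd K w k) = g (wd K w k))
    (x : CobarAlg K I) : f x = g x := by
  have : f = g := LinearMap.ext_on span_wd (by rintro _ ⟨w, k, rfl⟩; exact h w k)
  rw [this]

end Lift

/-- The total degree of a list of letters. -/
def listDeg (w : List (Letter I)) : ℤ := (w.map (letterDeg deg)).sum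

theorem wordDeg_ofList (w : List (Letter I)) (k : ℕ) :
    wordDeg deg (FreeAddMonoid.ofList w, k) = listDeg deg w := by
  simp [wordDeg, listDeg, FreeAddMonoid.lift_apply]

theorem wd_mem (w : List (Letter I)) (k : ℕ) : wd K w k ∈ grading K deg (listDeg deg w) := by
  have := AddMonoidAlgebra.single_mem_gradeBy (wordDeg deg) (FreeAddMonoid.ofList w, k) (1 : K)
  rwa [wordDeg_ofList] at this

/-- The sign `(-1)^{|w|}` of a list of letters. -/
def sgn (w : List (Letter I)) : ℤ := ((listDeg deg w).negOnePow : ℤ)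

theorem degSign_wd (w : List (Letter I)) (k : ℕ) :
    degSign (grading K deg) (wd K w k) = sgn deg w • wd K w k :=
  signOp_of_mem _ _ (wd_mem deg w k)

theorem sgn_append (w w' : List (Letter I)) : sgn deg (w ++ w') = sgn deg w * sgn deg w' := by
  simp [sgn, listDeg, Int.negOnePow_add]

/-- The central generator. -/
def W : CobarAlg K I := wd K [] 1

theorem W_comm (x : CobarAlg K I) : W * x = x * W := by
  refine ext_wd (f := LinearMap.mulLeft K W) (g := LinearMap.mulRight K W) (fun w k => ?_) x
  simp [W, wd_mul, add_comm]

theorem W_mem : (W : CobarAlg K I) ∈ grading K deg 0 := wd_mem deg [] 1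

open Classical in
/-- The generator associated to a pair `(m, u)`; zero for the trivial pair. -/
def tau (m : ℕ) (u : List I) : CobarAlg K I :=
  if h : (m, u) = (0, []) then 0 else wd K [⟨(m, u), h⟩] 0

theorem tau_zero_nil : (tau 0 [] : CobarAlg K I) = 0 := dif_pos rfl

theorem tau_letter (c : Letter I) : tau c.1.1 c.1.2 = wd K [c] 0 := dif_neg c.2

theorem tau_mem (m : ℕ) (u : List I) :
    (tau m u : CobarAlg K I) ∈ grading K deg ((u.map deg).sum + 1 - 2 * m - u.length) := by
  unfold tau
  split_ifs with h
  · exact Submodule.zero_mem _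
  · simpa [listDeg, letterDeg] using wd_mem (K := K) deg [⟨(m, u), h⟩] 0

end CobarAlg

/-! ### The universal homomorphism, extended multilinearly from basis words. -/

namespace UnitalBasis

open CobarAlg

variable {K : Type u} [Field K] {V : Type v} [AddCommGroup V] [Module K V]
  {𝒜 : ℤ → Submodule K V} [Decomposition 𝒜] {A : CurvedAInfAlgebra 𝒜} (β : UnitalBasis A)

/-- The basis elements other than the unit. -/
abbrev Ix : Type v := {i : β.ι // i ≠ β.unit}

/-- The basis vectors other than the unit. -/
abbrev vec (i : β.Ix) : V := β.basis i

/-- The degrees of the basis vectors other than the unit. -/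
abbrev ideg (i : β.Ix) : ℤ := β.deg i

/-- The grading of the cobar construction. -/
abbrev gr : ℤ → Submodule K (CobarAlg K β.Ix) := grading K β.ideg

/-- The projection to degree `n` fixes basis vectors of degree `n` and kills the others, so followed
by the `j`-th coordinate it vanishes on the whole basis. -/
theorem coord_eq_zero {n : ℤ} {a : V} (ha : a ∈ 𝒜 n) {j : β.ι} (hj : β.deg j ≠ n) :
    β.basis.coord j a = 0 := by
  let P : V →ₗ[K] V := (𝒜 n).subtype ∘ₗ DirectSum.component K ℤ _ n ∘ₗ
    (decomposeLinearEquiv 𝒜).toLinearMap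
  have hP : ∀ x, P x = decompose 𝒜 x n := fun x => rfl
  have h0 : β.basis.coord j ∘ₗ P = 0 := by
    refine β.basis.ext fun k => ?_
    rw [LinearMap.comp_apply, hP, LinearMap.zero_apply]
    by_cases hk : β.deg k = n
    · rw [decompose_of_mem_same 𝒜 (hk ▸ β.mem k), Module.Basis.coord_apply, Module.Basis.repr_self,
        Finsupp.single_eq_of_ne]
      rintro rfl
      exact hj hk
    · rw [decompose_of_mem_ne 𝒜 (β.mem k) hk, map_zero]
  have := LinearMap.congr_fun h0 a
  rwa [LinearMap.comp_apply, hP, decompose_of_mem_same 𝒜 ha] at this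

theorem deg_unit : β.deg β.unit = 0 := by
  have h := β.mem β.unit
  have h' := A.e_mem
  rw [← β.basis_unit] at h'
  exact degree_eq_of_mem_mem 𝒜 h h' (β.basis.ne_zero _)

open Classical in
/-- The projection to the span of the basis vectors other than the unit. -/
def bar : V →ₗ[K] AddMonoidAlgebra K (FreeAddMonoid β.Ix) :=
  β.basis.constr K fun j => if h : j = β.unit then 0 else
    AddMonoidAlgebra.single (FreeAddMonoid.of ⟨j, h⟩) 1

theorem bar_unit : β.bar A.e = 0 := by
  rw [← β.basis_unit, bar, Module.Basis.constr_basis, dif_pos rfl]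

theorem bar_vec (i : β.Ix) : β.bar (β.vec i) = AddMonoidAlgebra.single (FreeAddMonoid.of i) 1 := by
  rw [bar, Module.Basis.constr_basis, dif_neg i.2]

/-- The word algebra is bookkeeping for multilinear extension: multiplying the `bar`s of the inputs
expands them in basis words, to which `tauLin` can be applied. -/
theorem bar_vec_prod (u : List β.Ix) :
    ((u.map β.vec).map β.bar).prod = AddMonoidAlgebra.single (FreeAddMonoid.ofList u) 1 := by
  induction u with
  | nil => rfl
  | cons i u ih =>
    rw [List.map_cons, List.map_cons, List.prod_cons, ih, bar_vec,
      AddMonoidAlgebra.single_mul_single, FreeAddMonoid.ofList_cons, one_mul]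

/-- The coefficient of the unit. -/
def eps : V →ₗ[K] CobarAlg K β.Ix := Algebra.linearMap K _ ∘ₗ β.basis.coord β.unit

theorem eps_unit : β.eps A.e = 1 := by
  simp only [eps, ← β.basis_unit, LinearMap.comp_apply, Module.Basis.coord_apply,
    Module.Basis.repr_self, Finsupp.single_eq_same, map_one, Algebra.linearMap_apply]

theorem eps_vec (i : β.Ix) : β.eps (β.vec i) = 0 := by
  have : (Finsupp.single (i : β.ι) (1 : K)) β.unit = 0 := Finsupp.single_eq_of_ne i.2.symm
  simp [eps, this]

/-- The linear extension of `tau`. -/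
def tauLin (m : ℕ) : AddMonoidAlgebra K (FreeAddMonoid β.Ix) →ₗ[K] CobarAlg K β.Ix :=
  Finsupp.linearCombination K (fun x => tau m (FreeAddMonoid.toList x)) ∘ₗ
    (AddMonoidAlgebra.coeffLinearEquiv K).toLinearMap

theorem tauLin_single (m : ℕ) (u : List β.Ix) :
    β.tauLin m (AddMonoidAlgebra.single (FreeAddMonoid.ofList u) 1) = tau m u := by
  simp [tauLin]

/-- The part of the universal homomorphism which involves the unit. -/
def phiUnit : ℕ → MultiOp K V (CobarAlg K β.Ix)
  | 0, 1 => MultilinearMap.ofSubsingleton K V _ (0 : Fin 1) β.eps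
  | _, _ => 0

/-- The components of the universal homomorphism to the cobar construction. -/
def phi (m : ℕ) : MultiOp K V (CobarAlg K β.Ix) := fun d =>
  (β.tauLin m).compMultilinearMap ((MultilinearMap.mkPiAlgebraFin K d _).compLinearMap
    fun _ => β.bar) + β.phiUnit m d

theorem phi_ev (m : ℕ) (l : List V) :
    (β.phi m).ev l = β.tauLin m (l.map β.bar).prod + (β.phiUnit m).ev l := by
  change β.tauLin m _ + _ = _
  congr 2
  rw [MultilinearMap.compLinearMap_apply, MultilinearMap.mkPiAlgebraFin_apply]
  congr 1
  refine List.ext_getElem (by simp) fun i h h' => ?_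
  simp

theorem phiUnit_of_length {m : ℕ} {l : List V} (h : l.length ≠ 1) : (β.phiUnit m).ev l = 0 := by
  match m, l with
  | 0, [] => rfl
  | 0, [_] => simp at h
  | 0, _ :: _ :: _ => rfl
  | _ + 1, _ => rfl

theorem phi_vec (m : ℕ) (u : List β.Ix) : (β.phi m).ev (u.map β.vec) = tau m u := by
  rw [phi_ev, bar_vec_prod, tauLin_single]
  convert add_zero _
  match m, u with
  | _ + 1, _ => rfl
  | 0, [i] => exact β.eps_vec i
  | 0, [] => rfl
  | 0, _ :: _ :: _ => exact β.phiUnit_of_length (by simp)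

theorem phi_zero_nil : (β.phi 0).ev [] = 0 := β.phi_vec 0 []

theorem bar_prod_eq_zero {l : List V} (h : A.e ∈ l) : (l.map β.bar).prod = 0 := by
  obtain ⟨u, v, rfl⟩ := List.append_of_mem h
  simp [bar_unit]

theorem phi_unit (m : ℕ) : (β.phi m).ev [A.e] = if m = 0 then 1 else 0 := by
  rw [phi_ev, bar_prod_eq_zero _ (by simp), map_zero, zero_add]
  cases m with
  | zero => exact β.eps_unit
  | succ m => rfl

theorem phi_unit_other (m : ℕ) (l : List V) (hl : l.length ≠ 1) (h : A.e ∈ l) :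
    (β.phi m).ev l = 0 := by
  rw [phi_ev, bar_prod_eq_zero _ h, map_zero, phiUnit_of_length _ hl, add_zero]

/-- The reduced degree of words in the basis vectors. -/
def redDeg : FreeAddMonoid β.Ix →+ ℤ := FreeAddMonoid.lift fun i => β.ideg i - 1

theorem bar_mem {n : ℤ} {a : V} (ha : a ∈ 𝒜 n) :
    β.bar a ∈ AddMonoidAlgebra.gradeBy K β.redDeg (n - 1) := by
  rw [bar, Module.Basis.constr_apply]
  refine Submodule.sum_mem _ fun j _ => ?_
  by_cases hj : β.deg j = n
  · refine Submodule.smul_mem _ _ ?_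
    split_ifs with h
    · exact Submodule.zero_mem _
    · have := AddMonoidAlgebra.single_mem_gradeBy β.redDeg (FreeAddMonoid.of (⟨j, h⟩ : β.Ix)) (1 : K)
      simpa [redDeg, hj] using this
  · have := β.coord_eq_zero ha hj
    rw [Module.Basis.coord_apply] at this
    dsimp only
    rw [this, zero_smul]
    exact Submodule.zero_mem _

theorem redDeg_ofList (u : List β.Ix) :
    β.redDeg (FreeAddMonoid.ofList u) = (u.map β.ideg).sum - u.length := by
  simp only [redDeg, FreeAddMonoid.lift_apply, FreeAddMonoid.toList_ofList]
  induction u with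
  | nil => simp
  | cons i u ih => simp only [List.map_cons, List.sum_cons, ih, List.length_cons]; push_cast; ring

theorem tauLin_mem (m : ℕ) {n : ℤ} {x : AddMonoidAlgebra K (FreeAddMonoid β.Ix)}
    (hx : x ∈ AddMonoidAlgebra.gradeBy K β.redDeg n) : β.tauLin m x ∈ β.gr (n + 1 - 2 * m) := by
  rw [AddMonoidAlgebra.mem_gradeBy_iff] at hx
  rw [tauLin, LinearMap.comp_apply, Finsupp.linearCombination_apply]
  refine Submodule.sum_mem _ fun w hw => Submodule.smul_mem _ _ ?_
  have h1 : β.redDeg w = n := hx hw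
  have h2 := tau_mem (K := K) β.ideg m (FreeAddMonoid.toList w)
  have h3 := β.redDeg_ofList (FreeAddMonoid.toList w)
  rw [FreeAddMonoid.ofList_toList, h1] at h3
  rw [h3]
  convert h2 using 2
  ring

theorem eps_mem {n : ℤ} {a : V} (ha : a ∈ 𝒜 n) : β.eps a ∈ β.gr n := by
  by_cases hn : n = 0
  · subst hn
    rw [eps, LinearMap.comp_apply, Algebra.linearMap_apply, Algebra.algebraMap_eq_smul_one]
    exact Submodule.smul_mem _ _ SetLike.GradedOne.one_mem
  · rw [eps, LinearMap.comp_apply, β.coord_eq_zero ha (by rw [deg_unit]; exact Ne.symm hn), map_zero]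
    exact Submodule.zero_mem _

theorem phi_degree (m : ℕ) : (β.phi m).HasDegree 𝒜 β.gr (1 - 2 * m) := by
  intro d n a ha
  refine Submodule.add_mem _ ?_ ?_
  · have h1 : (List.ofFn fun i => β.bar (a i)).prod ∈
        AddMonoidAlgebra.gradeBy K β.redDeg (List.ofFn fun i => n i - 1).sum :=
      SetLike.list_prod_ofFn_mem_graded _ _ fun i => β.bar_mem (ha i)
    have h2 := β.tauLin_mem m h1
    rw [LinearMap.compMultilinearMap_apply, MultilinearMap.compLinearMap_apply,
      MultilinearMap.mkPiAlgebraFin_apply]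
    convert h2 using 2
    simp only [List.sum_ofFn, sum_sub_distrib, sum_const, card_univ, Fintype.card_fin, nsmul_eq_mul,
      mul_one]
    ring
  · match m, d with
    | 0, 0 => exact Submodule.zero_mem _
    | 0, 1 =>
      have h := β.eps_mem (ha 0)
      have h2 : ∑ i, n i + (1 - 2 * ((0 : ℕ) : ℤ)) - ((1 : ℕ) : ℤ) = n 0 := by simp
      rw [h2]
      exact h
    | 0, _ + 2 => exact Submodule.zero_mem _
    | _ + 1, _ => exact Submodule.zero_mem _

/-! ### The differential -/

/-- The operations of `A` as functions of lists. -/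
abbrev mu (A : CurvedAInfAlgebra 𝒜) (m : ℕ) : List V → V := (A.μ m).ev

/-- The right hand side of the equation for a homomorphism. -/
def sumIns (m : ℕ) (l : List V) : CobarAlg K β.Ix :=
  ∑ p ∈ antidiagonal m, ins (koszul 𝒜 1) (mu A p.2) (β.phi p.1).ev l

/-- The quadratic terms in the equation for a homomorphism. -/
def sumMul (m : ℕ) (l : List V) : CobarAlg K β.Ix :=
  ∑ p ∈ antidiagonal m, splitSum
    (fun u v => degSign β.gr ((β.phi p.1).ev u) * (β.phi p.2).ev v) l

/-- The curvature term in the equation for a homomorphism. -/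
def curvTerm (m : ℕ) (l : List V) : CobarAlg K β.Ix :=
  if l = [] then (if m = 1 then W else 0) else 0

/-- The differential of a generator. -/
def dTau (m : ℕ) (u : List β.Ix) : CobarAlg K β.Ix :=
  β.sumIns m (u.map β.vec) - β.sumMul m (u.map β.vec) - β.curvTerm m (u.map β.vec)

/-- The differential on words. -/
def dWord : List (Letter β.Ix) → CobarAlg K β.Ix
  | [] => 0
  | c :: w => β.dTau c.1.1 c.1.2 * wd K w 0 + sgn β.ideg [c] • (wd K [c] 0 * dWord w)

/-- The differential of the cobar construction. -/
def d : CobarAlg K β.Ix →ₗ[K] CobarAlg K β.Ix :=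
  lift fun w k => β.dWord w * wd K [] k

theorem d_letter (c : Letter β.Ix) : β.d (wd K [c] 0) = β.dTau c.1.1 c.1.2 := by
  simp [d, dWord, wd_nil_zero]

theorem d_W : β.d W = 0 := by
  simp [d, W, dWord]

theorem wd_nil_comm (k : ℕ) (x : CobarAlg K β.Ix) : wd K [] k * x = x * wd K [] k := by
  refine ext_wd (f := LinearMap.mulLeft K (wd K [] k)) (g := LinearMap.mulRight K (wd K [] k))
    (fun w k => ?_) x
  simp [wd_mul, add_comm]

theorem dWord_append (w w' : List (Letter β.Ix)) :
    β.dWord (w ++ w') = β.dWord w * wd K w' 0 + sgn β.ideg w • (wd K w 0 * β.dWord w') := by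
  induction w with
  | nil => simp [dWord, wd_nil_zero, sgn, listDeg]
  | cons c w ih =>
    have h : sgn β.ideg (c :: w) = sgn β.ideg [c] * sgn β.ideg w := sgn_append β.ideg [c] w
    have h2 : wd K (c :: w) 0 = wd K [c] 0 * wd K w 0 := by rw [wd_mul]; rfl
    have h3 : wd K (w ++ w') 0 = wd K w 0 * wd K w' 0 := by rw [wd_mul]
    rw [List.cons_append, dWord, dWord, ih, h, h2, h3]
    simp only [mul_add, add_mul, smul_add, mul_smul_comm, smul_mul_assoc, smul_smul, mul_assoc]
    abel

theorem leibniz (x y : CobarAlg K β.Ix) : β.d (x * y) = β.d x * y + degSign β.gr x * β.d y := by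
  refine ext_wd (f := β.d ∘ₗ LinearMap.mulRight K y)
    (g := LinearMap.mulRight K y ∘ₗ β.d + LinearMap.mulRight K (β.d y) ∘ₗ degSign β.gr)
    (fun w k => ?_) x
  refine ext_wd (f := β.d ∘ₗ LinearMap.mulLeft K (wd K w k))
    (g := LinearMap.mulLeft K (β.d (wd K w k)) + LinearMap.mulLeft K (degSign β.gr (wd K w k)) ∘ₗ β.d)
    (fun w' k' => ?_) y
  have h1 : wd K [] (k + k') = wd K [] k * wd K ([] : List (Letter β.Ix)) k' := by rw [wd_mul]; rfl
  have h2 : ∀ w k, wd K w k = wd K w 0 * wd K ([] : List (Letter β.Ix)) k := fun w k => by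
    rw [wd_mul]; simp
  simp only [LinearMap.comp_apply, LinearMap.mulLeft_apply, LinearMap.add_apply, wd_mul]
  simp only [d, lift_wd, dWord_append, degSign_wd]
  rw [h1, h2 w k, h2 w' k']
  simp only [add_mul, smul_mul_assoc, mul_assoc, wd_nil_comm _ k]

end UnitalBasis

/-- Used for operations on the entries next to `e`: `μ_0` with an entry `e` vanishes outside arity
two, so only the last two cuts of the left part count. -/
theorem splitSum_concat {α X : Type*} [AddCommMonoid X] {G : List α → List α → X}
    (h : ∀ u v, 2 ≤ v.length → G u v = 0) (l : List α) (x : α) :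
    splitSum G (l ++ [x]) = G l [x] + G (l ++ [x]) [] := by
  rw [splitSum_append_cons, splitSum_nil, splitSum_eq_right]
  · simp
  · intro u v _ hv
    refine h _ _ ?_
    have := List.length_pos_iff_ne_nil.2 hv
    simp
    omega

namespace UnitalBasis

open CobarAlg

variable {K : Type u} [Field K] {V : Type v} [AddCommGroup V] [Module K V]
  {𝒜 : ℤ → Submodule K V} [Decomposition 𝒜] {A : CurvedAInfAlgebra 𝒜} (β : UnitalBasis A)

/-! ### The equation on lists containing the unit -/

theorem koszul_e : koszul 𝒜 1 A.e = - A.e := by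
  rw [signOp_of_mem 𝒜 _ A.e_mem]
  simp

theorem mu_unit_succ (A : CurvedAInfAlgebra 𝒜) (m : ℕ) {l : List V} (h : A.e ∈ l) :
    mu A (m + 1) l = 0 := by
  by_cases hl : l.length = 2
  · match l with
    | [a, b] =>
      rcases List.mem_pair.1 h with h | h
      · rw [← h]; exact (A.e_left _ _).trans (if_neg (by omega))
      · rw [← h]; exact (A.e_right _ _).trans (if_neg (by omega))
  · exact A.e_other _ _ hl h

theorem degSign_phi (m : ℕ) (l : List V) :
    degSign β.gr ((β.phi m).ev l) = - (β.phi m).ev (l.map (koszul 𝒜 1)) := by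
  rw [(β.phi_degree m).degSign_ev, Int.negOnePow_sub, Int.negOnePow_one,
    Int.negOnePow_even _ (by simp)]
  simp

theorem degSign_gr_one : degSign β.gr 1 = 1 := by
  have : (1 : CobarAlg K β.Ix) ∈ β.gr 0 := SetLike.GradedOne.one_mem
  rw [signOp_of_mem _ _ this]
  simp

theorem phi_append_unit (m : ℕ) {l₁ l₂ : List V} (h : l₁ ++ l₂ ≠ []) :
    (β.phi m).ev (l₁ ++ A.e :: l₂) = 0 := by
  refine β.phi_unit_other m _ ?_ (by simp)
  have := List.length_pos_iff_ne_nil.2 h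
  simp at this ⊢
  omega

/-- If the inserted operation does not absorb `e`, then `e` is one of at least two inputs of `Φ` and
the term is zero. -/
theorem ins_unit (m n : ℕ) (l₁ l₂ : List V) :
    ins (koszul 𝒜 1) (mu A n) (β.phi m).ev (l₁ ++ A.e :: l₂) =
      splitSum (fun a b => splitSum (fun b' c =>
        (β.phi m).ev (a.map (koszul 𝒜 1) ++ mu A n (b ++ A.e :: b') :: c)) l₂) l₁ := by
  have h1 : ∀ l, ins (koszul 𝒜 1) (mu A n) (fun l => (β.phi m).ev (l ++ A.e :: l₂)) l = 0 :=
    fun l => splitSum_eq_zero fun u w _ => splitSum_eq_zero fun b c _ =>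
      β.phi_append_unit m (by simp)
  have h2 : ∀ l, ins (koszul 𝒜 1) (mu A n)
      (fun l => (β.phi m).ev (l₁.map (koszul 𝒜 1) ++ koszul 𝒜 1 A.e :: l)) l = 0 :=
    fun l => splitSum_eq_zero fun u w _ => splitSum_eq_zero fun b c _ => by
      dsimp only
      rw [koszul_e, (β.phi m).slotLinear.map_neg, β.phi_append_unit m (by simp), neg_zero]
  rw [ins_append_cons, h1, h2, zero_add, add_zero]

/-- Strict unitality only lets `e` merge with a neighbour. A left neighbour `x` becomes `degSign x =
-κ x` and a right neighbour is unchanged, so the two terms cancel when both neighbours exist. -/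
theorem ins_unit_zero (m : ℕ) (l₁ l₂ : List V) :
    ins (koszul 𝒜 1) (mu A 0) (β.phi m).ev (l₁ ++ A.e :: l₂) =
      (if l₁ = [] then 0 else - (β.phi m).ev (l₁.map (koszul 𝒜 1) ++ l₂)) +
      (if l₂ = [] then 0 else (β.phi m).ev (l₁.map (koszul 𝒜 1) ++ l₂)) := by
  have hlong : ∀ b b' : List V, b.length + b'.length ≠ 1 → mu A 0 (b ++ A.e :: b') = 0 :=
    fun b b' h => A.e_other _ _ (by simp; omega) (by simp)
  have hleft : ∀ x, mu A 0 [A.e, x] = x := fun x => (A.e_left _ _).trans (if_pos rfl)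
  have hright : ∀ x, mu A 0 [x, A.e] = degSign 𝒜 x := fun x => (A.e_right _ _).trans (if_pos rfl)
  have hz := (β.phi m).slotLinear.map_zero
  rw [ins_unit]
  have h0 : ∀ a : List V, splitSum (fun b' c =>
      (β.phi m).ev (a.map (koszul 𝒜 1) ++ mu A 0 ([] ++ A.e :: b') :: c)) l₂ =
      if l₂ = [] then 0 else (β.phi m).ev (a.map (koszul 𝒜 1) ++ l₂) := by
    intro a
    match l₂ with
    | [] => rw [splitSum_nil, hlong _ _ (by simp), hz, if_pos rfl]
    | x :: l =>
      rw [splitSum_cons, hlong _ _ (by simp), hz, zero_add, splitSum_eq_left, if_neg (by simp)]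
      · rw [List.nil_append, hleft]
      · intro u v _ hu
        have := List.length_pos_iff_ne_nil.2 hu
        rw [hlong _ _ (by simp; omega), hz]
  have h1 : ∀ (a : List V) (x : V), splitSum (fun b' c =>
      (β.phi m).ev (a.map (koszul 𝒜 1) ++ mu A 0 ([x] ++ A.e :: b') :: c)) l₂ =
      (β.phi m).ev (a.map (koszul 𝒜 1) ++ degSign 𝒜 x :: l₂) := by
    intro a x
    rw [splitSum_eq_left]
    · rw [List.singleton_append, hright]
    · intro u v _ hu
      have := List.length_pos_iff_ne_nil.2 hu
      rw [hlong _ _ (by simp; omega), hz]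
  rcases List.eq_nil_or_concat l₁ with rfl | ⟨l, x, rfl⟩
  · rw [splitSum_nil, h0, if_pos rfl, zero_add]
  · have hne : l ++ [x] ≠ [] := by simp
    rw [List.concat_eq_append, splitSum_concat, h0, h1, if_neg hne]
    · congr 1
      rw [List.map_append, List.map_singleton, koszul_eq_neg_degSign, List.append_assoc,
        List.singleton_append, (β.phi m).slotLinear.map_neg, neg_neg]
    · intro u v hv
      refine splitSum_eq_zero fun b c _ => ?_
      rw [hlong _ _ (by omega), hz]

theorem sumIns_unit (m : ℕ) (l₁ l₂ : List V) :
    β.sumIns m (l₁ ++ A.e :: l₂) =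
      (if l₁ = [] then 0 else - (β.phi m).ev (l₁.map (koszul 𝒜 1) ++ l₂)) +
      (if l₂ = [] then 0 else (β.phi m).ev (l₁.map (koszul 𝒜 1) ++ l₂)) := by
  rw [sumIns, sum_eq_single (m, 0), ins_unit_zero]
  · rintro ⟨p, q⟩ hp hne
    rw [HasAntidiagonal.mem_antidiagonal] at hp
    obtain _ | q := q
    · simp_all
    · rw [ins_unit]
      refine splitSum_eq_zero fun a b _ => splitSum_eq_zero fun b' c _ => ?_
      rw [mu_unit_succ A q (by simp), (β.phi p).slotLinear.map_zero]
  · simp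

/-- A product survives only if `e` is the sole input of one factor, which is then `Φ_0(e) = 1`. The
minus sign comes from the odd degree of `Φ`. -/
theorem sumMul_unit (m : ℕ) (l₁ l₂ : List V) :
    β.sumMul m (l₁ ++ A.e :: l₂) =
      (if l₂ = [] then - (β.phi m).ev (l₁.map (koszul 𝒜 1)) else 0) +
      (if l₁ = [] then (β.phi m).ev l₂ else 0) := by
  simp only [sumMul, splitSum_append_cons, sum_add_distrib]
  congr 1
  · rw [sum_eq_single (m, 0), splitSum_eq_right]
    · split_ifs with h
      · subst h
        rw [List.nil_append, phi_unit, if_pos rfl, mul_one, degSign_phi]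
      · rw [β.phi_append_unit 0 (by simpa using h), mul_zero]
    · intro u v _ hv
      rw [β.phi_append_unit 0 (by simp [hv]), mul_zero]
    · rintro ⟨p, q⟩ hp hne
      rw [HasAntidiagonal.mem_antidiagonal] at hp
      obtain _ | q := q
      · simp_all
      · refine splitSum_eq_zero fun u v _ => ?_
        by_cases h : v ++ l₂ = []
        · rw [List.append_eq_nil_iff] at h
          rw [h.1, h.2, List.nil_append, phi_unit, if_neg (by omega), mul_zero]
        · rw [β.phi_append_unit _ h, mul_zero]
    · simp
  · rw [sum_eq_single (0, m), splitSum_eq_left]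
    · split_ifs with h
      · subst h
        rw [List.nil_append, phi_unit, if_pos rfl, degSign_gr_one, one_mul]
      · rw [β.phi_append_unit 0 (by simpa using h), map_zero, zero_mul]
    · intro u v _ hv
      rw [β.phi_append_unit 0 (by simp [hv]), map_zero, zero_mul]
    · rintro ⟨p, q⟩ hp hne
      rw [HasAntidiagonal.mem_antidiagonal] at hp
      obtain _ | p := p
      · simp_all
      · refine splitSum_eq_zero fun u v _ => ?_
        by_cases h : l₁ ++ u = []
        · rw [List.append_eq_nil_iff] at h
          rw [h.1, h.2, List.nil_append, phi_unit, if_neg (by omega), map_zero, zero_mul]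
        · rw [β.phi_append_unit _ h, map_zero, zero_mul]
    · simp

theorem d_one : β.d 1 = 0 := by
  rw [← wd_nil_zero, d, lift_wd, dWord, zero_mul]

theorem d_phi_of_mem (m : ℕ) {l : List V} (h : A.e ∈ l) : β.d ((β.phi m).ev l) = 0 := by
  by_cases hl : l.length = 1
  · obtain ⟨a, rfl⟩ := List.length_eq_one_iff.1 hl
    rw [← List.mem_singleton.1 h, phi_unit]
    split_ifs
    · exact β.d_one
    · exact map_zero _
  · rw [β.phi_unit_other m l hl h, map_zero]

theorem exists_map_vec {l : List V} (hl : ∀ a ∈ l, a ∈ Set.range β.basis) (he : A.e ∉ l) :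
    ∃ u : List β.Ix, u.map β.vec = l := by
  rw [← Set.mem_range, Set.range_list_map]
  intro a ha
  obtain ⟨i, rfl⟩ := hl a ha
  refine ⟨⟨i, ?_⟩, rfl⟩
  rintro rfl
  exact he (β.basis_unit ▸ ha)

theorem sumIns_slotLinear (m : ℕ) : SlotLinear K (β.sumIns m) :=
  SlotLinear.sum fun p _ => SlotLinear.ins _ (A.μ p.2).slotLinear (β.phi p.1).slotLinear

theorem sumMul_slotLinear (m : ℕ) : SlotLinear K (β.sumMul m) :=
  SlotLinear.sum fun p _ => SlotLinear.splitSum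
    (fun r => ((β.phi p.1).slotLinear.comp (degSign β.gr)).comp
      (LinearMap.mulRight K ((β.phi p.2).ev r)))
    (fun u => (β.phi p.2).slotLinear.comp (LinearMap.mulLeft K (degSign β.gr ((β.phi p.1).ev u))))

/-- The equation for the universal homomorphism. -/
theorem d_phi (m : ℕ) (l : List V) :
    β.d ((β.phi m).ev l) = β.sumIns m l - β.sumMul m l - β.curvTerm m l := by
  refine SlotLinear.eq_of_span ((β.phi m).slotLinear.comp β.d)
    (((β.sumIns_slotLinear m).sub (β.sumMul_slotLinear m)).sub (SlotLinear.of_nil _))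
    β.basis.span_eq (fun l hl => ?_) l
  -- On basis lists with an entry `e` both sides are known from the unit lemmas; on the others the
  -- equation is the definition of `dTau`.
  by_cases he : A.e ∈ l
  · rw [β.d_phi_of_mem m he]
    obtain ⟨l₁, l₂, rfl⟩ := List.append_of_mem he
    rw [sumIns_unit, sumMul_unit]
    by_cases h1 : l₁ = [] <;> by_cases h2 : l₂ = [] <;> simp [h1, h2]
  · obtain ⟨u, rfl⟩ := β.exists_map_vec hl he
    rw [phi_vec]
    -- The excluded pair is not a letter, so here the right side has to vanish by itself; this uses
    -- `μ_0^0 = 0` and `Φ_0^0 = 0`.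
    by_cases hc : (m, u) = (0, [])
    · obtain ⟨rfl, rfl⟩ := Prod.mk.inj hc
      have h1 : mu A 0 [] = 0 := A.curvature
      have h2 := (β.phi 0).slotLinear.map_zero [] []
      rw [List.nil_append] at h2
      simp [sumIns, sumMul, tau_zero_nil, ins, h1, h2, phi_zero_nil]
    · exact (congrArg β.d (tau_letter ⟨(m, u), hc⟩)).trans (β.d_letter ⟨(m, u), hc⟩)

end UnitalBasis

/-! ### Reindexing of lists and of the exponents of `q`. -/

theorem List.forall₂_map_map {α β γ : Type*} {R : β → γ → Prop} {f : α → β} {g : α → γ}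
    (h : ∀ a, R (f a) (g a)) (l : List α) : List.Forall₂ R (l.map f) (l.map g) := by
  induction l with
  | nil => exact .nil
  | cons a l ih => exact .cons (h a) ih

theorem sum_antidiagonal_assoc {X : Type*} [AddCommMonoid X] (f : ℕ → ℕ → ℕ → X) (n : ℕ) :
    ∑ p ∈ antidiagonal n, ∑ q ∈ antidiagonal p.1, f q.1 q.2 p.2 =
      ∑ p ∈ antidiagonal n, ∑ q ∈ antidiagonal p.2, f p.1 q.1 q.2 := by
  rw [sum_sigma', sum_sigma']
  refine sum_nbij' (fun x => ⟨(x.2.1, x.2.2 + x.1.2), (x.2.2, x.1.2)⟩)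
    (fun x => ⟨(x.1.1 + x.2.1, x.2.2), (x.1.1, x.2.1)⟩) ?_ ?_ ?_ ?_ ?_
  · rintro ⟨⟨a, b⟩, ⟨c, d⟩⟩ h
    simp only [mem_sigma, HasAntidiagonal.mem_antidiagonal] at h ⊢
    exact ⟨by omega, trivial⟩
  · rintro ⟨⟨a, b⟩, ⟨c, d⟩⟩ h
    simp only [mem_sigma, HasAntidiagonal.mem_antidiagonal] at h ⊢
    exact ⟨by omega, trivial⟩
  · rintro ⟨⟨a, b⟩, ⟨c, d⟩⟩ h
    simp only [mem_sigma, HasAntidiagonal.mem_antidiagonal] at h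
    obtain ⟨rfl, rfl⟩ := h
    rfl
  · rintro ⟨⟨a, b⟩, ⟨c, d⟩⟩ h
    simp only [mem_sigma, HasAntidiagonal.mem_antidiagonal] at h
    obtain ⟨rfl, rfl⟩ := h
    rfl
  · rintro ⟨⟨a, b⟩, ⟨c, d⟩⟩ _
    rfl

theorem sum_antidiagonal_swap_right {X : Type*} [AddCommMonoid X] (f : ℕ → ℕ → ℕ → X) (n : ℕ) :
    ∑ p ∈ antidiagonal n, ∑ q ∈ antidiagonal p.1, f q.1 q.2 p.2 =
      ∑ p ∈ antidiagonal n, ∑ q ∈ antidiagonal p.1, f q.1 p.2 q.2 := by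
  rw [sum_antidiagonal_assoc, sum_antidiagonal_assoc (fun a b c => f a c b)]
  exact sum_congr rfl fun p _ => (Nat.sum_antidiagonal_swap (f := fun q => f p.1 q.1 q.2)).symm

namespace UnitalBasis

open CobarAlg

variable {K : Type u} [Field K] {V : Type v} [AddCommGroup V] [Module K V]
  {𝒜 : ℤ → Submodule K V} [Decomposition 𝒜] {A : CurvedAInfAlgebra 𝒜} (β : UnitalBasis A)

theorem ins_phi_mem (p q : ℕ) (u : List β.Ix) :
    ins (koszul 𝒜 1) (mu A q) (β.phi p).ev (u.map β.vec) ∈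
      β.gr ((u.map β.ideg).sum + 2 - 2 * (p + q) - u.length) := by
  simp only [ins, splitSum_map]
  refine Submodule.sum_mem _ fun i _ => ?_
  obtain ⟨a, w, ha, hw⟩ : ∃ a w, a = u.take i ∧ w = u.drop i := ⟨_, _, rfl, rfl⟩
  rw [← ha, ← hw]
  refine Submodule.sum_mem _ fun j _ => ?_
  obtain ⟨b, c, hb, hc⟩ : ∃ b c, b = w.take j ∧ c = w.drop j := ⟨_, _, rfl, rfl⟩
  rw [← hb, ← hc]
  have hu : u = a ++ (b ++ c) := by rw [hb, hc, List.take_append_drop, ha, hw, List.take_append_drop]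
  have h1 : mu A q (b.map β.vec) ∈ 𝒜 ((b.map β.ideg).sum + (2 - 2 * q) - b.length) := by
    have := (A.degree q).ev_mem (List.forall₂_map_map (R := fun a n => a ∈ 𝒜 n) (f := β.vec)
      (g := β.ideg) (fun i => β.mem i) b)
    rwa [List.length_map] at this
  have h2 : (β.phi p).ev (a.map (koszul 𝒜 1 ∘ β.vec) ++ mu A q (b.map β.vec) :: c.map β.vec) ∈
      β.gr ((a.map β.ideg ++ ((b.map β.ideg).sum + (2 - 2 * q) - b.length) :: c.map β.ideg).sum +
        (1 - 2 * p) - (a.map (koszul 𝒜 1 ∘ β.vec) ++ mu A q (b.map β.vec) ::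
          c.map β.vec).length) :=
    (β.phi_degree p).ev_mem (List.rel_append
      (List.forall₂_map_map (R := fun a n => a ∈ 𝒜 n)
        (f := fun i => koszul 𝒜 1 (β.vec i)) (g := β.ideg) (fun i => koszul_mem (β.mem i)) a)
      (.cons h1 (List.forall₂_map_map (R := fun a n => a ∈ 𝒜 n) (f := β.vec) (g := β.ideg)
        (fun i => β.mem i) c)))
  rw [List.map_map]
  convert h2 using 2
  rw [hu]
  simp
  ring

theorem dTau_mem (m : ℕ) (u : List β.Ix) :
    β.dTau m u ∈ β.gr ((u.map β.ideg).sum + 1 - 2 * m - u.length + 1) := by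
  refine Submodule.sub_mem _ (Submodule.sub_mem _ ?_ ?_) ?_
  · refine Submodule.sum_mem _ fun p hp => ?_
    rw [HasAntidiagonal.mem_antidiagonal] at hp
    convert β.ins_phi_mem p.1 p.2 u using 2
    rw [← hp]
    push_cast
    ring
  · refine Submodule.sum_mem _ fun p hp => ?_
    rw [HasAntidiagonal.mem_antidiagonal] at hp
    rw [splitSum_map]
    refine Submodule.sum_mem _ fun i _ => ?_
    obtain ⟨a, w, ha, hw⟩ : ∃ a w, a = u.take i ∧ w = u.drop i := ⟨_, _, rfl, rfl⟩
    rw [← ha, ← hw]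
    dsimp only
    rw [phi_vec, phi_vec]
    have hu : u = a ++ w := by rw [ha, hw, List.take_append_drop]
    have h1 := tau_mem (K := K) β.ideg p.1 a
    have h2 := tau_mem (K := K) β.ideg p.2 w
    rw [signOp_of_mem _ _ h1, smul_mul_assoc]
    refine Submodule.negOnePow_smul_mem ?_ _
    convert SetLike.mul_mem_graded h1 h2 using 2
    rw [hu, ← hp]
    simp
    ring
  · unfold curvTerm
    split_ifs with h1 h2
    · rw [List.map_eq_nil_iff] at h1
      subst h1 h2
      simpa using W_mem (K := K) β.ideg
    · exact Submodule.zero_mem _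
    · exact Submodule.zero_mem _

theorem dWord_mem (w : List (Letter β.Ix)) : β.dWord w ∈ β.gr (listDeg β.ideg w + 1) := by
  induction w with
  | nil => exact Submodule.zero_mem _
  | cons c w ih =>
    have h0 : listDeg β.ideg (c :: w) = letterDeg β.ideg c + listDeg β.ideg w := by simp [listDeg]
    refine Submodule.add_mem _ ?_ (Submodule.negOnePow_smul_mem ?_ _)
    · convert SetLike.mul_mem_graded (β.dTau_mem c.1.1 c.1.2) (wd_mem β.ideg w 0) using 2
      rw [h0, letterDeg]
      ring
    · convert SetLike.mul_mem_graded (wd_mem β.ideg [c] 0) ih using 2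
      rw [h0]
      simp [listDeg]
      ring

theorem d_mem (n : ℤ) (x : CobarAlg K β.Ix) (hx : x ∈ β.gr n) : β.d x ∈ β.gr (n + 1) := by
  rw [AddMonoidAlgebra.mem_gradeBy_iff] at hx
  rw [d, lift, LinearMap.comp_apply, Finsupp.linearCombination_apply]
  refine Submodule.sum_mem _ fun w hw => Submodule.smul_mem _ _ ?_
  have h1 : wordDeg β.ideg w = n := hx hw
  have h2 := wordDeg_ofList β.ideg (FreeAddMonoid.toList w.1) w.2
  rw [FreeAddMonoid.ofList_toList, Prod.mk.eta, h1] at h2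
  rw [h2]
  convert SetLike.mul_mem_graded (β.dWord_mem (FreeAddMonoid.toList w.1))
    (wd_mem (K := K) β.ideg [] w.2) using 2
  simp [listDeg]

theorem degSign_d (x : CobarAlg K β.Ix) : degSign β.gr (β.d x) = - β.d (degSign β.gr x) := by
  refine linearMap_ext_homogeneous (𝒜 := β.gr) (f := degSign β.gr ∘ₗ β.d)
    (g := - (β.d ∘ₗ degSign β.gr)) (fun n a ha => ?_) x
  rw [LinearMap.neg_apply, LinearMap.comp_apply, LinearMap.comp_apply, signOp_of_mem _ _ ha,
    signOp_of_mem _ _ (β.d_mem n a ha), Int.negOnePow_add, Int.negOnePow_one, map_zsmul]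
  simp

/-! ### The differential squares to zero -/

theorem mu_map_koszul (A : CurvedAInfAlgebra 𝒜) (m : ℕ) (l : List V) :
    mu A m (l.map (koszul 𝒜 1)) = - koszul 𝒜 1 (mu A m l) := by
  rw [koszul_eq_neg_degSign, neg_neg, (A.degree m).degSign_ev, Int.negOnePow_even]
  · simp
  · exact ⟨1 - m, by ring⟩

theorem sum_ins_mu (A : CurvedAInfAlgebra 𝒜) (m : ℕ) (l : List V) :
    ∑ p ∈ antidiagonal m, ins (koszul 𝒜 1) (mu A p.2) (mu A p.1) l = 0 := by
  rw [← A.assoc m l]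
  exact sum_congr rfl fun p _ => (insertSum_eq_ins 𝒜 1 _ _ l).symm

/-- Once the exponents of `q` are regrouped, the coefficient of `Φ` is fixed and the two insertions
of `μ` square to zero by `sum_ins_ins`. -/
theorem sum_ins_sumIns (m : ℕ) (l : List V) :
    ∑ p ∈ antidiagonal m, ins (koszul 𝒜 1) (mu A p.2) (β.sumIns p.1) l = 0 := by
  have h : ∀ p ∈ antidiagonal m, ins (koszul 𝒜 1) (mu A p.2) (β.sumIns p.1) l =
      ∑ q ∈ antidiagonal p.1,
        ins (koszul 𝒜 1) (mu A p.2) (ins (koszul 𝒜 1) (mu A q.2) (β.phi q.1).ev) l :=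
    fun p _ => ins_sum _ _ _ _ _
  rw [sum_congr rfl h, sum_antidiagonal_assoc
    (fun a b c => ins (koszul 𝒜 1) (mu A c) (ins (koszul 𝒜 1) (mu A b) (β.phi a).ev) l)]
  refine sum_eq_zero fun p _ => ?_
  exact sum_ins_ins (koszul 𝒜 1) koszul_koszul (mu_map_koszul A) (sum_ins_mu A)
    (β.phi p.1).slotLinear p.2 l

/-- Insertion is a coderivation for deconcatenation, so it acts on one factor at a time. Passing it
over the first factor applies `κ` there, and `degSign_phi` converts that into the minus sign. -/
theorem sum_ins_sumMul (m : ℕ) (l : List V) :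
    ∑ p ∈ antidiagonal m, ins (koszul 𝒜 1) (mu A p.2) (β.sumMul p.1) l =
      ∑ p ∈ antidiagonal m, splitSum (fun u v =>
        degSign β.gr (β.sumIns p.1 u) * (β.phi p.2).ev v - (β.phi p.1).ev u * β.sumIns p.2 v) l := by
  have hκ : ∀ u : List V, (u.map (koszul 𝒜 1)).map (koszul 𝒜 1) = u := fun u => by
    simp [Function.comp_def, koszul_koszul]
  have h1 : ∀ p ∈ antidiagonal m, ins (koszul 𝒜 1) (mu A p.2) (β.sumMul p.1) l =
      ∑ q ∈ antidiagonal p.1, (splitSum (fun u v => degSign β.gr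
          (ins (koszul 𝒜 1) (mu A p.2) (β.phi q.1).ev u) * (β.phi q.2).ev v) l -
        splitSum (fun u v => (β.phi q.1).ev u *
          ins (koszul 𝒜 1) (mu A p.2) (β.phi q.2).ev v) l) := fun p _ => by
    unfold sumMul
    rw [ins_sum]
    refine sum_congr rfl fun q _ => ?_
    rw [ins_splitSum, sub_eq_add_neg, ← splitSum_neg]
    congr 1
    · refine splitSum_congr fun u v _ => ?_
      rw [map_ins]
      exact (map_ins (LinearMap.mulRight K ((β.phi q.2).ev v)) _ _ _ _).symm
    · refine splitSum_congr fun u v _ => ?_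
      rw [degSign_phi, hκ, ← neg_mul]
      exact (map_ins (LinearMap.mulLeft K (-(β.phi q.1).ev u)) _ _ _ _).symm
  rw [sum_congr rfl h1]
  have h2 : ∀ p : ℕ × ℕ, splitSum (fun u v =>
        degSign β.gr (β.sumIns p.1 u) * (β.phi p.2).ev v - (β.phi p.1).ev u * β.sumIns p.2 v) l =
      ∑ q ∈ antidiagonal p.1, splitSum (fun u v => degSign β.gr
          (ins (koszul 𝒜 1) (mu A q.2) (β.phi q.1).ev u) * (β.phi p.2).ev v) l -
      ∑ q ∈ antidiagonal p.2, splitSum (fun u v => (β.phi p.1).ev u *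
          ins (koszul 𝒜 1) (mu A q.2) (β.phi q.1).ev v) l := fun p => by
    simp only [sub_eq_add_neg, splitSum_add, splitSum_neg, sumIns, map_sum, sum_mul, mul_sum,
      splitSum_sum]
  simp only [h2, sum_sub_distrib]
  refine congrArg₂ (· - ·) ?_ ?_
  · exact sum_antidiagonal_swap_right (fun a b c => splitSum (fun u v => degSign β.gr
      (ins (koszul 𝒜 1) (mu A c) (β.phi a).ev u) * (β.phi b).ev v) l) m
  · exact sum_antidiagonal_assoc (fun a b c => splitSum (fun u v => (β.phi a).ev u *
          ins (koszul 𝒜 1) (mu A c) (β.phi b).ev v) l) m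

/-- A list with an inserted entry is never empty, and the curvature term lives on the empty list
alone. -/
theorem sum_ins_curvTerm (m : ℕ) (l : List V) :
    ∑ p ∈ antidiagonal m, ins (koszul 𝒜 1) (mu A p.2) (β.curvTerm p.1) l = 0 :=
  sum_eq_zero fun p _ => splitSum_eq_zero fun u w _ => splitSum_eq_zero fun b c _ => by
    simp [curvTerm]

theorem degSign_mul (x y : CobarAlg K β.Ix) :
    degSign β.gr (x * y) = degSign β.gr x * degSign β.gr y :=
  DGStructure.degSign_mul x y

/-- `degSign` is multiplicative and an involution, so both sides become sums of `Φ · degSign Φ · Φ`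
over cuts into three pieces. -/
theorem sumMul_assoc (m : ℕ) (l : List V) :
    ∑ p ∈ antidiagonal m, splitSum (fun u v =>
      degSign β.gr (β.sumMul p.1 u) * (β.phi p.2).ev v) l =
    ∑ p ∈ antidiagonal m, splitSum (fun u v => (β.phi p.1).ev u * β.sumMul p.2 v) l := by
  simp only [sumMul, map_sum, sum_mul, mul_sum, splitSum_sum, map_splitSum, degSign_mul,
    degSign_degSign]
  rw [sum_antidiagonal_assoc (fun a b c => splitSum (fun u v => splitSum (fun u v =>
    (β.phi a).ev u * degSign β.gr ((β.phi b).ev v)) u * (β.phi c).ev v) l)]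
  refine sum_congr rfl fun p _ => sum_congr rfl fun q _ => ?_
  have h1 : ∀ u v, splitSum (fun u v =>
      (β.phi p.1).ev u * degSign β.gr ((β.phi q.1).ev v)) u * (β.phi q.2).ev v =
      splitSum (fun a b => (β.phi p.1).ev a * (degSign β.gr ((β.phi q.1).ev b) *
        (β.phi q.2).ev v)) u := fun u v => by
    simp only [← mul_assoc]
    exact map_splitSum (LinearMap.mulRight K ((β.phi q.2).ev v)) _ _
  have h2 : ∀ u v, (β.phi p.1).ev u * splitSum (fun u v =>
      degSign β.gr ((β.phi q.1).ev u) * (β.phi q.2).ev v) v =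
      splitSum (fun b c => (β.phi p.1).ev u * (degSign β.gr ((β.phi q.1).ev b) *
        (β.phi q.2).ev c)) v := fun u v =>
    map_splitSum (LinearMap.mulLeft K ((β.phi p.1).ev u)) _ _
  simp only [h1, h2]
  exact (splitSum_assoc (fun a b c => (β.phi p.1).ev a * (degSign β.gr ((β.phi q.1).ev b) *
        (β.phi q.2).ev c)) l).symm

/-- Only the cut with an empty piece carries `W`, which is even and central. -/
theorem curvTerm_comm (m : ℕ) (l : List V) :
    ∑ p ∈ antidiagonal m, splitSum (fun u v =>
      degSign β.gr (β.curvTerm p.1 u) * (β.phi p.2).ev v) l =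
    ∑ p ∈ antidiagonal m, splitSum (fun u v => (β.phi p.1).ev u * β.curvTerm p.2 v) l := by
  have hW : degSign β.gr W = W := by
    rw [signOp_of_mem _ _ (W_mem β.ideg)]
    simp
  rw [← Nat.sum_antidiagonal_swap]
  refine sum_congr rfl fun p _ => ?_
  rw [splitSum_eq_left, splitSum_eq_right]
  · by_cases h : p.2 = 1
    · simp [curvTerm, h, hW, W_comm]
    · simp [curvTerm, h]
  · intro u v _ h
    simp [curvTerm, h]
  · intro u v _ h
    simp [curvTerm, h]

/-- The equation for `dΦ` is used twice. Double insertions vanish, the mixed terms cancel between `d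
(sumIns)` and `d (sumMul)`, cubic terms cancel by associativity, and the terms with `W` by its
centrality. -/
theorem d_d_phi (m : ℕ) (l : List V) : β.d (β.d ((β.phi m).ev l)) = 0 := by
  have h1 : β.d (β.sumIns m l) = - ∑ p ∈ antidiagonal m, splitSum (fun u v =>
      degSign β.gr (β.sumIns p.1 u) * (β.phi p.2).ev v - (β.phi p.1).ev u * β.sumIns p.2 v) l := by
    rw [sumIns, map_sum]
    simp only [map_ins, d_phi, ins_sub, sum_sub_distrib, sum_ins_sumIns, sum_ins_curvTerm]
    rw [zero_sub, sub_zero, sum_ins_sumMul]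
  have h2 : β.d (β.sumMul m l) = ∑ p ∈ antidiagonal m, splitSum (fun u v =>
      - (degSign β.gr (β.d ((β.phi p.1).ev u)) * (β.phi p.2).ev v) +
      (β.phi p.1).ev u * β.d ((β.phi p.2).ev v)) l := by
    simp only [sumMul, map_sum, map_splitSum, leibniz, degSign_degSign, degSign_d, neg_mul, neg_neg]
  have h3 : β.d (β.curvTerm m l) = 0 := by
    unfold curvTerm
    split_ifs
    · exact β.d_W
    · exact map_zero _
    · exact map_zero _
  rw [d_phi, map_sub, map_sub, h1, h2, h3, sub_zero]
  simp only [d_phi, map_sub, sub_mul, mul_sub]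
  simp only [sub_eq_add_neg, splitSum_add, splitSum_neg, sum_add_distrib, sum_neg_distrib,
    sumMul_assoc, curvTerm_comm]
  abel

theorem d_d (x : CobarAlg K β.Ix) : β.d (β.d x) = 0 := by
  -- The mixed terms of `d² (x y)` cancel, so letters and powers of `W` suffice.
  have hmul : ∀ x y, β.d (β.d x) = 0 → β.d (β.d y) = 0 → β.d (β.d (x * y)) = 0 := fun x y hx hy => by
    rw [leibniz, map_add, leibniz, leibniz, hx, hy, degSign_d]
    simp
  refine ext_wd (f := β.d ∘ₗ β.d) (g := 0) (fun w k => ?_) x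
  rw [LinearMap.comp_apply, LinearMap.zero_apply]
  have h1 : wd K w k = wd K w 0 * wd K ([] : List (Letter β.Ix)) k := by rw [wd_mul]; simp
  have h2 : β.d (wd K [] k) = 0 := by simp [d, dWord]
  rw [h1]
  refine hmul _ _ ?_ (by rw [h2, map_zero])
  induction w with
  | nil => rw [wd_nil_zero, d_one, map_zero]
  | cons c w ih =>
    have h3 : wd K (c :: w) 0 = wd K [c] 0 * wd K w 0 := by rw [wd_mul]; rfl
    rw [h3]
    refine hmul _ _ ?_ (ih (by rw [wd_mul]; simp))
    rw [← tau_letter, ← phi_vec, d_d_phi]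

/-- The cobar construction as a differential graded algebra. -/
def dg : DGStructure β.gr where
  d := β.d
  d_mem := β.d_mem
  d_d := β.d_d
  leibniz n a b ha := by rw [leibniz, signOp_of_mem _ _ ha, smul_mul_assoc]

theorem isCentral_W : β.dg.IsCentral W where
  mem := W_mem β.ideg
  closed := β.d_W
  comm := W_comm

end UnitalBasis

/-! ### Homomorphisms into the curved algebra of a dga. -/

section OfDG

variable {K : Type*} [Field K] {V : Type*} [AddCommGroup V] [Module K V]
  {𝒜 : ℤ → Submodule K V} [Decomposition 𝒜] {A : CurvedAInfAlgebra 𝒜}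
  {B : Type*} [Ring B] [Algebra K B] {ℬ : ℤ → Submodule K B} [GradedAlgebra ℬ]

namespace DGStructure

variable (D : DGStructure ℬ) (W : B) (Φ : ℕ → MultiOp K V B)

/-- The terms of arity `r` on the left hand side of the equation for a homomorphism to a curved
dga. -/
def homTerm (r m : ℕ) (l : List V) : B :=
  ∑ i ∈ Finset.Nat.antidiagonalTuple r l.length, ∑ k ∈ Finset.Nat.antidiagonalTuple (r + 1) m,
    D.curvedOp W (k 0) r (fun t : Fin r => (Φ (k t.succ)).ev (block l i t))

theorem homTerm_zero (m : ℕ) (l : List V) :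
    D.homTerm W Φ 0 m l = if l = [] then (if m = 1 then W else 0) else 0 := by
  match l with
  | [] =>
    rw [homTerm, List.length_nil, Finset.Nat.antidiagonalTuple_zero_zero, sum_singleton,
      Finset.Nat.antidiagonalTuple_one, sum_singleton, if_pos rfl, ← D.curvedOp_nil W m]
    rw [MultiOp.ev]
    congr 1
    funext t
    exact t.elim0
  | x :: l =>
    rw [homTerm, List.length_cons, Finset.Nat.antidiagonalTuple_zero_succ, sum_empty,
      if_neg (by simp)]

theorem homTerm_one (m : ℕ) (l : List V) : D.homTerm W Φ 1 m l = D.d ((Φ m).ev l) := by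
  have hev : ∀ (n : ℕ) (f : Fin 1 → B), D.curvedOp W n 1 f = if n = 0 then D.d (f 0) else 0 := by
    intro n f
    rw [← D.curvedOp_one W n (f 0), MultiOp.ev]
    congr 1
    funext t
    fin_cases t
    rfl
  rw [homTerm, Finset.Nat.antidiagonalTuple_one, sum_singleton, sum_eq_single ![0, m]]
  · rw [hev]
    simp [block]
  · intro k hk hne
    rw [hev, if_neg]
    intro h0
    rw [Finset.Nat.mem_antidiagonalTuple, Fin.sum_univ_two, h0, zero_add] at hk
    apply hne
    funext t
    fin_cases t
    · exact h0
    · exact hk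
  · intro h
    exact absurd (by simp [Finset.Nat.mem_antidiagonalTuple]) h

/-- `μ²` has no positive powers of `q`, which forces `k 0 = 0`; the pairs of block lengths `(i, |l|
- i)` are the cuts of `l`. -/
theorem homTerm_two (m : ℕ) (l : List V) : D.homTerm W Φ 2 m l = ∑ p ∈ antidiagonal m,
    splitSum (fun u v => degSign ℬ ((Φ p.1).ev u) * (Φ p.2).ev v) l := by
  have hev : ∀ (n : ℕ) (f : Fin 2 → B),
      D.curvedOp W n 2 f = if n = 0 then degSign ℬ (f 0) * f 1 else 0 := by
    intro n f
    rw [← D.curvedOp_two W n (f 0), MultiOp.ev]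
    congr 1
    funext t
    fin_cases t <;> rfl
  rw [homTerm, sum_comm]
  symm
  refine sum_of_injOn (fun p => ![0, p.1, p.2]) ?_ ?_ ?_ ?_
  · rintro p - q - h
    exact Prod.ext (congrFun h 1) (congrFun h 2)
  · rintro p hp
    simpa [Finset.Nat.mem_antidiagonalTuple, Fin.sum_univ_three] using hp
  · intro k hk hne
    refine sum_eq_zero fun i _ => ?_
    rw [hev, if_neg]
    intro h0
    rw [Finset.Nat.mem_antidiagonalTuple, Fin.sum_univ_three, h0, zero_add] at hk
    apply hne
    refine ⟨(k 1, k 2), by simpa using hk, ?_⟩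
    funext t
    fin_cases t
    · exact h0.symm
    · rfl
    · rfl
  · rintro p -
    refine sum_of_injOn (fun i => ![i, l.length - i]) ?_ ?_ ?_ ?_
    · rintro i - j - h
      exact congrFun h 0
    · intro i hi
      have : i < l.length + 1 := by simpa using hi
      simp [Finset.Nat.mem_antidiagonalTuple, Fin.sum_univ_two]
      omega
    · intro i hi hne
      rw [Finset.Nat.mem_antidiagonalTuple, Fin.sum_univ_two] at hi
      refine absurd ⟨i 0, by simp; omega, ?_⟩ hne
      funext t
      fin_cases t
      · rfl
      · simp; omega
    · intro i _
      rw [hev]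
      have h1 : (Iio (1 : Fin 2)) = {0} := rfl
      have h0 : (Iio (0 : Fin 2)) = ∅ := rfl
      simp [block, h0, h1, List.take_of_length_le]

theorem homTerm_of_three_le (r m : ℕ) (l : List V) : D.homTerm W Φ (r + 3) m l = 0 := by
  refine sum_eq_zero fun i _ => sum_eq_zero fun k _ => ?_
  rw [curvedOp_apply_three]
  rfl

/-- For `m + |l| ≤ 1` the range of `r` may omit arity one or two, but every omitted term then
contains `Φ_0^0 = 0`. -/
theorem sum_homTerm (h0 : (Φ 0).ev [] = 0) (m : ℕ) (l : List V) :
    ∑ r ∈ range (m + l.length + 1), D.homTerm W Φ r m l =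
      D.homTerm W Φ 0 m l + D.homTerm W Φ 1 m l + D.homTerm W Φ 2 m l := by
  have h1 : m + l.length = 0 → D.homTerm W Φ 1 m l = 0 := fun h => by
    obtain ⟨rfl, hl⟩ := Nat.add_eq_zero_iff.1 h
    rw [List.length_eq_zero_iff] at hl
    subst hl
    rw [homTerm_one, h0, map_zero]
  have h2 : m + l.length ≤ 1 → D.homTerm W Φ 2 m l = 0 := fun h => by
    rw [homTerm_two]
    refine sum_eq_zero fun p hp => splitSum_eq_zero fun u v huv => ?_
    rw [HasAntidiagonal.mem_antidiagonal] at hp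
    have := congrArg List.length huv
    rw [List.length_append] at this
    by_cases hc : p.1 = 0 ∧ u = []
    · rw [hc.1, hc.2, h0, map_zero, zero_mul]
    · have hp2 : p.2 = 0 ∧ v.length = 0 := by
        by_cases hp1 : p.1 = 0
        · have := List.length_pos_iff_ne_nil.2 fun hu => hc ⟨hp1, hu⟩
          omega
        · omega
      rw [hp2.1, List.length_eq_zero_iff.1 hp2.2, h0, mul_zero]
  have h3 : ∀ n, ∑ r ∈ range (n + 3), D.homTerm W Φ r m l =
      D.homTerm W Φ 0 m l + D.homTerm W Φ 1 m l + D.homTerm W Φ 2 m l := fun n => by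
    induction n with
    | zero => simp [sum_range_succ]
    | succ n ih => rw [add_right_comm, sum_range_succ, ih, homTerm_of_three_le, add_zero]
  match hn : m + l.length with
  | 0 => simp [h1 hn, h2 (by omega)]
  | 1 => simp [sum_range_succ, h2 (by omega)]
  | n + 2 => exact h3 n

end DGStructure

/-- Construction of homomorphisms to the curved algebra associated to a dga and a central
element. -/
def CurvedAInfHom.ofDG (D : DGStructure ℬ) {W : B} (hW : D.IsCentral W) (Φ : ℕ → MultiOp K V B)
    (degree : ∀ m : ℕ, (Φ m).HasDegree 𝒜 ℬ (1 - 2 * m)) (curvature : (Φ 0).ev [] = 0)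
    (equation : ∀ (m : ℕ) (l : List V), D.d ((Φ m).ev l) =
      ∑ p ∈ antidiagonal m, ins (koszul 𝒜 1) (A.μ p.2).ev (Φ p.1).ev l -
      ∑ p ∈ antidiagonal m, splitSum (fun u v => degSign ℬ ((Φ p.1).ev u) * (Φ p.2).ev v) l -
      if l = [] then (if m = 1 then W else 0) else 0)
    (unit : ∀ m, (Φ m).ev [A.e] = if m = 0 then 1 else 0)
    (unit_other : ∀ (m : ℕ) (l : List V), l.length ≠ 1 → A.e ∈ l → (Φ m).ev l = 0) :
    CurvedAInfHom A (D.curved hW) where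
  Φ := Φ
  degree := degree
  curvature := curvature
  equation m l := by
    refine (D.sum_homTerm W Φ curvature m l).trans ?_
    rw [D.homTerm_zero, D.homTerm_one, D.homTerm_two, equation]
    simp only [insertSum_eq_ins]
    abel
  unit := unit
  unit_other := unit_other

end OfDG

namespace CobarAlg

variable {K I : Type*} [Field K]

/-! ### Weight filtrations -/

/-- The weight of a letter. -/
def letterWt (c : Letter I) : ℕ := 2 * c.1.1 + c.1.2.length + 1

/-- The weight of a list of letters. -/
def listWt (w : List (Letter I)) : ℕ := (w.map letterWt).sum

@[simp] theorem listWt_nil : listWt ([] : List (Letter I)) = 0 := rfl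

@[simp] theorem listWt_cons (c : Letter I) (w : List (Letter I)) :
    listWt (c :: w) = letterWt c + listWt w := rfl

/-- Words which are empty or start with a letter involving the formal variable. -/
def StartsFree : List (Letter I) → Prop
  | [] => True
  | c :: _ => c.1.1 ≠ 0

open Classical in
/-- A secondary filtration index of words of the same weight. -/
def cls : List (Letter I) → ℕ
  | [] => 2
  | c :: w => if c.1.1 ≠ 0 then 2 else if c.1.2.length = 1 ∧ StartsFree w then 1 else 0

/-- The class breaks ties between words of equal weight. Away from the image of `A` and up to lower
weight, the error `dh + hd - 1` takes class `2` to class at most `1`, class `1` to class `0`, and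
class `0` to zero. As there are three classes, `3 * weight + cls` encodes the lexicographic order.
-/
theorem cls_le (w : List (Letter I)) : cls w ≤ 2 := by
  match w with
  | [] => exact le_rfl
  | c :: w =>
    rw [cls]
    split_ifs <;> omega

theorem cls_le_one {c : Letter I} (hc : c.1.1 = 0) (w : List (Letter I)) : cls (c :: w) ≤ 1 := by
  rw [cls, if_neg (not_not.2 hc)]
  split_ifs <;> omega

theorem startsFree_of_cls {w : List (Letter I)} (h : ¬ StartsFree w) : cls w ≤ 1 := by
  match w with
  | [] => exact absurd trivial h
  | c :: w => exact cls_le_one (not_not.1 h) w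

variable (K I) in
/-- The span of the words of weight at most `n`. -/
def wtFil (n : ℕ) : Submodule K (CobarAlg K I) :=
  Submodule.span K {x | ∃ w k, listWt w + 4 * k ≤ n ∧ x = wd K w k}

variable (K I) in
/-- The filtration by weight, refined by `cls`. -/
def fil (n : ℕ) : Submodule K (CobarAlg K I) :=
  Submodule.span K {x | ∃ w k, 3 * (listWt w + 4 * k) + cls w ≤ n ∧ x = wd K w k}

variable (K I) in
/-- The span of the words of weight at most `n` which are `StartsFree`. -/
def freeFil (n : ℕ) : Submodule K (CobarAlg K I) :=
  Submodule.span K {x | ∃ w k, StartsFree w ∧ listWt w + 4 * k ≤ n ∧ x = wd K w k}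

variable (K I) in
/-- The span of the words of weight at most `n` which are not `StartsFree`. -/
def vecFil (n : ℕ) : Submodule K (CobarAlg K I) :=
  Submodule.span K {x | ∃ w k, ¬ StartsFree w ∧ listWt w + 4 * k ≤ n ∧ x = wd K w k}

theorem wd_mem_wtFil {w : List (Letter I)} {k n : ℕ} (h : listWt w + 4 * k ≤ n) :
    wd K w k ∈ wtFil K I n := Submodule.subset_span ⟨w, k, h, rfl⟩

theorem fil_mono {m n : ℕ} (h : m ≤ n) : fil K I m ≤ fil K I n :=
  Submodule.span_mono fun _ ⟨w, k, hw, hx⟩ => ⟨w, k, hw.trans h, hx⟩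

theorem wtFil_le_fil {m n : ℕ} (h : 3 * m + 2 ≤ n) : wtFil K I m ≤ fil K I n :=
  Submodule.span_mono fun _ ⟨w, k, hw, hx⟩ => ⟨w, k, by have := cls_le w; omega, hx⟩

theorem vecFil_le_fil {m n : ℕ} (h : 3 * m + 1 ≤ n) : vecFil K I m ≤ fil K I n :=
  Submodule.span_mono fun _ ⟨w, k, hw, hwt, hx⟩ =>
    ⟨w, k, by have := startsFree_of_cls hw; omega, hx⟩

theorem mul_mem_wtFil {m n N : ℕ} {x y : CobarAlg K I} (hx : x ∈ wtFil K I m)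
    (hy : y ∈ wtFil K I n) (h : m + n ≤ N) : x * y ∈ wtFil K I N := by
  have : wtFil K I m * wtFil K I n ≤ wtFil K I N := by
    rw [wtFil, wtFil, Submodule.span_mul_span, Submodule.span_le]
    rintro _ ⟨_, ⟨w, k, hw, rfl⟩, _, ⟨w', k', hw', rfl⟩, rfl⟩
    dsimp only
    rw [wd_mul]
    refine wd_mem_wtFil ?_
    simp only [listWt, List.map_append, List.sum_append] at hw hw' ⊢
    omega
  exact this (Submodule.mul_mem_mul hx hy)

theorem tau_mem_wtFil {m n : ℕ} {u : List I} (h : 2 * m + u.length + 1 ≤ n) :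
    (tau m u : CobarAlg K I) ∈ wtFil K I n := by
  unfold tau
  split_ifs with hc
  · exact Submodule.zero_mem _
  · exact wd_mem_wtFil (by simpa [letterWt] using h)

theorem tau_mul_mem_vecFil {u : List I} {m n : ℕ} {x : CobarAlg K I} (hx : x ∈ wtFil K I m)
    (h : u.length + 1 + m ≤ n) : tau 0 u * x ∈ vecFil K I n := by
  unfold tau
  split_ifs with hc
  · rw [zero_mul]; exact Submodule.zero_mem _
  · induction hx using Submodule.span_induction with
    | mem x hx =>
      obtain ⟨w, k, hw, rfl⟩ := hx
      rw [wd_mul]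
      refine Submodule.subset_span ⟨_, _, ?_, ?_, rfl⟩
      · simp [StartsFree]
      · simp [letterWt]; omega
    | zero => rw [mul_zero]; exact Submodule.zero_mem _
    | add x y _ _ hx hy => rw [mul_add]; exact Submodule.add_mem _ hx hy
    | smul c x _ hx => rw [mul_smul_comm]; exact Submodule.smul_mem _ _ hx

theorem exists_add_of_mem_wtFil {n : ℕ} {x : CobarAlg K I} (hx : x ∈ wtFil K I n) :
    ∃ y ∈ freeFil K I n, ∃ z ∈ vecFil K I n, x = y + z := by
  have : wtFil K I n ≤ freeFil K I n ⊔ vecFil K I n := by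
    refine Submodule.span_le.2 ?_
    rintro _ ⟨w, k, hw, rfl⟩
    by_cases h : StartsFree w
    · exact Submodule.mem_sup_left (Submodule.subset_span ⟨w, k, h, hw, rfl⟩)
    · exact Submodule.mem_sup_right (Submodule.subset_span ⟨w, k, h, hw, rfl⟩)
  obtain ⟨y, hy, z, hz, h⟩ := Submodule.mem_sup.1 (this hx)
  exact ⟨y, hy, z, hz, h.symm⟩

/-- A non-free word of weight at most `n` goes to class `0`. A free word only goes to class `1`, but
the bound `3 * n + 1` forces its weight to be at most `n - 1`, which leaves room. -/
theorem tau_single_mul_mem_fil {v : I} {n : ℕ} {x : CobarAlg K I} (hx : x ∈ fil K I (3 * n + 1)) :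
    tau 0 [v] * x ∈ fil K I (3 * (n + 2)) := by
  induction hx using Submodule.span_induction with
  | mem x hx =>
    obtain ⟨w, k, hw, rfl⟩ := hx
    rw [show tau 0 [v] = wd K [⟨(0, [v]), by simp⟩] 0 from dif_neg _, wd_mul]
    refine Submodule.subset_span ⟨_, _, ?_, rfl⟩
    by_cases h : StartsFree w
    · have h2 : cls w = 2 := by
        match w with
        | [] => rfl
        | c :: w => exact if_pos h
      have := cls_le_one (I := I) (c := ⟨(0, [v]), by simp⟩) rfl w
      simp [letterWt]
      omega
    · have h2 : cls ((⟨(0, [v]), by simp⟩ : Letter I) :: w) = 0 := by simp [cls, h]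
      simp [letterWt, h2]
      omega
  | zero => rw [mul_zero]; exact Submodule.zero_mem _
  | add x y _ _ hx hy => rw [mul_add (tau _ _)]; exact Submodule.add_mem _ hx hy
  | smul c x _ hx => rw [mul_smul_comm]; exact Submodule.smul_mem _ _ hx

/-! ### The homotopy -/

variable (deg : I → ℤ)

variable (K) in
/-- The homotopy on words which are `StartsFree`. -/
def homotopyFree : List (Letter I) → ℕ → CobarAlg K I
  | [], 0 => 0
  | [], k + 1 => - wd K [⟨(1, []), by simp⟩] k
  | ⟨(1, []), _⟩ :: ⟨(m, u), _⟩ :: w, k => wd K (⟨(m + 1, u), by simp⟩ :: w) k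
  | _, _ => 0

variable (K) in
/-- The homotopy on words. -/
def homotopyWord : List (Letter I) → ℕ → CobarAlg K I
  | ⟨(0, [v]), h⟩ :: ⟨(0, x :: u), _⟩ :: w, k =>
    - sgn deg [⟨(0, [v]), h⟩] • wd K (⟨(0, v :: x :: u), by simp⟩ :: w) k
  | ⟨(0, [v]), h⟩ :: w, k =>
    sgn deg [⟨(0, [v]), h⟩] • (wd K [⟨(0, [v]), h⟩] 0 * homotopyFree K w k)
  | ⟨(0, _ :: _ :: _), _⟩ :: _, _ => 0
  | w, k => homotopyFree K w k

variable (K) in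
/-- The homotopy on the cobar construction. -/
def homotopy : CobarAlg K I →ₗ[K] CobarAlg K I := lift (homotopyWord K deg)

/-- The sign of a generator. -/
def sg (m : ℕ) (u : List I) : ℤ :=
  (((u.map deg).sum + 1 - 2 * m - u.length).negOnePow : ℤ)

theorem degSign_tau (m : ℕ) (u : List I) :
    degSign (grading K deg) (tau m u) = sg deg m u • tau m u :=
  signOp_of_mem _ _ (tau_mem deg m u)

theorem sg_mul_self (m : ℕ) (u : List I) : sg deg m u * sg deg m u = 1 := by
  rw [sg, ← Units.val_mul, ← Int.negOnePow_add]
  simp [Int.negOnePow_even]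

theorem sg_succ (m : ℕ) (u : List I) : sg deg (m + 1) u = sg deg m u := by
  have : (u.map deg).sum + 1 - 2 * ((m + 1 : ℕ) : ℤ) - u.length =
      ((u.map deg).sum + 1 - 2 * m - u.length) - 2 := by push_cast; ring
  rw [sg, sg, this, Int.negOnePow_sub, Int.negOnePow_even 2 (by decide), mul_one]

theorem sg_zero_nil : sg deg 0 [] = -1 := by simp [sg]

theorem sg_one_nil : sg deg 1 [] = -1 := by rw [← zero_add 1, sg_succ, sg_zero_nil]

theorem sg_zero_cons (v : I) (u : List I) : sg deg 0 (v :: u) = - (sg deg 0 [v] * sg deg 0 u) := by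
  have h1 : ((v :: u).map deg).sum + 1 - 2 * ((0 : ℕ) : ℤ) - (v :: u).length =
      (([v].map deg).sum + 1 - 2 * ((0 : ℕ) : ℤ) - [v].length) +
      ((u.map deg).sum + 1 - 2 * ((0 : ℕ) : ℤ) - u.length) - 1 := by simp; ring
  rw [sg, sg, sg, h1, Int.negOnePow_sub, Int.negOnePow_add, Int.negOnePow_one]
  simp

theorem sgn_letter (m : ℕ) (u : List I) (h : (m, u) ≠ (0, [])) :
    sgn deg [⟨(m, u), h⟩] = sg deg m u := by
  simp [sgn, sg, listDeg, letterDeg]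

theorem tau_eq {m : ℕ} {u : List I} (h : (m, u) ≠ (0, [])) :
    (tau m u : CobarAlg K I) = wd K [⟨(m, u), h⟩] 0 := dif_neg h

theorem homotopy_wd (w : List (Letter I)) (k : ℕ) :
    homotopy K deg (wd K w k) = homotopyWord K deg w k := lift_wd _ _ _

theorem homotopy_one : homotopy K deg (wd K [] 0) = 0 := homotopy_wd deg _ _

/-- The sign inverts the leading term `-W` of `d τ(1,[])`. -/
theorem homotopy_wd_nil_succ (k : ℕ) :
    homotopy K deg (wd K [] (k + 1)) = - (tau 1 [] * wd K [] k) := by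
  rw [homotopy_wd, tau_eq (by simp), wd_mul, zero_add]
  rfl

/-- No sign is needed: the product `τ(1,[]) τ(m,u)` occurs in `d τ(m+1,u)` with coefficient `-sg 1
[] = 1`. -/
theorem homotopy_q_mul_tau {m : ℕ} {u : List I} (h : (m, u) ≠ (0, [])) (b : CobarAlg K I) :
    homotopy K deg (tau 1 [] * (tau m u * b)) = tau (m + 1) u * b := by
  refine ext_wd (f := homotopy K deg ∘ₗ LinearMap.mulLeft K (tau 1 []) ∘ₗ
    LinearMap.mulLeft K (tau m u)) (g := LinearMap.mulLeft K (tau (m + 1) u)) (fun w k => ?_) b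
  simp only [LinearMap.comp_apply, LinearMap.mulLeft_apply]
  rw [tau_eq (by simp), tau_eq h, tau_eq (by simp), wd_mul, wd_mul, wd_mul, homotopy_wd]
  simp only [zero_add]
  rfl

theorem homotopy_q_mul_wd_nil (k : ℕ) : homotopy K deg (tau 1 [] * wd K [] k) = 0 := by
  rw [tau_eq (by simp), wd_mul, homotopy_wd]
  rfl

theorem homotopy_tau_succ {m : ℕ} {u : List I} (h : (m, u) ≠ (0, [])) (b : CobarAlg K I) :
    homotopy K deg (tau (m + 1) u * b) = 0 := by
  refine ext_wd (f := homotopy K deg ∘ₗ LinearMap.mulLeft K (tau (m + 1) u)) (g := 0)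
    (fun w k => ?_) b
  simp only [LinearMap.comp_apply, LinearMap.mulLeft_apply]
  rw [tau_eq (by simp), wd_mul, homotopy_wd]
  match m, u with
  | 0, [] => exact absurd rfl h
  | 0, x :: u => rfl
  | m + 1, [] => rfl
  | m + 1, x :: u => rfl

/-- This inverts the term `-sg 0 [v] • τ(0,[v]) τ(0,u)` of `d τ(0,v::u)`. -/
theorem homotopy_tau_single_mul_tau_zero (v : I) {u : List I} (h : u ≠ []) (b : CobarAlg K I) :
    homotopy K deg (tau 0 [v] * (tau 0 u * b)) = - (sg deg 0 [v] • (tau 0 (v :: u) * b)) := by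
  refine ext_wd (f := homotopy K deg ∘ₗ LinearMap.mulLeft K (tau 0 [v]) ∘ₗ
    LinearMap.mulLeft K (tau 0 u)) (g := - (sg deg 0 [v] • LinearMap.mulLeft K (tau 0 (v :: u))))
    (fun w k => ?_) b
  simp only [LinearMap.comp_apply, LinearMap.mulLeft_apply, LinearMap.neg_apply,
    LinearMap.smul_apply]
  rw [tau_eq (by simp), tau_eq (u := u) (by simpa using h), tau_eq (by simp), wd_mul, wd_mul,
    wd_mul, homotopy_wd, ← sgn_letter deg 0 [v] (by simp), ← neg_smul]
  simp only [zero_add]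
  match u with
  | x :: u => rfl

/-- The sign is the one for which `dh + hd` commutes, to leading order, with left multiplication by
`τ(0,[v])`. -/
theorem homotopy_tau_single_mul_free (v : I) {n : ℕ} {y : CobarAlg K I} (hy : y ∈ freeFil K I n) :
    homotopy K deg (tau 0 [v] * y) = sg deg 0 [v] • (tau 0 [v] * homotopy K deg y) := by
  refine LinearMap.eqOn_span (f := homotopy K deg ∘ₗ LinearMap.mulLeft K (tau 0 [v]))
    (g := sg deg 0 [v] • (LinearMap.mulLeft K (tau 0 [v]) ∘ₗ homotopy K deg)) ?_ hy
  rintro _ ⟨w, k, hw, -, rfl⟩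
  simp only [LinearMap.comp_apply, LinearMap.mulLeft_apply, LinearMap.smul_apply]
  rw [tau_eq (by simp), wd_mul, homotopy_wd, homotopy_wd, ← sgn_letter deg 0 [v] (by simp), zero_add]
  match w with
  | [] => rfl
  | ⟨(0, _), _⟩ :: w => exact absurd rfl hw
  | ⟨(m + 1, []), _⟩ :: w => rfl
  | ⟨(m + 1, x :: u), _⟩ :: w => rfl

theorem homotopy_tau_long (v x : I) (u : List I) (b : CobarAlg K I) :
    homotopy K deg (tau 0 (v :: x :: u) * b) = 0 := by
  refine ext_wd (f := homotopy K deg ∘ₗ LinearMap.mulLeft K (tau 0 (v :: x :: u))) (g := 0)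
    (fun w k => ?_) b
  simp only [LinearMap.comp_apply, LinearMap.mulLeft_apply]
  rw [tau_eq (by simp), wd_mul, homotopy_wd]
  rfl

theorem homotopyFree_mem {w : List (Letter I)} {k n : ℕ} (h : listWt w + 4 * k ≤ n + 1) :
    homotopyFree K w k ∈ wtFil K I n := by
  unfold homotopyFree
  split
  · exact Submodule.zero_mem _
  · refine Submodule.neg_mem _ (wd_mem_wtFil ?_)
    simp [letterWt] at h ⊢
    omega
  · refine wd_mem_wtFil ?_
    simp [letterWt] at h ⊢
    omega
  · exact Submodule.zero_mem _

theorem homotopyWord_vec_mem {w : List (Letter I)} {k n : ℕ} (hw : ¬ StartsFree w)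
    (h : listWt w + 4 * k ≤ n + 1) : homotopyWord K deg w k ∈ vecFil K I n := by
  unfold homotopyWord
  split
  · refine zsmul_mem ?_ _
    refine Submodule.subset_span ⟨_, _, by simp [StartsFree], ?_, rfl⟩
    simp [letterWt] at h ⊢
    omega
  · rename_i v hc w _
    rw [← tau_eq]
    refine zsmul_mem ?_ _
    simp [letterWt] at h
    -- With nothing after `τ(0,[v])` the bound `listWt w + 4 * k - 1` below would be truncated at
    -- zero; in that case `homotopyFree` vanishes.
    by_cases h0 : listWt w + 4 * k = 0
    · have : w = [] ∧ k = 0 := by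
        refine ⟨?_, by omega⟩
        match w with
        | [] => rfl
        | c :: w => simp [letterWt] at h0
      rw [this.1, this.2]
      simp [homotopyFree]
    · exact tau_mul_mem_vecFil (m := listWt w + 4 * k - 1) (homotopyFree_mem (by omega))
        (by simp; omega)
  · exact Submodule.zero_mem _
  · rename_i _ _ h1 h2 h3
    exfalso
    match w with
    | [] => exact hw trivial
    | ⟨(0, []), hc⟩ :: w => exact hc rfl
    | ⟨(0, [v]), hc⟩ :: w => exact h2 v hc w rfl
    | ⟨(0, v :: x :: u), hc⟩ :: w => exact h3 v x u hc w rfl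
    | ⟨(m + 1, u), hc⟩ :: w => exact hw (by simp [StartsFree])

theorem homotopyWord_of_startsFree {w : List (Letter I)} (hw : StartsFree w) (k : ℕ) :
    homotopyWord K deg w k = homotopyFree K w k := by
  match w with
  | [] => rfl
  | ⟨(0, _), _⟩ :: w => exact absurd rfl hw
  | ⟨(m + 1, []), _⟩ :: w => rfl
  | ⟨(m + 1, x :: u), _⟩ :: w => rfl

theorem vecFil_le_wtFil (n : ℕ) : vecFil K I n ≤ wtFil K I n :=
  Submodule.span_mono fun _ ⟨w, k, _, hw, hx⟩ => ⟨w, k, hw, hx⟩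

theorem freeFil_le_wtFil (n : ℕ) : freeFil K I n ≤ wtFil K I n :=
  Submodule.span_mono fun _ ⟨w, k, _, hw, hx⟩ => ⟨w, k, hw, hx⟩

theorem homotopy_mem_vecFil {n : ℕ} {x : CobarAlg K I} (hx : x ∈ vecFil K I (n + 1)) :
    homotopy K deg x ∈ vecFil K I n := by
  have : vecFil K I (n + 1) ≤ (vecFil K I n).comap (homotopy K deg) := by
    refine Submodule.span_le.2 ?_
    rintro _ ⟨w, k, hw, h, rfl⟩
    rw [SetLike.mem_coe, Submodule.mem_comap, homotopy_wd]
    exact homotopyWord_vec_mem deg hw h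
  exact this hx

theorem homotopy_mem_wtFil {n : ℕ} {x : CobarAlg K I} (hx : x ∈ wtFil K I (n + 1)) :
    homotopy K deg x ∈ wtFil K I n := by
  have : wtFil K I (n + 1) ≤ (wtFil K I n).comap (homotopy K deg) := by
    refine Submodule.span_le.2 ?_
    rintro _ ⟨w, k, h, rfl⟩
    rw [SetLike.mem_coe, Submodule.mem_comap, homotopy_wd]
    by_cases hw : StartsFree w
    · rw [homotopyWord_of_startsFree deg hw]
      exact homotopyFree_mem h
    · exact vecFil_le_wtFil n (homotopyWord_vec_mem deg hw h)
  exact this hx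

/-- Fusing `τ(0,[v])` with the vector letter after it yields a long letter, hence class `0`, and
lowers the total weight `n + 2` by one. -/
theorem homotopy_tau_single_mul_vec (v : I) {n : ℕ} {x : CobarAlg K I}
    (hx : x ∈ vecFil K I n) : homotopy K deg (tau 0 [v] * x) ∈ fil K I (3 * (n + 1)) := by
  have : vecFil K I n ≤ (fil K I (3 * (n + 1))).comap
      (homotopy K deg ∘ₗ LinearMap.mulLeft K (tau 0 [v])) := by
    refine Submodule.span_le.2 ?_
    rintro _ ⟨w, k, hw, h, rfl⟩
    rw [SetLike.mem_coe, Submodule.mem_comap, LinearMap.comp_apply, LinearMap.mulLeft_apply]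
    match w with
    | [] => exact absurd trivial hw
    | ⟨(m + 1, u), hc⟩ :: w => exact absurd (by simp [StartsFree]) hw
    | ⟨(0, []), hc⟩ :: w => exact absurd rfl hc
    | ⟨(0, x :: u), hc⟩ :: w =>
      have h1 : wd K (⟨(0, x :: u), hc⟩ :: w) k = tau 0 (x :: u) * wd K w k := by
        rw [tau_eq hc, wd_mul, zero_add]; rfl
      rw [h1, homotopy_tau_single_mul_tau_zero deg v (by simp), tau_eq (by simp), wd_mul]
      refine Submodule.neg_mem _ (zsmul_mem ?_ _)
      refine Submodule.subset_span ⟨_, _, ?_, rfl⟩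
      simp [letterWt, cls] at h ⊢
      omega
  exact this hx

end CobarAlg

namespace UnitalBasis

open CobarAlg

variable {K : Type u} [Field K] {V : Type v} [AddCommGroup V] [Module K V]
  {𝒜 : ℤ → Submodule K V} [Decomposition 𝒜] {A : CurvedAInfAlgebra 𝒜} (β : UnitalBasis A)

/-! ### The differential and the weight filtration -/

theorem phi_mem_wtFil (m : ℕ) (l : List V) {n : ℕ} (h : 2 * m + l.length + 1 ≤ n) :
    (β.phi m).ev l ∈ wtFil K β.Ix n := by
  -- The reduction to basis entries concerns functions on all lists; the guard on the length removes
  -- the lists to which the bound does not apply.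
  let F : List V → CobarAlg K β.Ix ⧸ wtFil K β.Ix n := fun l' =>
    if l'.length = l.length then (wtFil K β.Ix n).mkQ ((β.phi m).ev l') else 0
  have hF : SlotLinear K F := by
    intro u v
    by_cases hl : (u ++ 0 :: v).length = l.length
    · have : ∀ x, F (u ++ x :: v) = (wtFil K β.Ix n).mkQ ((β.phi m).ev (u ++ x :: v)) :=
        fun x => if_pos (by simpa using hl)
      simp only [this]
      exact (β.phi m).slotLinear.comp (wtFil K β.Ix n).mkQ u v
    · have : ∀ x, F (u ++ x :: v) = 0 := fun x => if_neg (by simpa using hl)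
      simp only [this]
      exact (0 : V →ₗ[K] _).isLinear
  have h0 := hF.eq_zero_of_span β.basis.span_eq (fun l' hl' => ?_) l
  · rw [← (wtFil K β.Ix n).ker_mkQ, LinearMap.mem_ker]
    simpa [F] using h0
  · by_cases hlen : l'.length = l.length
    · rw [show F l' = (wtFil K β.Ix n).mkQ ((β.phi m).ev l') from if_pos hlen, ← LinearMap.mem_ker,
        Submodule.ker_mkQ]
      by_cases he : A.e ∈ l'
      · by_cases hl : l'.length = 1
        · obtain ⟨a, rfl⟩ := List.length_eq_one_iff.1 hl
          rw [← List.mem_singleton.1 he, phi_unit]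
          split_ifs
          · exact wd_mem_wtFil (w := []) (k := 0) (by simp)
          · exact Submodule.zero_mem _
        · rw [β.phi_unit_other m l' hl he]
          exact Submodule.zero_mem _
      · obtain ⟨u, rfl⟩ := β.exists_map_vec hl' he
        rw [phi_vec]
        rw [List.length_map] at hlen
        exact tau_mem_wtFil (by omega)
    · exact if_neg hlen

/-- The terms of the differential of a generator which come from the operations of `A`. -/
def linPart (m : ℕ) (u : List β.Ix) : CobarAlg K β.Ix := β.sumIns m (u.map β.vec)

/-- The quadratic part of the differential of a generator. -/
def quadPart (m : ℕ) (u : List β.Ix) : CobarAlg K β.Ix :=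
  ∑ p ∈ antidiagonal m, splitSum (fun a b => sg β.ideg p.1 a • (tau p.1 a * tau p.2 b)) u

theorem d_tau (m : ℕ) (u : List β.Ix) : β.d (tau m u) = β.linPart m u - β.quadPart m u -
    if m = 1 ∧ u = [] then W else 0 := by
  rw [← phi_vec, d_phi]
  congr 1
  · congr 1
    refine sum_congr rfl fun p _ => ?_
    simp only [splitSum_map, phi_vec, degSign_tau, smul_mul_assoc]
  · simp only [curvTerm, List.map_eq_nil_iff, and_comm (a := m = 1), ite_and]

/-- Inserting `μ_n^j` changes the weight by `1 - j - 2n`, which is positive only for the vanishing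
operation `μ_0^0`. -/
theorem linPart_mem {m n : ℕ} {u : List β.Ix} (h : 2 * m + u.length + 1 ≤ n) :
    β.linPart m u ∈ wtFil K β.Ix n := by
  simp only [linPart, sumIns, ins, splitSum]
  refine Submodule.sum_mem _ fun p hp => Submodule.sum_mem _ fun i hi =>
    Submodule.sum_mem _ fun j hj => ?_
  rw [HasAntidiagonal.mem_antidiagonal] at hp
  rw [mem_range, List.length_map] at hi
  rw [mem_range, List.length_drop, List.length_map] at hj
  by_cases h0 : p.2 = 0 ∧ j = 0
  · have h1 : mu A 0 [] = 0 := A.curvature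
    rw [h0.1, h0.2, List.take_zero, h1, (β.phi p.1).slotLinear.map_zero]
    exact Submodule.zero_mem _
  · refine β.phi_mem_wtFil _ _ ?_
    simp
    omega

/-- Two letters carry the constant `1` of the weight twice, so a cut raises the weight by one. The
weight `4` of `W` makes the term `-W` of `d τ(1,[])` behave in the same way. -/
theorem quadPart_mem {m n : ℕ} {u : List β.Ix} (h : 2 * m + u.length + 2 ≤ n) :
    β.quadPart m u ∈ wtFil K β.Ix n := by
  refine Submodule.sum_mem _ fun p hp => Submodule.sum_mem _ fun i hi => zsmul_mem ?_ _
  rw [HasAntidiagonal.mem_antidiagonal] at hp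
  rw [mem_range] at hi
  refine mul_mem_wtFil (tau_mem_wtFil le_rfl) (tau_mem_wtFil le_rfl) ?_
  simp
  omega

theorem d_tau_mem {m n : ℕ} {u : List β.Ix} (h : 2 * m + u.length + 2 ≤ n) :
    β.d (tau m u) ∈ wtFil K β.Ix n := by
  rw [d_tau]
  refine Submodule.sub_mem _ (Submodule.sub_mem _ (β.linPart_mem (by omega)) (β.quadPart_mem h)) ?_
  split_ifs with hc
  · obtain ⟨rfl, rfl⟩ := hc
    exact wd_mem_wtFil (w := []) (k := 1) (by simpa using h)
  · exact Submodule.zero_mem _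

theorem dWord_mem_wtFil {n : ℕ} (w : List (Letter β.Ix)) (h : listWt w + 1 ≤ n) :
    β.dWord w ∈ wtFil K β.Ix n := by
  induction w generalizing n with
  | nil => exact Submodule.zero_mem _
  | cons c w ih =>
    rw [listWt_cons] at h
    rw [dWord, ← d_letter, ← tau_letter]
    refine Submodule.add_mem _ (mul_mem_wtFil (β.d_tau_mem le_rfl)
      (wd_mem_wtFil (k := 0) le_rfl) ?_) (zsmul_mem (mul_mem_wtFil (tau_mem_wtFil le_rfl)
      (ih le_rfl) ?_) _)
    · unfold letterWt at h; omega
    · unfold letterWt at h; omega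

theorem d_mem_wtFil {n : ℕ} {x : CobarAlg K β.Ix} (hx : x ∈ wtFil K β.Ix n) :
    β.d x ∈ wtFil K β.Ix (n + 1) := by
  have : wtFil K β.Ix n ≤ (wtFil K β.Ix (n + 1)).comap β.d := by
    refine Submodule.span_le.2 ?_
    rintro _ ⟨w, k, hw, rfl⟩
    rw [SetLike.mem_coe, Submodule.mem_comap, d, lift_wd]
    refine mul_mem_wtFil (β.dWord_mem_wtFil w le_rfl) (wd_mem_wtFil (w := []) (k := k) le_rfl) ?_
    simp
    omega
  exact this hx

/-! ### The homotopy identity up to lower order terms -/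

/-- The homotopy on the cobar construction. -/
abbrev h : CobarAlg K β.Ix →ₗ[K] CobarAlg K β.Ix := homotopy K β.ideg

/-- The anticommutator of the differential and the homotopy. -/
def box : CobarAlg K β.Ix →ₗ[K] CobarAlg K β.Ix := β.d ∘ₗ β.h + β.h ∘ₗ β.d

theorem box_apply (x : CobarAlg K β.Ix) : β.box x = β.d (β.h x) + β.h (β.d x) := rfl

theorem sg_smul_sg_smul (m : ℕ) (u : List β.Ix) (x : CobarAlg K β.Ix) :
    sg β.ideg m u • sg β.ideg m u • x = x := by
  rw [smul_smul, sg_mul_self, one_smul]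

theorem d_tau_mul (m : ℕ) (u : List β.Ix) (b : CobarAlg K β.Ix) :
    β.d (tau m u * b) = β.d (tau m u) * b + sg β.ideg m u • (tau m u * β.d b) := by
  rw [leibniz, degSign_tau, smul_mul_assoc]

theorem quadPart_zero_cons (v : β.Ix) (u : List β.Ix) :
    β.quadPart 0 (v :: u) =
      splitSum (fun a c => sg β.ideg 0 (v :: a) • (tau 0 (v :: a) * tau 0 c)) u := by
  simp [quadPart, splitSum_cons, tau_zero_nil]

theorem d_tau_zero_cons (v : β.Ix) (u : List β.Ix) :
    β.d (tau 0 (v :: u)) = β.linPart 0 (v :: u) - β.quadPart 0 (v :: u) := by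
  rw [d_tau, if_neg (by simp), sub_zero]

theorem d_tau_single (v : β.Ix) : β.d (tau 0 [v]) = β.linPart 0 [v] := by
  rw [d_tau_zero_cons, quadPart_zero_cons]
  simp [tau_zero_nil]

theorem d_q : β.d (tau 1 []) = β.linPart 1 [] - W := by
  rw [d_tau, if_pos ⟨rfl, rfl⟩]
  simp [quadPart, Nat.antidiagonal_succ, tau_zero_nil]

theorem d_wd_nil (k : ℕ) : β.d (wd K [] k) = 0 := by simp [d, dWord]

theorem wd_nil_succ (k : ℕ) : (wd K [] (k + 1) : CobarAlg K β.Ix) = W * wd K [] k := by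
  rw [W, wd_mul, add_comm]; rfl

/-- `h` kills words that start with a long letter. Of the quadratic part only the cut right after
`v` survives, and `h` fuses it back to the original word. -/
theorem box_sub_tau_long (v : β.Ix) {u : List β.Ix} (hu : u ≠ []) {n : ℕ} {b : CobarAlg K β.Ix}
    (hb : b ∈ wtFil K β.Ix n) :
    β.box (tau 0 (v :: u) * b) - tau 0 (v :: u) * b ∈ wtFil K β.Ix (n + u.length + 1) := by
  have hlong : ∀ a : List β.Ix, a ≠ [] → ∀ b, β.h (tau 0 (v :: a) * b) = 0 := by
    intro a ha b
    match a with
    | x :: a => exact homotopy_tau_long _ v x a b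
  have hquad : β.h (β.quadPart 0 (v :: u) * b) = - (tau 0 (v :: u) * b) := by
    have h1 := map_splitSum (β.h ∘ₗ LinearMap.mulRight K b)
      (fun a c => sg β.ideg 0 (v :: a) • (tau 0 (v :: a) * tau 0 c)) u
    rw [← quadPart_zero_cons] at h1
    refine h1.trans ?_
    rw [splitSum_eq_left]
    · rw [LinearMap.comp_apply, LinearMap.mulRight_apply, smul_mul_assoc, mul_assoc, map_zsmul,
        homotopy_tau_single_mul_tau_zero _ v hu, smul_neg, sg_smul_sg_smul]
    · intro a c _ ha
      rw [LinearMap.comp_apply, LinearMap.mulRight_apply, smul_mul_assoc, mul_assoc, map_zsmul,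
        hlong a ha, smul_zero]
  rw [box_apply, hlong u hu, d_tau_mul, map_zero, map_add, map_zsmul, hlong u hu, d_tau_zero_cons,
    sub_mul, map_sub, hquad]
  have h2 := homotopy_mem_wtFil β.ideg (mul_mem_wtFil (N := n + u.length + 1 + 1)
    (β.linPart_mem (m := 0) (u := v :: u) le_rfl) hb (by simp; omega))
  convert h2 using 1
  rw [smul_zero]
  abel

/-- Every cut inside `u` occurs in `dh` and in `hd` with opposite signs. The cut between `v` and `u`
occurs in `dh` alone and gives the identity. -/
theorem box_sub_tau_tau (v : β.Ix) {u : List β.Ix} (hu : u ≠ []) {n : ℕ} {b : CobarAlg K β.Ix}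
    (hb : b ∈ wtFil K β.Ix n) :
    β.box (tau 0 [v] * (tau 0 u * b)) - tau 0 [v] * (tau 0 u * b) ∈
      wtFil K β.Ix (n + u.length + 2) := by
  have hdu : β.d (tau 0 u) = β.linPart 0 u - β.quadPart 0 u := by
    match u with
    | x :: u => exact β.d_tau_zero_cons x u
  have hh := fun {u : List β.Ix} (hu : u ≠ []) b =>
    homotopy_tau_single_mul_tau_zero (K := K) β.ideg v hu b
  have hquad : sg β.ideg 0 [v] • (β.quadPart 0 (v :: u) * b) -
      sg β.ideg 0 [v] • β.h (tau 0 [v] * (β.quadPart 0 u * b)) = tau 0 [v] * (tau 0 u * b) := by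
    have h1 := map_splitSum (sg β.ideg 0 [v] • LinearMap.mulRight K b)
      (fun a c => sg β.ideg 0 (v :: a) • (tau 0 (v :: a) * tau 0 c)) u
    rw [← quadPart_zero_cons] at h1
    have h2 := map_splitSum (- (sg β.ideg 0 [v] • (β.h ∘ₗ LinearMap.mulLeft K (tau 0 [v]) ∘ₗ
      LinearMap.mulRight K b))) (fun a c => sg β.ideg 0 a • (tau 0 a * tau 0 c)) u
    have h3 : splitSum (fun a c => sg β.ideg 0 a • (tau 0 a * tau 0 c)) u = β.quadPart 0 u := by
      simp [quadPart]
    rw [h3] at h2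
    have h4 := congrArg₂ (· + ·) h1 h2
    rw [← splitSum_add] at h4
    refine (sub_eq_add_neg _ _).trans (h4.trans ?_)
    rw [splitSum_eq_left]
    · simp only [LinearMap.smul_apply, LinearMap.neg_apply, LinearMap.comp_apply,
        LinearMap.mulRight_apply, LinearMap.mulLeft_apply, tau_zero_nil]
      simp only [zero_mul, smul_zero, mul_zero, map_zero, neg_zero, add_zero]
      rw [smul_mul_assoc, sg_smul_sg_smul, mul_assoc]
    · intro a c _ ha
      simp only [LinearMap.smul_apply, LinearMap.neg_apply, LinearMap.comp_apply,
        LinearMap.mulRight_apply, LinearMap.mulLeft_apply]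
      simp only [smul_mul_assoc, mul_smul_comm, map_zsmul, mul_assoc, hh ha, sg_zero_cons _ v a]
      simp only [smul_neg, neg_smul, smul_smul, neg_neg]
      rw [mul_comm (sg β.ideg 0 a), neg_add_cancel]
  have hT : sg β.ideg 0 [v] • sg β.ideg 0 (v :: u) • (tau 0 (v :: u) * β.d b) =
      - (sg β.ideg 0 u • (tau 0 (v :: u) * β.d b)) := by
    rw [sg_zero_cons _ v u, neg_smul, smul_neg, mul_smul, sg_smul_sg_smul]
  have hT' : sg β.ideg 0 [v] • sg β.ideg 0 u • sg β.ideg 0 [v] • (tau 0 (v :: u) * β.d b) =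
      sg β.ideg 0 u • (tau 0 (v :: u) * β.d b) := by
    rw [smul_comm (sg β.ideg 0 u), sg_smul_sg_smul]
  have hkey : β.box (tau 0 [v] * (tau 0 u * b)) - tau 0 [v] * (tau 0 u * b) =
      - (sg β.ideg 0 [v] • (β.linPart 0 (v :: u) * b)) +
      (β.h (β.linPart 0 [v] * (tau 0 u * b)) +
        sg β.ideg 0 [v] • β.h (tau 0 [v] * (β.linPart 0 u * b))) := by
    rw [box_apply, hh hu, d_tau_mul, d_tau_mul, map_neg, map_zsmul, d_tau_mul, d_tau_single, hdu,
      d_tau_zero_cons]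
    simp only [mul_add, mul_smul_comm, sub_mul, mul_sub, map_add, map_sub, map_zsmul, hh hu,
      smul_add, smul_sub, smul_neg, hT, hT']
    rw [← hquad]
    abel
  rw [hkey]
  refine Submodule.add_mem _ (Submodule.neg_mem _ (zsmul_mem ?_ _))
    (Submodule.add_mem _ (homotopy_mem_wtFil _ ?_) (zsmul_mem (homotopy_mem_wtFil _ ?_) _))
  · exact mul_mem_wtFil (β.linPart_mem le_rfl) hb (by simp; omega)
  · exact mul_mem_wtFil (β.linPart_mem le_rfl)
      (mul_mem_wtFil (tau_mem_wtFil le_rfl) hb le_rfl) (by simp; omega)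
  · exact mul_mem_wtFil (tau_mem_wtFil le_rfl)
      (mul_mem_wtFil (β.linPart_mem le_rfl) hb le_rfl) (by simp; omega)

theorem box_sub_wd_nil (k : ℕ) :
    β.box (wd K [] (k + 1)) - wd K [] (k + 1) ∈ wtFil K β.Ix (4 * k + 3) := by
  have hkey : β.box (wd K [] (k + 1)) - wd K [] (k + 1) = - (β.linPart 1 [] * wd K [] k) := by
    rw [box_apply, homotopy_wd_nil_succ, d_wd_nil, map_zero, add_zero, map_neg, d_tau_mul, d_wd_nil,
      d_q, wd_nil_succ, mul_zero, smul_zero, add_zero, sub_mul]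
    abel
  rw [hkey]
  exact Submodule.neg_mem _ (mul_mem_wtFil (β.linPart_mem le_rfl)
    (wd_mem_wtFil (w := []) (k := k) le_rfl) (by simp; omega))

theorem box_sub_q_mul_wd_nil (k : ℕ) :
    β.box (tau 1 [] * wd K [] k) - tau 1 [] * wd K [] k ∈ wtFil K β.Ix (4 * k + 2) := by
  have hkey : β.box (tau 1 [] * wd K [] k) - tau 1 [] * wd K [] k =
      β.h (β.linPart 1 [] * wd K [] k) := by
    rw [box_apply, homotopy_q_mul_wd_nil, map_zero, zero_add, d_tau_mul, d_wd_nil, d_q, mul_zero,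
      smul_zero, add_zero, sub_mul, ← wd_nil_succ, map_sub, homotopy_wd_nil_succ]
    abel
  rw [hkey]
  exact homotopy_mem_wtFil _ (mul_mem_wtFil (β.linPart_mem le_rfl)
    (wd_mem_wtFil (w := []) (k := k) le_rfl) (by simp; omega))

/-- The part of `quadPart (m + 1) u` whose first factors do not involve the formal variable. -/
def quadVec (m : ℕ) (u : List β.Ix) : CobarAlg K β.Ix :=
  splitSum (fun a c => sg β.ideg 0 a • (tau 0 a * tau (m + 1) c)) u

/-- The part of `quadPart (m + 1) u` whose first factors involve the formal variable. -/
def quadFree (m : ℕ) (u : List β.Ix) : CobarAlg K β.Ix :=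
  ∑ p ∈ antidiagonal m, splitSum (fun a b => sg β.ideg p.1 a • (tau (p.1 + 1) a * tau p.2 b)) u

theorem quadPart_succ (m : ℕ) (u : List β.Ix) :
    β.quadPart (m + 1) u = β.quadVec m u + β.quadFree m u := by
  simp only [quadPart, Nat.sum_antidiagonal_succ, sg_succ]
  rfl

theorem quadVec_mul_mem {m n N : ℕ} {u : List β.Ix} {b : CobarAlg K β.Ix}
    (hb : b ∈ wtFil K β.Ix n) (h : 2 * m + u.length + 4 + n ≤ N) :
    β.quadVec m u * b ∈ vecFil K β.Ix N := by
  rw [quadVec, splitSum, sum_mul]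
  refine Submodule.sum_mem _ fun i hi => ?_
  rw [mem_range] at hi
  rw [smul_mul_assoc, mul_assoc]
  refine zsmul_mem (tau_mul_mem_vecFil (mul_mem_wtFil (tau_mem_wtFil le_rfl) hb le_rfl) ?_) _
  simp
  omega

theorem d_tau_succ {m : ℕ} {u : List β.Ix} (h : (m, u) ≠ (0, [])) :
    β.d (tau (m + 1) u) = β.linPart (m + 1) u - (β.quadVec m u + β.quadFree m u) := by
  rw [d_tau, if_neg (by simpa using h), sub_zero, quadPart_succ]

/-- The only free first letter that `h` can fuse with its successor is `τ(1,[])`; its coefficient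
`sg 0 [] = -1` is the sign of the result. -/
theorem h_quadFree_mul {m : ℕ} {u : List β.Ix} (h : (m, u) ≠ (0, [])) (b : CobarAlg K β.Ix) :
    β.h (β.quadFree m u * b) = - (tau (m + 1) u * b) := by
  have h1 : ∀ (p : ℕ × ℕ) (a c : List β.Ix), (p.1, a) ≠ (0, []) →
      (β.h ∘ₗ LinearMap.mulRight K b) (sg β.ideg p.1 a • (tau (p.1 + 1) a * tau p.2 c)) = 0 := by
    intro p a c ha
    rw [map_zsmul, LinearMap.comp_apply, LinearMap.mulRight_apply, mul_assoc,
      homotopy_tau_succ _ ha, smul_zero]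
  have h2 : β.h (β.quadFree m u * b) = ∑ p ∈ antidiagonal m, splitSum (fun a c =>
      (β.h ∘ₗ LinearMap.mulRight K b) (sg β.ideg p.1 a • (tau (p.1 + 1) a * tau p.2 c))) u := by
    simp only [← map_splitSum, ← map_sum]
    rfl
  rw [h2, sum_eq_single (0, m), splitSum_eq_left]
  · rw [map_zsmul, LinearMap.comp_apply, LinearMap.mulRight_apply, mul_assoc, sg_zero_nil, neg_smul,
      one_smul, homotopy_q_mul_tau _ h]
  · exact fun a c _ ha => h1 _ a c (by simpa using ha)
  · rintro p hp hne
    rw [HasAntidiagonal.mem_antidiagonal] at hp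
    refine splitSum_eq_zero fun a c _ => h1 _ a c fun hc => hne ?_
    have := congrArg Prod.fst hc
    dsimp only at this
    exact Prod.ext this (by simp; omega)
  · simp

/-- The quadratic terms with a free first factor return the word itself. Those with a vector letter
in front keep the weight but drop to class at most `1`. -/
theorem box_sub_tau_succ {m : ℕ} {u : List β.Ix} (h : (m, u) ≠ (0, [])) {n N : ℕ}
    {b : CobarAlg K β.Ix} (hb : b ∈ wtFil K β.Ix n) (hN : 2 * m + u.length + 3 + n = N) :
    β.box (tau (m + 1) u * b) - tau (m + 1) u * b ∈ fil K β.Ix (3 * N + 1) := by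
  have hkey : β.box (tau (m + 1) u * b) - tau (m + 1) u * b =
      β.h (β.linPart (m + 1) u * b) - β.h (β.quadVec m u * b) := by
    rw [box_apply, homotopy_tau_succ _ h, map_zero, zero_add, d_tau_mul, map_add, map_zsmul,
      homotopy_tau_succ _ h, β.d_tau_succ h, smul_zero, add_zero, sub_mul, add_mul, map_sub,
      map_add, h_quadFree_mul _ h]
    abel
  rw [hkey]
  refine Submodule.sub_mem _ (wtFil_le_fil (m := N - 1) (by omega) (homotopy_mem_wtFil _ ?_))
    (vecFil_le_fil le_rfl (homotopy_mem_vecFil _ ?_))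
  · exact mul_mem_wtFil (β.linPart_mem le_rfl) hb (by omega)
  · exact β.quadVec_mul_mem hb (by omega)

/-- Fusing `τ(1,[])` into each first factor turns `quadPart` into `quadFree`, except for the trivial
first factor: it is zero in `quadPart`, but contributes `-τ(1,[]) τ(m,u)` to `quadFree`. -/
theorem h_q_mul_quadPart_mul (m : ℕ) (u : List β.Ix) (b : CobarAlg K β.Ix) :
    β.h (tau 1 [] * (β.quadPart m u * b)) = β.quadFree m u * b + tau 1 [] * (tau m u * b) := by
  let f : CobarAlg K β.Ix →ₗ[K] CobarAlg K β.Ix :=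
    β.h ∘ₗ LinearMap.mulLeft K (tau 1 []) ∘ₗ LinearMap.mulRight K b
  let g : ℕ × ℕ → List β.Ix → List β.Ix → CobarAlg K β.Ix := fun p a c =>
    f (sg β.ideg p.1 a • (tau p.1 a * tau p.2 c)) -
      LinearMap.mulRight K b (sg β.ideg p.1 a • (tau (p.1 + 1) a * tau p.2 c))
  have h1 : ∀ (p : ℕ × ℕ) (a c : List β.Ix), (p.1, a) ≠ (0, []) → g p a c = 0 := by
    intro p a c ha
    simp only [g, f, map_zsmul, LinearMap.comp_apply, LinearMap.mulRight_apply,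
      LinearMap.mulLeft_apply, mul_assoc, homotopy_q_mul_tau _ ha, sub_self]
  have h2 : β.h (tau 1 [] * (β.quadPart m u * b)) - β.quadFree m u * b =
      ∑ p ∈ antidiagonal m, splitSum (g p) u := by
    have hf : f (β.quadPart m u) = ∑ p ∈ antidiagonal m, splitSum (fun a c =>
        f (sg β.ideg p.1 a • (tau p.1 a * tau p.2 c))) u := by
      simp only [← map_splitSum, ← map_sum]
      rfl
    have hr : LinearMap.mulRight K b (β.quadFree m u) = ∑ p ∈ antidiagonal m, splitSum (fun a c =>
        LinearMap.mulRight K b (sg β.ideg p.1 a • (tau (p.1 + 1) a * tau p.2 c))) u := by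
      simp only [← map_splitSum, ← map_sum]
      rfl
    refine (congrArg₂ (· - ·) hf hr).trans ?_
    rw [← sum_sub_distrib]
    exact sum_congr rfl fun p _ => (sum_sub_distrib _ _).symm
  rw [← sub_eq_iff_eq_add', h2, sum_eq_single (0, m), splitSum_eq_left]
  · simp only [g, tau_zero_nil, zero_mul, smul_zero, map_zero, zero_sub, sg_zero_nil, neg_smul,
      one_smul, LinearMap.mulRight_apply, zero_add]
    rw [neg_mul, neg_neg, mul_assoc]
  · exact fun a c _ ha => h1 _ a c (by simpa using ha)
  · rintro p hp hne
    rw [HasAntidiagonal.mem_antidiagonal] at hp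
    refine splitSum_eq_zero fun a c _ => h1 _ a c fun hc => hne ?_
    have := congrArg Prod.fst hc
    dsimp only at this
    exact Prod.ext this (by simp; omega)
  · simp

/-- The `quadFree` terms of `dh` cancel against `hd`, and the discrepancy in `h_q_mul_quadPart_mul`
is precisely the original word. -/
theorem box_sub_q_mul_tau {m : ℕ} {u : List β.Ix} (h : (m, u) ≠ (0, [])) {n N : ℕ}
    {b : CobarAlg K β.Ix} (hb : b ∈ wtFil K β.Ix n) (hN : 2 * m + u.length + 4 + n = N) :
    β.box (tau 1 [] * (tau m u * b)) - tau 1 [] * (tau m u * b) ∈ fil K β.Ix (3 * N + 1) := by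
  have hT : sg β.ideg 1 [] • (tau 1 [] * (sg β.ideg m u • (tau m u * β.d b))) =
      - (sg β.ideg m u • (tau 1 [] * (tau m u * β.d b))) := by
    rw [sg_one_nil, neg_smul, one_smul, mul_smul_comm]
  -- The terms with `W` from `d τ(m,u)` and from `d τ(1,[])`. They cancel if `(m,u) = (1,[])`;
  -- otherwise only the second occurs, and it starts with a vector letter for `m = 0` and is killed
  -- by `h` for `m > 0`.
  have hW : β.h (tau 1 [] * ((if m = 1 ∧ u = [] then W else 0) * b)) - β.h (W * (tau m u * b)) ∈
      fil K β.Ix (3 * N + 1) := by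
    match m with
    | 0 =>
      rw [if_neg (by simp), zero_mul, mul_zero, map_zero, zero_sub]
      refine Submodule.neg_mem _ (vecFil_le_fil (m := N) (by omega) (homotopy_mem_vecFil _ ?_))
      rw [← mul_assoc, W_comm, mul_assoc]
      refine tau_mul_mem_vecFil (mul_mem_wtFil (m := 4) (wd_mem_wtFil (w := []) (by simp)) hb le_rfl) ?_
      omega
    | m + 1 =>
      by_cases hm : (m, u) = (0, [])
      · obtain ⟨rfl, rfl⟩ := Prod.mk.inj hm
        rw [if_pos ⟨rfl, rfl⟩, ← mul_assoc, ← W_comm, mul_assoc, sub_self]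
        exact Submodule.zero_mem _
      · rw [if_neg (by simpa using hm), ← mul_assoc W, W_comm, mul_assoc, homotopy_tau_succ _ hm]
        simp
  have hkey : β.box (tau 1 [] * (tau m u * b)) - tau 1 [] * (tau m u * b) =
      β.linPart (m + 1) u * b - β.quadVec m u * b + β.h (β.linPart 1 [] * (tau m u * b)) -
      β.h (tau 1 [] * (β.linPart m u * b)) +
      (β.h (tau 1 [] * ((if m = 1 ∧ u = [] then W else 0) * b)) - β.h (W * (tau m u * b))) := by
    rw [box_apply, homotopy_q_mul_tau _ h, d_tau_mul, d_tau_mul, d_tau_mul, β.d_tau_succ h, d_q,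
      d_tau, sg_succ]
    simp only [mul_add, sub_mul, add_mul, mul_sub, map_add, map_sub, smul_add, smul_sub, hT]
    simp only [sg_one_nil, neg_smul, one_smul, map_neg, map_zsmul, homotopy_q_mul_tau _ h,
      h_q_mul_quadPart_mul]
    abel
  rw [hkey]
  refine Submodule.add_mem _ (Submodule.sub_mem _ (Submodule.add_mem _ (Submodule.sub_mem _ ?_ ?_)
    (wtFil_le_fil (m := N - 1) (by omega) (homotopy_mem_wtFil _ ?_)))
    (wtFil_le_fil (m := N - 1) (by omega) (homotopy_mem_wtFil _ ?_))) hW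
  · exact wtFil_le_fil (m := N - 1) (by omega)
      (mul_mem_wtFil (β.linPart_mem le_rfl) hb (by omega))
  · exact vecFil_le_fil le_rfl (β.quadVec_mul_mem hb (by omega))
  · exact mul_mem_wtFil (β.linPart_mem le_rfl)
      (mul_mem_wtFil (tau_mem_wtFil le_rfl) hb le_rfl) (by simp; omega)
  · exact mul_mem_wtFil (tau_mem_wtFil le_rfl)
      (mul_mem_wtFil (β.linPart_mem le_rfl) hb le_rfl) (by simp; omega)

/-- `box` commutes with `τ(0,[v])` on free words, except for insertion terms and for the non-free
part `y₀` of `dy`, on which `h` follows another rule. Behind `τ(0,[v])` the error of `y` and the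
`y₀` terms have class `0`. -/
theorem box_sub_tau_single_mul (v : β.Ix) {n : ℕ} {y : CobarAlg K β.Ix}
    (hy : y ∈ freeFil K β.Ix (n + 1)) (hbox : β.box y - y ∈ fil K β.Ix (3 * (n + 1) + 1)) :
    β.box (tau 0 [v] * y) - tau 0 [v] * y ∈ fil K β.Ix (3 * (n + 3)) := by
  have hy' := freeFil_le_wtFil _ hy
  obtain ⟨y₂, hy₂, y₀, hy₀, hdy⟩ := exists_add_of_mem_wtFil (β.d_mem_wtFil hy')
  have hkey : β.box (tau 0 [v] * y) - tau 0 [v] * y =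
      tau 0 [v] * (β.box y - y) + sg β.ideg 0 [v] • (β.linPart 0 [v] * β.h y) +
      β.h (β.linPart 0 [v] * y) + sg β.ideg 0 [v] • β.h (tau 0 [v] * y₀) - tau 0 [v] * β.h y₀ := by
    rw [box_apply, homotopy_tau_single_mul_free _ v hy, map_zsmul, d_tau_mul, d_tau_mul,
      d_tau_single, map_add, map_zsmul, smul_add, sg_smul_sg_smul, box_apply, hdy, mul_add, map_add,
      homotopy_tau_single_mul_free _ v hy₂, smul_add, sg_smul_sg_smul, map_add, mul_sub, mul_add,
      mul_add]
    abel
  rw [hkey]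
  refine Submodule.sub_mem _ (Submodule.add_mem _ (Submodule.add_mem _ (Submodule.add_mem _
    (tau_single_mul_mem_fil hbox) (zsmul_mem (wtFil_le_fil (m := n + 2) (by omega) ?_) _))
    (wtFil_le_fil (m := n + 2) (by omega) (homotopy_mem_wtFil _ ?_)))
    (zsmul_mem (homotopy_tau_single_mul_vec _ v hy₀) _)) ?_
  · exact mul_mem_wtFil (β.linPart_mem le_rfl) (homotopy_mem_wtFil _ hy') (by simp; omega)
  · exact mul_mem_wtFil (β.linPart_mem le_rfl) hy' (by simp; omega)
  · exact tau_single_mul_mem_fil (vecFil_le_fil le_rfl (homotopy_mem_vecFil _ hy₀))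

end UnitalBasis

/-- The last hypothesis says that the quotient complex by the image of `f` is acyclic; the proof is
the resulting diagram chase. -/
theorem isQuasiIso_of_injective {K : Type*} [Field K] {V : Type*} [AddCommGroup V] [Module K V]
    {V' : Type*} [AddCommGroup V'] [Module K V'] {d : V →ₗ[K] V} {d' : V' →ₗ[K] V'} {f : V →ₗ[K] V'}
    (hd : ∀ a, d' (d' a) = 0) (hf : ∀ a, f (d a) = d' (f a)) (hinj : Function.Injective f)
    (hsurj : ∀ z, d' z ∈ LinearMap.range f → z ∈ LinearMap.range d' ⊔ LinearMap.range f) :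
    IsQuasiIso d d' f := by
  refine ⟨hf, ?_, ?_⟩
  · rw [← LinearMap.ker_eq_bot, LinearMap.ker_eq_bot']
    intro x hx
    obtain ⟨⟨a, ha⟩, rfl⟩ := Submodule.mkQ_surjective _ x
    have h1 : Submodule.Quotient.mk (f.restrict (p := LinearMap.ker d) (q := LinearMap.ker d')
        (fun a ha => by
          rw [LinearMap.mem_ker] at ha ⊢
          rw [← hf, ha, map_zero]) ⟨a, ha⟩) = (0 : Cohomology d') := hx
    rw [Submodule.Quotient.mk_eq_zero] at h1
    obtain ⟨b, hb⟩ := h1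
    have hb' : d' b = f a := hb
    obtain ⟨_, ⟨b', rfl⟩, _, ⟨a', rfl⟩, hba⟩ := Submodule.mem_sup.1 (hsurj b ⟨a, hb'.symm⟩)
    refine (Submodule.Quotient.mk_eq_zero _).2 ⟨a', hinj ?_⟩
    rw [hf]
    change d' (f a') = f a
    rw [← hb', ← hba, map_add, hd, zero_add]
  · intro x
    obtain ⟨⟨z, hz⟩, rfl⟩ := Submodule.mkQ_surjective _ x
    have hz' : d' z = 0 := hz
    obtain ⟨_, ⟨b, rfl⟩, _, ⟨a, rfl⟩, hba⟩ := Submodule.mem_sup.1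
      (hsurj z (by rw [hz']; exact Submodule.zero_mem _))
    have ha : d a = 0 := by
      apply hinj
      rw [hf, map_zero, ← hz', ← hba, map_add, hd, zero_add]
    refine ⟨Submodule.Quotient.mk ⟨a, ha⟩, (Submodule.Quotient.eq _).2 ⟨- b, ?_⟩⟩
    change d' (- b) = f a - z
    rw [map_neg, ← hba]
    abel

namespace UnitalBasis

open CobarAlg

variable {K : Type u} [Field K] {V : Type v} [AddCommGroup V] [Module K V]
  {𝒜 : ℤ → Submodule K V} [Decomposition 𝒜] {A : CurvedAInfAlgebra 𝒜} (β : UnitalBasis A)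

/-! ### The inclusion of generators is a quasi-isomorphism -/

/-- The linear part of the universal homomorphism. -/
def incl : V →ₗ[K] CobarAlg K β.Ix := (β.phi 0).lin

theorem _root_.MultiOp.lin_apply {V' : Type*} [AddCommGroup V'] [Module K V']
    (φ : MultiOp K V V') (a : V) : φ.lin a = φ.ev [a] := by
  change φ 1 _ = φ 1 _
  congr 1
  funext t
  fin_cases t
  rfl

theorem incl_apply (a : V) : β.incl a = (β.phi 0).ev [a] := (β.phi 0).lin_apply a

theorem incl_vec (v : β.Ix) : β.incl (β.vec v) = tau 0 [v] := by
  rw [incl_apply]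
  exact β.phi_vec 0 [v]

theorem incl_unit : β.incl A.e = 1 := by
  rw [incl_apply, phi_unit, if_pos rfl]

/-- The words `1` and `τ(0,[v])` are the ones left unpaired by the homotopy. -/
theorem h_incl (a : V) : β.h (β.incl a) = 0 := by
  have : β.h ∘ₗ β.incl = 0 := by
    refine β.basis.ext fun i => ?_
    rw [LinearMap.comp_apply, LinearMap.zero_apply]
    by_cases hi : i = β.unit
    · rw [hi, β.basis_unit, incl_unit, ← wd_nil_zero, homotopy_one]
    · have h1 : (1 : CobarAlg K β.Ix) ∈ freeFil K β.Ix 0 :=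
        Submodule.subset_span ⟨[], 0, trivial, by simp, rfl⟩
      have h2 := homotopy_tau_single_mul_free β.ideg ⟨i, hi⟩ h1
      rw [mul_one, ← wd_nil_zero, homotopy_one, mul_zero, smul_zero] at h2
      exact (congrArg β.h (β.incl_vec ⟨i, hi⟩)).trans h2
  exact LinearMap.congr_fun this a

theorem d_incl (a : V) : β.incl ((A.μ 0).lin a) = β.d (β.incl a) := by
  have h0 : mu A 0 [] = 0 := A.curvature
  have h1 := (β.phi 0).slotLinear.map_zero [] [a]
  have h2 := (β.phi 0).slotLinear.map_zero [koszul 𝒜 1 a] []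
  rw [List.nil_append] at h1
  rw [List.singleton_append] at h2
  rw [incl_apply, incl_apply, d_phi, MultiOp.lin_apply]
  simp [sumIns, sumMul, curvTerm, ins, splitSum_cons, phi_zero_nil, h0, h1, h2]

theorem incl_injective : Function.Injective β.incl := by
  -- A left inverse needs the right values only on `1` and on single letters `τ(0,[v])`; all other
  -- values are arbitrary.
  let r : CobarAlg K β.Ix →ₗ[K] V := lift fun w _ =>
    match w with
    | [] => A.e
    | ⟨(0, [v]), _⟩ :: _ => β.vec v
    | _ => 0
  have : r ∘ₗ β.incl = LinearMap.id := by
    refine β.basis.ext fun i => ?_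
    rw [LinearMap.comp_apply, LinearMap.id_apply]
    by_cases hi : i = β.unit
    · rw [hi, β.basis_unit, incl_unit, ← wd_nil_zero]
      exact lift_wd _ _ _
    · refine (congrArg r ((β.incl_vec ⟨i, hi⟩).trans (tau_eq (by simp)))).trans ?_
      exact lift_wd _ _ _
  exact Function.LeftInverse.injective (g := r) fun a => LinearMap.congr_fun this a

theorem box_incl (a : V) : β.box (β.incl a) = 0 := by
  rw [box_apply, h_incl, ← d_incl, h_incl, map_zero, add_zero]

theorem box_sub_free {w : List (Letter β.Ix)} {k n : ℕ} (hw : StartsFree w)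
    (hn : listWt w + 4 * k = n + 1) :
    β.box (wd K w k) - wd K w k ∈ fil K β.Ix (3 * (n + 1) + 1) := by
  have hcons : ∀ c (w : List (Letter β.Ix)), (wd K (c :: w) k : CobarAlg K β.Ix) =
      tau c.1.1 c.1.2 * wd K w k := fun c w => by
    rw [tau_letter, wd_mul, zero_add]
    rfl
  match w with
  | [] =>
    obtain _ | k := k
    · simp at hn
    · rw [listWt_nil] at hn
      exact wtFil_le_fil (by omega) (β.box_sub_wd_nil k)
  | ⟨(0, _), _⟩ :: _ => exact absurd rfl hw
  | [⟨(1, []), _⟩] =>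
    rw [hcons]
    simp only [listWt_cons, listWt_nil, letterWt, List.length_nil] at hn
    exact wtFil_le_fil (by omega) (β.box_sub_q_mul_wd_nil k)
  | ⟨(1, []), _⟩ :: ⟨(m, u), hc⟩ :: w =>
    rw [hcons, hcons]
    simp only [listWt_cons, letterWt, List.length_nil] at hn
    exact β.box_sub_q_mul_tau hc (wd_mem_wtFil le_rfl) (by omega)
  | ⟨(m + 2, u), _⟩ :: w =>
    rw [hcons]
    simp only [listWt_cons, letterWt] at hn
    exact β.box_sub_tau_succ (m := m + 1) (by simp) (wd_mem_wtFil le_rfl) (by dsimp only; omega)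
  | ⟨(1, x :: u), _⟩ :: w =>
    rw [hcons]
    simp only [listWt_cons, letterWt] at hn
    exact β.box_sub_tau_succ (m := 0) (by simp) (wd_mem_wtFil le_rfl) (by dsimp only; omega)

/-- On `1` and `τ(0,[v])` the operator `box` is zero, so there the error is minus the word itself.
This is where the summand `range incl` is needed. -/
theorem box_sub_mem (w : List (Letter β.Ix)) (k : ℕ) :
    β.box (wd K w k) - wd K w k ∈
      fil K β.Ix (3 * (listWt w + 4 * k) + cls w - 1) ⊔ LinearMap.range β.incl := by
  have hcons : ∀ c (w : List (Letter β.Ix)), (wd K (c :: w) k : CobarAlg K β.Ix) =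
      tau c.1.1 c.1.2 * wd K w k := fun c w => by
    rw [tau_letter, wd_mul, zero_add]
    rfl
  have htriv : ∀ w : List (Letter β.Ix), listWt w + 4 * k = 0 → w = [] ∧ k = 0 := fun w h => by
    match w with
    | [] => exact ⟨rfl, by omega⟩
    | c :: w => simp [letterWt] at h
  by_cases hw : StartsFree w
  · match hn : listWt w + 4 * k with
    | 0 =>
      obtain ⟨rfl, rfl⟩ := htriv w hn
      rw [wd_nil_zero, ← β.incl_unit, box_incl, zero_sub]
      exact Submodule.mem_sup_right (Submodule.neg_mem _ ⟨_, rfl⟩)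
    | n + 1 =>
      have hcls : cls w = 2 := by
        match w with
        | [] => rfl
        | c :: w => exact if_pos hw
      rw [hcls]
      exact Submodule.mem_sup_left (β.box_sub_free hw hn)
  match w with
  | [] => exact absurd trivial hw
  | ⟨(_ + 1, _), _⟩ :: _ => exact absurd (by simp [StartsFree]) hw
  | ⟨(0, []), hc⟩ :: _ => exact absurd rfl hc
  | ⟨(0, v :: x :: u), hc⟩ :: w =>
    refine Submodule.mem_sup_left ?_
    rw [hcons]
    refine wtFil_le_fil ?_ (β.box_sub_tau_long v (List.cons_ne_nil x u) (wd_mem_wtFil le_rfl))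
    simp [letterWt]
    omega
  | ⟨(0, [v]), hc⟩ :: w =>
    rw [hcons]
    by_cases hw' : StartsFree w
    · have hcls : cls (⟨(0, [v]), hc⟩ :: w) = 1 := by simp [cls, hw']
      rw [hcls]
      match hn : listWt w + 4 * k with
      | 0 =>
        obtain ⟨rfl, rfl⟩ := htriv w hn
        rw [wd_nil_zero, mul_one, ← incl_vec, box_incl, zero_sub]
        exact Submodule.mem_sup_right (Submodule.neg_mem _ ⟨_, rfl⟩)
      | n + 1 =>
        refine Submodule.mem_sup_left (fil_mono ?_ (β.box_sub_tau_single_mul v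
          (Submodule.subset_span ⟨w, k, hw', hn.le, rfl⟩) (β.box_sub_free hw' hn)))
        simp [letterWt]
        omega
    · refine Submodule.mem_sup_left ?_
      match w with
      | [] => exact absurd trivial hw'
      | ⟨(_ + 1, _), _⟩ :: _ => exact absurd (by simp [StartsFree]) hw'
      | ⟨(0, u), hu⟩ :: w =>
        rw [hcons]
        refine wtFil_le_fil ?_ (β.box_sub_tau_tau v (u := u) (by simpa using hu)
          (wd_mem_wtFil le_rfl))
        simp [letterWt]
        omega

theorem fil_zero : fil K β.Ix 0 = ⊥ := by
  refine (Submodule.span_eq_bot).2 ?_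
  rintro _ ⟨w, k, hw, -⟩
  match w with
  | [] => simp [cls] at hw
  | c :: w => simp [letterWt] at hw

theorem box_sub_mem_of_mem_fil {n : ℕ} {x : CobarAlg K β.Ix} (hx : x ∈ fil K β.Ix (n + 1)) :
    β.box x - x ∈ fil K β.Ix n ⊔ LinearMap.range β.incl := by
  have : fil K β.Ix (n + 1) ≤
      (fil K β.Ix n ⊔ LinearMap.range β.incl).comap (β.box - LinearMap.id) := by
    refine Submodule.span_le.2 ?_
    rintro _ ⟨w, k, hw, rfl⟩
    have h : fil K β.Ix (3 * (listWt w + 4 * k) + cls w - 1) ≤ fil K β.Ix n := fil_mono (by omega)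
    exact sup_le_sup_right h _ (β.box_sub_mem w k)
  exact this hx

theorem exists_mem_fil (x : CobarAlg K β.Ix) : ∃ n, x ∈ fil K β.Ix n := by
  have hx : x ∈ Submodule.span K {x : CobarAlg K β.Ix | ∃ w k, x = wd K w k} := by
    rw [span_wd]; trivial
  induction hx using Submodule.span_induction with
  | mem x hx =>
    obtain ⟨w, k, rfl⟩ := hx
    exact ⟨_, Submodule.subset_span ⟨w, k, le_rfl, rfl⟩⟩
  | zero => exact ⟨0, Submodule.zero_mem _⟩
  | add x y _ _ hx hy =>
    obtain ⟨m, hx⟩ := hx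
    obtain ⟨n, hy⟩ := hy
    exact ⟨max m n, Submodule.add_mem _ (fil_mono (le_max_left _ _) hx)
      (fil_mono (le_max_right _ _) hy)⟩
  | smul c x _ hx =>
    obtain ⟨n, hx⟩ := hx
    exact ⟨n, Submodule.smul_mem _ _ hx⟩

/-- `h` kills `dz`, so `box z = d (h z)` is exact, and it differs from `z` by an element of the
image of `A` and a remainder `y` one step lower. Again `dy` lies in the image of `A`, so the
induction on the filtration continues with `y`. -/
theorem mem_sup_of_d_mem (z : CobarAlg K β.Ix) (hz : β.d z ∈ LinearMap.range β.incl) :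
    z ∈ LinearMap.range β.d ⊔ LinearMap.range β.incl := by
  obtain ⟨n, hn⟩ := β.exists_mem_fil z
  induction n generalizing z with
  | zero =>
    rw [fil_zero, Submodule.mem_bot] at hn
    rw [hn]
    exact Submodule.zero_mem _
  | succ n ih =>
    obtain ⟨y, hy, _, ⟨a, rfl⟩, hya⟩ := Submodule.mem_sup.1 (β.box_sub_mem_of_mem_fil hn)
    have hbox : β.box z = β.d (β.h z) := by
      obtain ⟨a', ha'⟩ := hz
      rw [box_apply, ← ha', h_incl, add_zero]
    have hy' : y = β.d (β.h z) - z - β.incl a := by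
      rw [← hbox, ← hya]
      abel
    have hdy : β.d y ∈ LinearMap.range β.incl := by
      rw [hy', map_sub, map_sub, d_d, ← d_incl, zero_sub]
      exact Submodule.sub_mem _ (Submodule.neg_mem _ hz) ⟨_, rfl⟩
    have hzy : z = β.d (β.h z) - y - β.incl a := by
      rw [hy']
      abel
    rw [hzy]
    exact Submodule.sub_mem _ (Submodule.sub_mem _ (Submodule.mem_sup_left ⟨_, rfl⟩)
      (ih y hdy hy)) (Submodule.mem_sup_right ⟨_, rfl⟩)

end UnitalBasis

/-! ### Transport along an isomorphism of algebras -/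

section Transport

variable {K : Type*} [Field K] {B : Type*} [Ring B] [Algebra K B] {B' : Type*} [Ring B']
  [Algebra K B'] (e : B ≃ₐ[K] B')

/-- The image of a grading under an isomorphism. -/
def mapGrading (ℬ : ℤ → Submodule K B) (n : ℤ) : Submodule K B' :=
  (ℬ n).comap e.symm.toLinearMap

variable (ℬ : ℤ → Submodule K B)

theorem mem_mapGrading {n : ℤ} {x : B'} : x ∈ mapGrading e ℬ n ↔ e.symm x ∈ ℬ n := Iff.rfl

theorem apply_mem_mapGrading {n : ℤ} {x : B} : e x ∈ mapGrading e ℬ n ↔ x ∈ ℬ n := by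
  rw [mem_mapGrading, AlgEquiv.symm_apply_apply]

variable [GradedAlgebra ℬ]

/-- The restriction of an isomorphism to a homogeneous component. -/
def toMapGrading (n : ℤ) : ℬ n →ₗ[K] mapGrading e ℬ n :=
  e.toLinearMap.restrict fun _ hx => (apply_mem_mapGrading e ℬ).2 hx

instance : GradedAlgebra (mapGrading e ℬ) where
  one_mem := by
    rw [mem_mapGrading, map_one]
    exact SetLike.one_mem_graded ℬ
  mul_mem m n x y hx hy := by
    rw [mem_mapGrading, map_mul]
    exact SetLike.mul_mem_graded (A := ℬ) hx hy
  toDecomposition := Decomposition.ofLinearMap _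
    (lmap (toMapGrading e ℬ) ∘ₗ (decomposeLinearEquiv ℬ).toLinearMap ∘ₗ e.symm.toLinearMap)
    (by
      have h : DirectSum.coeLinearMap (mapGrading e ℬ) ∘ₗ lmap (toMapGrading e ℬ) =
          e.toLinearMap ∘ₗ DirectSum.coeLinearMap ℬ := by
        ext n x
        simp only [LinearMap.comp_apply, lmap_lof, coeLinearMap_lof]
        rfl
      rw [← LinearMap.comp_assoc, h]
      ext x
      simp only [LinearMap.comp_apply, LinearMap.id_apply]
      have h2 : DirectSum.coeLinearMap ℬ (decompose ℬ (e.symm x)) = e.symm x :=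
        (decompose ℬ).symm_apply_apply _
      exact (congrArg e h2).trans (e.apply_symm_apply x))
    (by
      ext n x : 2
      simp only [LinearMap.comp_apply, LinearMap.id_apply, coeLinearMap_lof]
      have h2 : decomposeLinearEquiv ℬ (e.symm x) = lof K ℤ (fun n => ℬ n) n ⟨e.symm x, x.2⟩ :=
        decompose_of_mem ℬ x.2
      refine (congrArg (lmap (toMapGrading e ℬ)) h2).trans ?_
      rw [lmap_lof]
      congr 1
      exact Subtype.ext (e.apply_symm_apply _))

variable {ℬ}

theorem degSign_mapGrading (x : B) : degSign (mapGrading e ℬ) (e x) = e (degSign ℬ x) := by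
  refine linearMap_ext_homogeneous (𝒜 := ℬ) (f := degSign (mapGrading e ℬ) ∘ₗ e.toLinearMap)
    (g := e.toLinearMap ∘ₗ degSign ℬ) (fun n a ha => ?_) x
  rw [LinearMap.comp_apply, LinearMap.comp_apply, signOp_of_mem _ _ ha, map_zsmul]
  exact signOp_of_mem _ _ ((apply_mem_mapGrading e ℬ).2 ha)

namespace DGStructure

variable (D : DGStructure ℬ)

/-- The image of a dga structure under an isomorphism. -/
def map : DGStructure (mapGrading e ℬ) where
  d := e.toLinearMap ∘ₗ D.d ∘ₗ e.symm.toLinearMap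
  d_mem n a ha := (apply_mem_mapGrading e ℬ).2 (D.d_mem n _ ha)
  d_d a := by simp [D.d_d]
  leibniz n a b ha := by
    have := D.leibniz n (e.symm a) (e.symm b) ha
    simp [this]

theorem map_d_apply (x : B) : (D.map e).d (e x) = e (D.d x) :=
  congrArg (fun y => e (D.d y)) (e.symm_apply_apply x)

variable {D}

theorem IsCentral.map {W : B} (hW : D.IsCentral W) : (D.map e).IsCentral (e W) where
  mem := (apply_mem_mapGrading e ℬ).2 hW.mem
  closed := by rw [map_d_apply, hW.closed, map_zero]
  comm a := by
    obtain ⟨a, rfl⟩ := e.surjective a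
    rw [← map_mul, hW.comm, map_mul]

end DGStructure

end Transport

/-! ### The universal homomorphism after transport, and the size of its target. -/

namespace UnitalBasis

open CobarAlg

variable {K : Type u} [Field K] {V : Type v} [AddCommGroup V] [Module K V]
  {𝒜 : ℤ → Submodule K V} [Decomposition 𝒜] {A : CurvedAInfAlgebra 𝒜} (β : UnitalBasis A)
  {B : Type*} [Ring B] [Algebra K B] (e : CobarAlg K β.Ix ≃ₐ[K] B)

/-- The composition of the universal homomorphism with an isomorphism. -/
def homOfEquiv : CurvedAInfHom A ((β.dg.map e).curved (β.isCentral_W.map e)) :=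
  .ofDG (β.dg.map e) (β.isCentral_W.map e)
    (fun m d => e.toLinearMap.compMultilinearMap (β.phi m d))
    (fun m d n a ha => (apply_mem_mapGrading e β.gr).2 (β.phi_degree m d n a ha))
    ((congrArg e β.phi_zero_nil).trans (map_zero e))
    (fun m l => by
      refine (β.dg.map_d_apply e _).trans ((congrArg e (β.d_phi m l)).trans ?_)
      rw [map_sub, map_sub, sumIns, sumMul, curvTerm, map_sum, map_sum]
      refine congrArg₂ _ (congrArg₂ _ (sum_congr rfl fun p _ => ?_)
        (sum_congr rfl fun p _ => ?_)) ?_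
      · exact map_ins e.toLinearMap _ _ _ _
      · rw [map_splitSum]
        refine splitSum_congr fun u v _ => ?_
        rw [map_mul, ← degSign_mapGrading]
        rfl
      · split_ifs <;> simp)
    (fun m => (congrArg e (β.phi_unit m)).trans (by split_ifs <;> simp))
    (fun m l hl h => (congrArg e (β.phi_unit_other m l hl h)).trans (map_zero e))

theorem homOfEquiv_isFilteredQuasiIso : (β.homOfEquiv e).IsFilteredQuasiIso := by
  have hinj : Function.Injective (e.toLinearMap ∘ₗ β.incl) := e.injective.comp β.incl_injective
  refine isQuasiIso_of_injective (d' := (β.dg.map e).d) (f := e.toLinearMap ∘ₗ β.incl)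
    (β.dg.map e).d_d (fun a => ?_) hinj (fun z hz => ?_)
  · exact (congrArg e (β.d_incl a)).trans (β.dg.map_d_apply e _).symm
  · obtain ⟨z, rfl⟩ := e.surjective z
    obtain ⟨a, ha⟩ := hz
    rw [β.dg.map_d_apply e] at ha
    obtain ⟨_, ⟨b, rfl⟩, _, ⟨a', rfl⟩, hba⟩ :=
      Submodule.mem_sup.1 (β.mem_sup_of_d_mem z ⟨a, e.injective ha⟩)
    refine Submodule.mem_sup.2 ⟨_, ⟨e b, rfl⟩, _, ⟨a', rfl⟩, ?_⟩
    rw [β.dg.map_d_apply e]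
    exact (map_add e _ _).symm.trans (congrArg e hba)

/-- `K` embeds into `V` as the multiples of the unit vector, and an element of the free algebra is
determined by its coefficients. The algebra can thus be moved to the universe of `V`. -/
theorem small_cobarAlg : Small.{v} (CobarAlg K β.Ix) := by
  have hK : Small.{v} K := by
    refine small_of_injective (f := fun k : K => k • β.basis β.unit) ?_
    exact smul_left_injective K (β.basis.ne_zero _)
  exact small_of_injective (f := fun (x : CobarAlg K β.Ix) (w : CobarWord β.Ix) => x.coeff w)
    fun x y h => AddMonoidAlgebra.coeff_injective (DFunLike.coe_injective h)

end UnitalBasis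

end

/-! ### The theorem. -/

theorem mainTheorem5 {K : Type u} [Field K] {V : Type v} [AddCommGroup V] [Module K V]
    (𝒜 : ℤ → Submodule K V) [Decomposition 𝒜] (A : CurvedAInfAlgebra 𝒜)
    (hHH : ∀ k : ℤ, k < 0 → Subsingleton (A.reduction.HH (2 * k))) :
    ∃ (B : Type v) (_ : Ring B) (_ : Algebra K B) (ℬ : ℤ → Submodule K B) (_ : GradedAlgebra ℬ)
      (D : DGStructure ℬ) (W : B) (hW : D.IsCentral W),
      (Nontrivial V → Nontrivial B) ∧
        ∃ Φ : CurvedAInfHom A (D.curved hW), Φ.IsFilteredQuasiIso := by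
  rcases subsingleton_or_nontrivial V with hV | hV
  -- If `V = 0`, then `e = 0` is not part of a basis; the zero algebra serves as `B`.
  · let ℬ : ℤ → Submodule K PUnit.{v + 1} := fun _ => ⊤
    let _ : GradedAlgebra ℬ :=
      { one_mem := trivial
        mul_mem := fun _ _ _ _ _ _ => trivial
        decompose' := fun _ => (0 : ⨁ n, ℬ n)
        left_inv := fun _ => Subsingleton.elim _ _
        right_inv := fun _ => Subsingleton.elim _ _ }
    let D : DGStructure ℬ :=
      { d := 0
        d_mem := fun _ _ _ => trivial
        d_d := fun _ => rfl
        leibniz := fun _ _ _ _ => Subsingleton.elim _ _ }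
    have hW : D.IsCentral PUnit.unit := ⟨trivial, rfl, fun _ => rfl⟩
    refine ⟨PUnit, inferInstance, inferInstance, ℬ, inferInstance, D, PUnit.unit, hW,
      fun h => absurd hV (not_subsingleton_iff_nontrivial.2 h), ?_⟩
    refine ⟨.ofDG D hW (fun _ _ => 0) (fun _ _ _ _ _ => trivial) rfl
      (fun _ _ => Subsingleton.elim _ _) (fun _ => Subsingleton.elim _ _)
      (fun _ _ _ _ => Subsingleton.elim _ _), ?_⟩
    refine isQuasiIso_of_injective (fun _ => Subsingleton.elim _ _)
      (fun _ => Subsingleton.elim _ _) (Function.injective_of_subsingleton _) (fun z _ => ?_)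
    rw [Subsingleton.elim z 0]
    exact Submodule.zero_mem _
  · obtain ⟨β⟩ := A.nonempty_unitalBasis
    have := β.small_cobarAlg
    let e : CobarAlg K β.Ix ≃ₐ[K] Shrink.{v} (CobarAlg K β.Ix) := (Shrink.algEquiv K _).symm
    exact ⟨_, inferInstance, inferInstance, mapGrading e β.gr, inferInstance, β.dg.map e,
      e CobarAlg.W, β.isCentral_W.map e, fun _ => e.injective.nontrivial, β.homOfEquiv e,
      β.homOfEquiv_isFilteredQuasiIso e⟩
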